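/- **Two-dimensional Dyson Lemma.** Let $\Lambda=[0,L]^2$ with opposite sides identified, with distance $d(x,y)=\min_{k\in\mathbb{Z}^2}|x-y-kL|$, and let $0<R_0<R<L/2$. Sums over $p$ run over $\frac{2\pi}{L}\mathbb{Z}^2$. *Interaction.* Let $\tilde v:[0,\infty)\to[0,\infty]$ be measurable with $\tilde v(r)=0$ for $r>R_0$, and with scattering length $\tilde a>0$. That is, for $R_1>R_0$, $$\frac{2\pi}{\ln(R_1/\tilde a)}=\inf_g\int_{B_{R_1}}\Big(|\nabla g|^2+\tfrac12\tilde v(|x|)\,|g|^2\Big)dx ,\qquad 0<\tilde a<R_1,$$ where $B_{R_1}\subset\mathbb{R}^2$ is the disk of radius $R_1$ centered at the origin and the infimum is over $g\in H^1(B_{R_1})$ with $g=1$ on $\partial B_{R_1}$. (The value of $\tilde a$ does not depend on the choice of $R_1$.) *Momentum cutoff.* Let $\chi:\mathbb{R}^2\to[0,1]$ be radial with $\sum_p(1-\chi(p))<\infty$, and define $$h(x)=\frac{2\pi}{|\Lambda|}\sum_p(1-\chi(p))\,e^{-ipx},\qquad f_R(x)=\sup_{|y|\le R}|h(x-y)-h(x)|,\qquad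 w_R(x)=\frac{2}{\pi}\,f_R(x)\int_\Lambda f_R(y)\,dy .$$ With this normalization of $h$, the operator $1-\chi(p)$ is convolution with $(2\pi)^{-1}h$ on $\Lambda$. *Soft potential.* Let $U_R\ge 0$ be a measurable function supported in $[R_0,R]$ with $\int_{R_0}^R U_R(t)\ln(t/\tilde a)\,t\,dt\le 1$. Let $n\ge1$, let $y_1,\dots,y_n\in\Lambda$, and let $y_{\mathrm{NN}}(x)$ denote a nearest neighbor of $x\in\Lambda$ among the $y_i$ with respect to $d$. Then for every $\epsilon>0$, $$-\nabla\chi(p)^2\nabla+\frac12\sum_{i=1}^n\tilde v(d(x,y_i))\ \ge\ (1-\epsilon)\,U_R\big(d(x,y_{\mathrm{NN}}(x))\big)-\frac1\epsilon\int_{\mathbb{R}_+}U_R(t)\,t\,dt\ \sum_{i=1}^n w_R(x-y_i)$$ in the sense of quadratic forms on $L^2(\Lambda)$, where forms of nonnegative operators take values in $[0,\infty]$. -/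

import Mathlib

open MeasureTheory
open scoped ENNReal NNReal ContDiff

namespace Dyson

noncomputable section

/-- The Euclidean plane. -/
abbrev Plane : Type := EuclideanSpace ℝ (Fin 2)

/-! ### The torus of side length `L`

Points of the torus are represented by points of the plane; the distance, the kernel `h` and the
weight `w` below depend on `x - y` only modulo `L ℤ²`. Functions on the torus are functions on the
fundamental square. -/

/-- The square `[0, L]²`. -/
def torus (L : ℝ) : Set Plane := {x | ∀ i, x i ∈ Set.Icc 0 L}

/-- The torus distance, the minimum of `|x - y - k L|` over `k ∈ ℤ²`. -/
def torusDist (L : ℝ) (x y : Plane) : ℝ :=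
  ⨅ k : Fin 2 → ℤ, ‖x - y - L • (WithLp.toLp 2 (fun i => (k i : ℝ)) : Plane)‖

/-- The momentum `p = (2π / L) k`, `k ∈ ℤ²`. -/
def momentum (L : ℝ) (k : Fin 2 → ℤ) : Plane :=
  WithLp.toLp 2 (fun i => 2 * Real.pi / L * (k i : ℝ))

/-- The plane wave `e^{-ipx}`. -/
def planeWave (p x : Plane) : ℂ := Complex.exp (-(Complex.I * ((inner ℝ p x : ℝ) : ℂ)))

/-- The quadratic form of `-∇ χ(p)² ∇` on `L²` of the torus, with values in `[0, ∞]`: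
`L⁻² ∑_p |p|² χ(p)² |∫ ψ(x) e^{-ipx} dx|²`, where `p` runs over `(2π / L) ℤ²`. -/
def kineticForm (L : ℝ) (χ : Plane → ℝ) (ψ : Plane → ℂ) : ℝ≥0∞ :=
  ∑' k : Fin 2 → ℤ, ENNReal.ofReal
    (1 / L ^ 2 * (‖momentum L k‖ ^ 2 * χ (momentum L k) ^ 2
      * ‖∫ x in torus L, ψ x * planeWave (momentum L k) x‖ ^ 2))

/-- The quadratic form of multiplication by a potential `V ≥ 0`. -/
def potentialForm (L : ℝ) (V : Plane → ℝ≥0∞) (ψ : Plane → ℂ) : ℝ≥0∞ :=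
  ∫⁻ x in torus L, V x * ‖ψ x‖ₑ ^ 2

/-! ### The scattering length -/

/-- `g` is in `H¹(B_R)` with gradient `G`, and `g = 1` on `∂B_R`. The identity is required for
all test functions `φ` on the plane. Those supported in `B_R` say that `G` is the weak gradient of
`g`; the others say, by Green's formula, that the trace of `g - 1` on `∂B_R` vanishes. -/
structure IsTrialFunction (R : ℝ) (g : Plane → ℝ) (G : Plane → Plane) : Prop where
  memLp : MemLp g 2 (volume.restrict (Metric.ball 0 R))
  memLp_grad : MemLp G 2 (volume.restrict (Metric.ball 0 R))
  weak_grad : ∀ φ : Plane → ℝ, ContDiff ℝ ∞ φ → HasCompactSupport φ → ∀ i : Fin 2,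
    ∫ x in Metric.ball (0 : Plane) R, (g x - 1) * fderiv ℝ φ x (EuclideanSpace.single i 1)
      = -∫ x in Metric.ball (0 : Plane) R, G x i * φ x

/-- The infimum of `∫_{B_R} |∇g|² + (v / 2) |g|²` over `g ∈ H¹(B_R)` with `g = 1` on `∂B_R`. -/
def scatteringEnergy (v : ℝ → ℝ≥0∞) (R : ℝ) : ℝ≥0∞ :=
  ⨅ (g : Plane → ℝ) (G : Plane → Plane) (_ : IsTrialFunction R g G),
    ∫⁻ x in Metric.ball (0 : Plane) R, (‖G x‖ₑ ^ 2 + v ‖x‖ / 2 * ‖g x‖ₑ ^ 2)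

/-- `a > 0` is the scattering length of `v`, a radial potential of range less than `R`: the
scattering energy in `B_R` is `2π / ln(R / a)`. (The number `a` so determined is the same for every
`R` that exceeds the range of `v`.) -/
def IsScatteringLength (v : ℝ → ℝ≥0∞) (R a : ℝ) : Prop :=
  0 < a ∧ a < R ∧ scatteringEnergy v R = ENNReal.ofReal (2 * Real.pi / Real.log (R / a))

/-! ### The error term -/

/-- The kernel `h(x) = (2π / L²) ∑_p (1 - χ(p)) e^{-ipx}`, where `p` runs over `(2π / L) ℤ²`; the
operator `1 - χ(p)` is convolution with `h / (2π)`. -/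
def kernelH (L : ℝ) (χ : Plane → ℝ) (x : Plane) : ℂ :=
  ((2 * Real.pi / L ^ 2 : ℝ) : ℂ) *
    ∑' k : Fin 2 → ℤ, ((1 - χ (momentum L k) : ℝ) : ℂ) * planeWave (momentum L k) x

/-- `f_R(x) = sup_{|y| ≤ R} |h(x - y) - h(x)|`. -/
def oscF (L : ℝ) (χ : Plane → ℝ) (R : ℝ) (x : Plane) : ℝ≥0∞ :=
  ⨆ y ∈ Metric.closedBall (0 : Plane) R, ‖kernelH L χ (x - y) - kernelH L χ x‖ₑ

/-- `w_R(x) = (2 / π) f_R(x) ∫ f_R`. -/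
def weightW (L : ℝ) (χ : Plane → ℝ) (R : ℝ) (x : Plane) : ℝ≥0∞ :=
  ENNReal.ofReal (2 / Real.pi) * oscF L χ R x * ∫⁻ y in torus L, oscF L χ R y

end

end Dyson

open Dyson

/-! Write ξ = χ(p)ψ. The kinetic form is ∫|∇ξ|², whereas the potential acts on ψ itself, and ψ - ξ
is the convolution of ψ with h / 2π. On a disk of radius R the function ψ - ξ varies only by an
amount that f_R controls. So a Dyson-type inequality for ξ can be traded for one for ψ at the price
of the error term. The torus is cut into nearest-neighbor cells. The part of a cell within distance
R of its center is star-shaped (`cell_star`), so it suffices to argue on each ray issuing from the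
center, keeping only the interaction with that center.

On a ray, let φ solve (r φ')' = W φ r for a bounded W ≤ v / 2, normalized so that the flux m = r φ'
equals 1 beyond the range. Then W φ r dr is a probability measure. Integrating the equation by parts
against ξ gives ψ(t) - z = ∫₀ᵗ (m ξ' + W φ ψ r) dr, where z is the average of (ψ - ξ)(t) - (ψ -
ξ)(r). The energy of φ in the disk of radius t is φ(t) on each ray, so Cauchy-Schwarz yields |ψ(t) -
z|² ≤ φ(t) ∫₀ᵗ (|ξ'|² + W |ψ|²) r dr (`exists_norm_sq_le`). Since |z| ≤ M, giving up a fraction ε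
bounds |ψ(t)|² up to an error M² / ε. Multiplying by U(t) t and integrating over t and the angle,
with ∫ U φ t dt ≤ 1, gives the inequality in one cell (`lintegral_cellPart_le`). A weighted
Cauchy-Schwarz inequality bounds 2π M² by the form of the weight w_R (`exists_error_bound`).

The scattering length enters through the size of φ. For W_N = min(v / 2, N + 1) the boundary values
φ_N(R₁) decrease to some l > 0. The limit of the φ_N, divided by l, is a trial function with energy
at most 2π / l (`scatteringEnergy_le`), hence l ≤ log(R₁ / a). Only this direction is needed. Beyond
the range every φ_N is a logarithm plus a constant, so φ_N(t) ≤ log(t / a) + δ for large N and all t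
≥ R₀ (`IsScatteringLength.exists_solution`).

The rest is approximation. Partial Fourier sums of ψ have no more kinetic energy than ψ, and forms
of bounded potentials are continuous on L² (`bounded_inequality`). Finally U is truncated and
multiplied by c < 1, which absorbs δ, and both changes are removed in the limit (`dyson_of_approx`).
-/

namespace Dyson

/-! ### The radial zero-energy scattering equation -/

/-- The flux `∫_0^s w u σ dσ` through the circle of radius `s`. -/
noncomputable def radialFlux (w u : ℝ → ℝ≥0∞) (s : ℝ) : ℝ≥0∞ :=
  ∫⁻ σ in Set.Ioc 0 s, w σ * u σ * ENNReal.ofReal σ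

/-- One Picard step for the radial equation `(r u')' = w u r`, `u(0) = 1`. -/
noncomputable def picardStep (w u : ℝ → ℝ≥0∞) (r : ℝ) : ℝ≥0∞ :=
  1 + ∫⁻ s in Set.Ioc 0 r, radialFlux w u s * ENNReal.ofReal s⁻¹

/-- The Picard iterates for the radial equation. -/
noncomputable def picardIter (w : ℝ → ℝ≥0∞) : ℕ → ℝ → ℝ≥0∞
  | 0 => 0
  | k + 1 => picardStep w (picardIter w k)

/-- The limit of the Picard iterates. -/
noncomputable def picardLimit (w : ℝ → ℝ≥0∞) (r : ℝ) : ℝ≥0∞ := ⨆ k, picardIter w k r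

lemma radialFlux_monotone (w u : ℝ → ℝ≥0∞) : Monotone (radialFlux w u) := fun _ _ h =>
  lintegral_mono_set (Set.Ioc_subset_Ioc_right h)

lemma picardStep_monotone (w u : ℝ → ℝ≥0∞) : Monotone (picardStep w u) := fun _ _ h =>
  add_le_add le_rfl (lintegral_mono_set (Set.Ioc_subset_Ioc_right h))

lemma radialFlux_mono {w u u' : ℝ → ℝ≥0∞} (h : u ≤ u') (s : ℝ) :
    radialFlux w u s ≤ radialFlux w u' s := by
  unfold radialFlux
  gcongr with σ
  exact h σ

lemma picardStep_mono {w u u' : ℝ → ℝ≥0∞} (h : u ≤ u') : picardStep w u ≤ picardStep w u' := by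
  intro r
  unfold picardStep
  gcongr with s
  exact radialFlux_mono h s

lemma picardIter_le_succ (w : ℝ → ℝ≥0∞) (k : ℕ) : picardIter w k ≤ picardIter w (k + 1) := by
  induction k with
  | zero => intro r; exact zero_le
  | succ k ih => exact picardStep_mono ih

lemma picardIter_monotone (w : ℝ → ℝ≥0∞) : Monotone (picardIter w) :=
  monotone_nat_of_le_succ (picardIter_le_succ w)

lemma picardIter_measurable (w : ℝ → ℝ≥0∞) (k : ℕ) : Measurable (picardIter w k) := by
  cases k with
  | zero => exact measurable_const
  | succ k => exact (picardStep_monotone w _).measurable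

/-- With E(r) = exp(N r² / 2), bounding the integrand of the flux by its value at s gives a flux of
at most N s² E(s). After division by s this is the derivative of E times s / s, and ∫₀ʳ N s E(s) ds
= E(r) - 1. So E is a supersolution of the Picard step, and the iterates stay below it. -/
lemma picardIter_le_exp {w : ℝ → ℝ≥0∞} {N : ℝ} (hN : 0 ≤ N) (hw : ∀ r, w r ≤ ENNReal.ofReal N)
    (k : ℕ) (r : ℝ) : picardIter w k r ≤ ENNReal.ofReal (Real.exp (N * r ^ 2 / 2)) := by
  induction k generalizing r with
  | zero => exact zero_le
  | succ k ih =>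
    have h1 : (1 : ℝ) ≤ Real.exp (N * r ^ 2 / 2) := Real.one_le_exp (by positivity)
    rcases le_or_gt r 0 with hr | hr
    · simp only [picardIter, picardStep, Set.Ioc_eq_empty (not_lt.2 hr), Measure.restrict_empty,
        lintegral_zero_measure, add_zero]
      simpa using h1
    have hflux : ∀ s ∈ Set.Ioc 0 r, radialFlux w (picardIter w k) s * ENNReal.ofReal s⁻¹
        ≤ ENNReal.ofReal (N * s * Real.exp (N * s ^ 2 / 2)) := by
      intro s hs
      have hs0 : 0 < s := hs.1
      have : radialFlux w (picardIter w k) s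
          ≤ ENNReal.ofReal (N * s ^ 2 * Real.exp (N * s ^ 2 / 2)) := by
        calc radialFlux w (picardIter w k) s
            ≤ ∫⁻ σ in Set.Ioc 0 s, ENNReal.ofReal (N * Real.exp (N * s ^ 2 / 2) * s) := by
              refine setLIntegral_mono measurable_const fun σ hσ => ?_
              rw [ENNReal.ofReal_mul (by positivity), ENNReal.ofReal_mul hN]
              gcongr
              · exact hw σ
              · refine (ih σ).trans (ENNReal.ofReal_le_ofReal (Real.exp_le_exp.2 ?_))
                have : σ ^ 2 ≤ s ^ 2 := pow_le_pow_left₀ hσ.1.le hσ.2 2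
                nlinarith
              · exact hσ.2
          _ = ENNReal.ofReal (N * s ^ 2 * Real.exp (N * s ^ 2 / 2)) := by
              rw [setLIntegral_const, Real.volume_Ioc, sub_zero, ← ENNReal.ofReal_mul (by positivity)]
              ring_nf
      calc _ ≤ ENNReal.ofReal (N * s ^ 2 * Real.exp (N * s ^ 2 / 2)) * ENNReal.ofReal s⁻¹ := by
            gcongr
        _ = _ := by
            rw [← ENNReal.ofReal_mul (by positivity)]
            congr 1
            field_simp
    calc picardIter w (k + 1) r
        ≤ 1 + ∫⁻ s in Set.Ioc 0 r, ENNReal.ofReal (N * s * Real.exp (N * s ^ 2 / 2)) :=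
          add_le_add le_rfl (setLIntegral_mono (by fun_prop) hflux)
      _ = 1 + ENNReal.ofReal (Real.exp (N * r ^ 2 / 2) - 1) := by
          have hd : ∀ x ∈ Set.uIcc 0 r, HasDerivAt (fun s => Real.exp (N * s ^ 2 / 2))
              (N * x * Real.exp (N * x ^ 2 / 2)) x := by
            intro x _
            have := (((hasDerivAt_pow 2 x).const_mul N).div_const 2).exp
            convert this using 1
            simp
            ring
          have hc : Continuous fun s : ℝ => N * s * Real.exp (N * s ^ 2 / 2) := by fun_prop
          rw [← ofReal_integral_eq_lintegral_ofReal (hc.integrableOn_Ioc)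
            ((ae_restrict_iff' measurableSet_Ioc).2 (ae_of_all _ fun s hs => by
              have := hs.1.le; positivity)),
            ← intervalIntegral.integral_of_le hr.le,
            intervalIntegral.integral_eq_sub_of_hasDerivAt hd (hc.intervalIntegrable _ _)]
          simp
      _ = _ := by
          rw [← ENNReal.ofReal_one, ← ENNReal.ofReal_add (by norm_num) (by linarith)]
          congr 1
          ring

lemma picardLimit_measurable (w : ℝ → ℝ≥0∞) : Measurable (picardLimit w) :=
  Measurable.iSup (picardIter_measurable w)

/-- Monotone convergence, once in the flux and once in the outer integral. Values in `[0, ∞]` spare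
all integrability questions until the exponential bound is used. -/
lemma picardLimit_eq {w : ℝ → ℝ≥0∞} (hw : Measurable w) (r : ℝ) :
    picardLimit w r = picardStep w (picardLimit w) r := by
  have hflux : ∀ s, radialFlux w (picardLimit w) s = ⨆ k, radialFlux w (picardIter w k) s := by
    intro s
    unfold radialFlux picardLimit
    rw [← lintegral_iSup]
    · refine lintegral_congr fun σ => ?_
      rw [ENNReal.mul_iSup, ENNReal.iSup_mul]
    · intro k
      have := picardIter_measurable w k
      fun_prop
    · intro i j hij σ
      have := picardIter_monotone w hij σ
      dsimp only
      gcongr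
  have hstep : picardStep w (picardLimit w) r = ⨆ k, picardStep w (picardIter w k) r := by
    unfold picardStep
    rw [← ENNReal.add_iSup]
    congr 1
    rw [← lintegral_iSup]
    · refine lintegral_congr fun s => ?_
      rw [hflux, ENNReal.iSup_mul]
    · intro k
      have := (radialFlux_monotone w (picardIter w k)).measurable
      fun_prop
    · intro i j hij s
      have := radialFlux_mono (w := w) (picardIter_monotone w hij) s
      dsimp only
      gcongr
  rw [hstep]
  refine le_antisymm (iSup_le fun k => ?_) (iSup_le fun k => le_iSup (fun k => picardIter w k r) (k+1))
  exact (picardIter_le_succ w k r).trans (le_iSup (fun k => picardStep w (picardIter w k) r) k)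

lemma picardLimit_le_exp {w : ℝ → ℝ≥0∞} {N : ℝ} (hN : 0 ≤ N) (hw : ∀ r, w r ≤ ENNReal.ofReal N)
    (r : ℝ) : picardLimit w r ≤ ENNReal.ofReal (Real.exp (N * r ^ 2 / 2)) :=
  iSup_le fun k => picardIter_le_exp hN hw k r

/-- `φ` solves the radial scattering equation `(r φ')' = W φ r` for a bounded potential `W` that is
supported in `(0, R₀]`, with flux `m(r) = r φ'(r)` equal to `1` outside of the support. -/
structure IsScatteringSolution (R₀ : ℝ) (W φ m : ℝ → ℝ) : Prop where
  measurable : Measurable W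
  nonneg : ∀ r, 0 ≤ W r
  bounded : ∃ C, ∀ r, W r ≤ C
  support : ∀ r, r ∉ Set.Ioc 0 R₀ → W r = 0
  flux : ∀ r, m r = ∫ s in (0 : ℝ)..r, W s * φ s * s
  hasDerivAt : ∀ r, HasDerivAt φ (m r / r) r
  continuous_deriv : Continuous fun r => m r / r
  flux_one : ∀ r, R₀ ≤ r → m r = 1
  pos : ∀ r, 0 < φ r

/-- The Picard limit is finite by the exponential bound, at least 1, and constant in flux beyond R₀.
Its total flux is positive because W does not vanish almost everywhere, so dividing by it normalizes
the flux to 1. -/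
theorem exists_isScatteringSolution {R₀ : ℝ} (hR₀ : 0 < R₀) {W : ℝ → ℝ} (hWm : Measurable W)
    (hW0 : ∀ r, 0 ≤ W r) {N : ℝ} (hWN : ∀ r, W r ≤ N) (hWs : ∀ r, r ∉ Set.Ioc 0 R₀ → W r = 0)
    (hW : ¬ W =ᵐ[volume.restrict (Set.Ioc 0 R₀)] 0) :
    ∃ φ m, IsScatteringSolution R₀ W φ m := by
  have hN : 0 ≤ N := (hW0 0).trans (hWN 0)
  set w : ℝ → ℝ≥0∞ := fun r => ENNReal.ofReal (W r) with hw
  have hwm : Measurable w := hWm.ennreal_ofReal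
  have hwN : ∀ r, w r ≤ ENNReal.ofReal N := fun r => ENNReal.ofReal_le_ofReal (hWN r)
  set u := picardLimit w with hu
  have hueq : ∀ r, u r = 1 + ∫⁻ s in Set.Ioc 0 r, radialFlux w u s * ENNReal.ofReal s⁻¹ :=
    fun r => picardLimit_eq hwm r
  have hutop : ∀ r, u r ≠ ⊤ := fun r =>
    ((picardLimit_le_exp hN hwN r).trans_lt ENNReal.ofReal_lt_top).ne
  set f : ℝ → ℝ := fun r => (u r).toReal with hf
  have hfu : ∀ r, ENNReal.ofReal (f r) = u r := fun r => ENNReal.ofReal_toReal (hutop r)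
  have hfm : Measurable f := (picardLimit_measurable w).ennreal_toReal
  have hf1 : ∀ r, 1 ≤ f r := fun r => by
    have : (1 : ℝ≥0∞) ≤ u r := by rw [hueq]; exact le_self_add
    simpa using ENNReal.toReal_mono (hutop r) this
  have hfexp : ∀ r, f r ≤ Real.exp (N * r ^ 2 / 2) := fun r =>
    ENNReal.toReal_le_of_le_ofReal (Real.exp_pos _).le (picardLimit_le_exp hN hwN r)
  set q : ℝ → ℝ := fun σ => W σ * f σ * σ with hq
  have hqm : Measurable q := by fun_prop
  have hqs : ∀ σ, σ ∉ Set.Ioc 0 R₀ → q σ = 0 := fun σ hσ => by simp [hq, hWs σ hσ]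
  have hq0 : ∀ σ, 0 ≤ q σ := fun σ => by
    by_cases hσ : σ ∈ Set.Ioc 0 R₀
    · have := hW0 σ; have := hf1 σ; have := hσ.1.le
      simp only [hq]; positivity
    · rw [hqs σ hσ]
  set K := N * Real.exp (N * R₀ ^ 2 / 2) with hK
  have hK0 : 0 ≤ K := by positivity
  have hqK : ∀ σ, q σ ≤ K * |σ| := fun σ => by
    by_cases hσ : σ ∈ Set.Ioc 0 R₀
    · have h1 : f σ ≤ Real.exp (N * R₀ ^ 2 / 2) := (hfexp σ).trans (Real.exp_le_exp.2 (by
        have : σ ^ 2 ≤ R₀ ^ 2 := pow_le_pow_left₀ hσ.1.le hσ.2 2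
        nlinarith))
      simp only [hq, hK]
      rw [abs_of_pos hσ.1]
      have := hW0 σ; have := hf1 σ; have := hσ.1.le; have := hWN σ
      gcongr
    · rw [hqs σ hσ]; positivity
  have hqi : Integrable q := by
    have : IntegrableOn q (Set.Ioc 0 R₀) := by
      refine Measure.integrableOn_of_bounded (M := K * R₀) (by simp) hqm.aestronglyMeasurable
        ((ae_restrict_iff' measurableSet_Ioc).2 (ae_of_all _ fun σ hσ => ?_))
      rw [Real.norm_of_nonneg (hq0 σ)]
      refine (hqK σ).trans ?_
      rw [abs_of_pos hσ.1]
      exact mul_le_mul_of_nonneg_left hσ.2 hK0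
    exact this.integrable_of_forall_notMem_eq_zero hqs
  set m : ℝ → ℝ := fun s => ∫ σ in (0 : ℝ)..s, q σ with hm
  have hmc : Continuous m := intervalIntegral.continuous_primitive (fun a b => hqi.intervalIntegrable) 0
  have hm0 : ∀ s, s ≤ 0 → m s = 0 := by
    intro s hs
    simp only [hm]
    rw [intervalIntegral.integral_symm, intervalIntegral.integral_of_le hs,
      setIntegral_eq_zero_of_forall_eq_zero, neg_zero]
    intro σ hσ
    exact hqs σ fun h => absurd h.1 (not_lt.2 hσ.2)
  -- The density is at most K|σ|, so the flux is quadratic at the origin. Thus m(s) / s tends to 0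
  -- there, which agrees with the value 0 of division by zero and makes φ' continuous on the whole
  -- line.
  have hmK : ∀ s, ‖m s‖ ≤ K * |s| * |s| := by
    intro s
    have := intervalIntegral.norm_integral_le_of_norm_le_const (a := 0) (b := s) (f := q)
      (C := K * |s|) (fun σ hσ => by
        rw [Real.norm_of_nonneg (hq0 σ)]
        refine (hqK σ).trans ?_
        gcongr ?_ * ?_
        rw [Set.mem_uIoc] at hσ
        rcases hσ with h | h
        · rw [abs_of_pos h.1]; exact h.2.trans (le_abs_self s)
        · rw [abs_of_nonpos h.2, abs_of_neg (h.1.trans_le h.2)]; linarith [h.1])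
    simpa using this
  have hmnn : ∀ s, 0 ≤ m s := by
    intro s
    rcases le_or_gt s 0 with h | h
    · rw [hm0 s h]
    · exact intervalIntegral.integral_nonneg h.le fun σ _ => hq0 σ
  have hdc : Continuous fun r => m r / r := by
    rw [continuous_iff_continuousAt]
    intro r
    rcases eq_or_ne r 0 with rfl | hr
    · rw [ContinuousAt, div_zero]
      refine squeeze_zero_norm (a := fun s => K * |s|) (fun s => ?_) ?_
      · rcases eq_or_ne s 0 with rfl | hs
        · simp
        · rw [norm_div, div_le_iff₀ (norm_pos_iff.2 hs)]
          exact hmK s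
      · have : Continuous fun s : ℝ => K * |s| := by fun_prop
        simpa using this.tendsto 0
    · exact hmc.continuousAt.div continuousAt_id hr
  have hfluxeq : ∀ s, 0 ≤ s → radialFlux w u s = ENNReal.ofReal (m s) := by
    intro s hs
    simp only [hm]
    rw [intervalIntegral.integral_of_le hs, ofReal_integral_eq_lintegral_ofReal hqi.integrableOn
      (ae_of_all _ hq0)]
    refine setLIntegral_congr_fun measurableSet_Ioc fun σ hσ => ?_
    simp only [hq, hw]
    rw [ENNReal.ofReal_mul (mul_nonneg (hW0 σ) (zero_le_one.trans (hf1 σ))),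
      ENNReal.ofReal_mul (hW0 σ), hfu]
  have hfeq : ∀ r, f r = 1 + ∫ s in (0 : ℝ)..r, m s / s := by
    intro r
    rcases le_or_gt r 0 with hr | hr
    · have h1 : u r = 1 := by
        rw [hueq, Set.Ioc_eq_empty (not_lt.2 hr)]; simp
      have h2 : ∫ s in (0 : ℝ)..r, m s / s = 0 := by
        rw [intervalIntegral.integral_symm, intervalIntegral.integral_of_le hr,
          setIntegral_eq_zero_of_forall_eq_zero, neg_zero]
        intro s hs
        simp [hm0 s hs.2]
      rw [h2]
      simp [hf, h1]
    · have hnn : 0 ≤ ∫ s in (0 : ℝ)..r, m s / s :=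
        intervalIntegral.integral_nonneg hr.le fun s hs => div_nonneg (hmnn s) hs.1
      have h1 : u r = ENNReal.ofReal (1 + ∫ s in (0 : ℝ)..r, m s / s) := by
        rw [hueq, ENNReal.ofReal_add zero_le_one hnn, ENNReal.ofReal_one,
          intervalIntegral.integral_of_le hr.le,
          ofReal_integral_eq_lintegral_ofReal hdc.integrableOn_Ioc
          ((ae_restrict_iff' measurableSet_Ioc).2
            (ae_of_all _ fun s hs => div_nonneg (hmnn s) hs.1.le))]
        congr 1
        refine setLIntegral_congr_fun measurableSet_Ioc fun s hs => ?_
        rw [hfluxeq s hs.1.le, ← ENNReal.ofReal_mul (hmnn s), div_eq_mul_inv]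
      simp only [hf]
      rw [h1, ENNReal.toReal_ofReal (by linarith)]
  have hfd : ∀ r, HasDerivAt f (m r / r) r := by
    intro r
    have := (hdc.integral_hasStrictDerivAt 0 r).hasDerivAt.const_add 1
    exact this.congr_of_eventuallyEq (Filter.Eventually.of_forall hfeq)
  have hmR : ∀ r, R₀ ≤ r → m r = m R₀ := by
    intro r hr
    have := intervalIntegral.integral_add_adjacent_intervals (a := 0) (b := R₀) (c := r)
      (hqi.intervalIntegrable) (hqi.intervalIntegrable)
    have h0 : ∫ σ in R₀..r, q σ = 0 := by
      rw [intervalIntegral.integral_of_le hr]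
      refine setIntegral_eq_zero_of_forall_eq_zero fun σ hσ => hqs σ fun h => ?_
      exact absurd h.2 (not_le.2 hσ.1)
    simp only [hm]
    rw [← this, h0, add_zero]
  have hFpos : 0 < m R₀ := by
    refine lt_of_le_of_ne (hmnn _) fun h => hW ?_
    have h' : ∫ σ in Set.Ioc 0 R₀, q σ = 0 := by
      rw [← intervalIntegral.integral_of_le hR₀.le]; exact h.symm
    rw [integral_eq_zero_iff_of_nonneg hq0 hqi.integrableOn] at h'
    filter_upwards [h', ae_restrict_mem measurableSet_Ioc] with σ hσ hσ'
    have h1 := hf1 σ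
    have h2 := hσ'.1
    have h3 : W σ * f σ * σ = 0 := hσ
    have : f σ * σ ≠ 0 := by positivity
    rw [mul_assoc] at h3
    exact (mul_eq_zero.1 h3).resolve_right this
  -- The equation is linear, so solution and flux are divided by the same constant.
  refine ⟨fun r => f r / m R₀, fun r => m r / m R₀, hWm, hW0, ⟨N, hWN⟩, hWs, ?_, ?_, ?_, ?_, ?_⟩
  · intro r
    rw [← intervalIntegral.integral_div]
    refine intervalIntegral.integral_congr fun s _ => ?_
    simp only [hq]
    ring
  · intro r
    have := (hfd r).div_const (m R₀)
    rwa [div_right_comm] at this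
  · exact (hdc.div_const (m R₀)).congr fun r => by ring
  · intro r hr
    rw [hmR r hr, div_self hFpos.ne']
  · intro r
    have := hf1 r
    positivity

namespace IsScatteringSolution

variable {R₀ : ℝ} {W φ m : ℝ → ℝ}

lemma continuous (h : IsScatteringSolution R₀ W φ m) : Continuous φ :=
  continuous_iff_continuousAt.2 fun r => (h.hasDerivAt r).continuousAt

lemma density_nonneg (h : IsScatteringSolution R₀ W φ m) (s : ℝ) : 0 ≤ W s * φ s * s := by
  by_cases hs : s ∈ Set.Ioc 0 R₀
  · have := h.nonneg s; have := h.pos s; have := hs.1.le; positivity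
  · simp [h.support s hs]

lemma intervalIntegrable_mul (h : IsScatteringSolution R₀ W φ m) {f : ℝ → ℝ} (hf : Continuous f)
    (a b : ℝ) : IntervalIntegrable (fun s => W s * f s) volume a b := by
  obtain ⟨C, hC⟩ := h.bounded
  have hW : IntervalIntegrable W volume a b := by
    rw [intervalIntegrable_iff]
    refine Measure.integrableOn_of_bounded (M := C) (by simp) h.measurable.aestronglyMeasurable
      (ae_of_all _ fun s => ?_)
    rw [Real.norm_of_nonneg (h.nonneg s)]
    exact hC s
  exact hW.mul_continuousOn hf.continuousOn

lemma intervalIntegrable_density (h : IsScatteringSolution R₀ W φ m) (a b : ℝ) :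
    IntervalIntegrable (fun s => W s * φ s * s) volume a b := by
  simpa only [mul_assoc] using
    h.intervalIntegrable_mul (f := fun s => φ s * s) (h.continuous.mul continuous_id) a b

lemma monotone_flux (h : IsScatteringSolution R₀ W φ m) : Monotone m := by
  intro a b hab
  rw [h.flux a, h.flux b, ← intervalIntegral.integral_add_adjacent_intervals
    (h.intervalIntegrable_density 0 a) (h.intervalIntegrable_density a b)]
  exact le_add_of_nonneg_right (intervalIntegral.integral_nonneg hab fun s _ => h.density_nonneg s)

lemma flux_zero (h : IsScatteringSolution R₀ W φ m) : m 0 = 0 := by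
  rw [h.flux, intervalIntegral.integral_same]

lemma monotoneOn (h : IsScatteringSolution R₀ W φ m) : MonotoneOn φ (Set.Ici 0) := by
  refine monotoneOn_of_deriv_nonneg (convex_Ici 0) h.continuous.continuousOn
    (fun r _ => (h.hasDerivAt r).differentiableAt.differentiableWithinAt) fun r hr => ?_
  rw [interior_Ici, Set.mem_Ioi] at hr
  rw [(h.hasDerivAt r).deriv]
  have := h.monotone_flux hr.le
  rw [h.flux_zero] at this
  positivity

/-- Outside of the support of the potential, the solution is a logarithm. -/
lemma eq_add_log (h : IsScatteringSolution R₀ W φ m) (hR₀ : 0 < R₀) {s t : ℝ} (hs : R₀ ≤ s)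
    (hst : s ≤ t) : φ t = φ s + Real.log (t / s) := by
  have hs0 : 0 < s := hR₀.trans_le hs
  have h1 : ∫ r in s..t, m r / r = φ t - φ s :=
    intervalIntegral.integral_eq_sub_of_hasDerivAt (fun r _ => h.hasDerivAt r)
      (h.continuous_deriv.intervalIntegrable _ _)
  have h2 : ∫ r in s..t, m r / r = ∫ r in s..t, 1 / r := by
    refine intervalIntegral.integral_congr fun r hr => ?_
    rw [Set.uIcc_of_le hst] at hr
    rw [h.flux_one r (hs.trans hr.1)]
  rw [integral_one_div_of_pos hs0 (hs0.trans_le hst)] at h2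
  linarith

/-- Testing the scattering equation on `[0, t]` against `f`. -/
lemma integral_flux_mul_deriv (h : IsScatteringSolution R₀ W φ m) {f f' : ℝ → ℝ}
    (hf : ∀ r, HasDerivAt f (f' r) r) (hf' : Continuous f') {t : ℝ} :
    ∫ r in (0 : ℝ)..t, m r * f' r + W r * φ r * r * f r = m t * f t := by
  have hfc : Continuous f := continuous_iff_continuousAt.2 fun r => (hf r).continuousAt
  have hmc : Continuous m := by
    have : m = fun r => ∫ s in (0 : ℝ)..r, W s * φ s * s := funext h.flux
    rw [this]
    exact intervalIntegral.continuous_primitive h.intervalIntegrable_density 0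
  -- W is only measurable, so m is differentiable only almost everywhere. Integration by parts
  -- therefore uses absolute continuity.
  have hmac : AbsolutelyContinuousOnInterval m 0 t := by
    have := (h.intervalIntegrable_density 0 t).absolutelyContinuousOnInterval_intervalIntegral
      (c := 0) Set.left_mem_uIcc
    convert this using 1
    exact funext h.flux
  have hfac : AbsolutelyContinuousOnInterval f 0 t := by
    have hc : ContDiff ℝ 1 f := by
      rw [contDiff_one_iff_deriv]
      refine ⟨fun r => (hf r).differentiableAt, ?_⟩
      rwa [funext fun r => (hf r).deriv]
    exact hc.contDiffOn.absolutelyContinuousOnInterval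
  have hd : ∀ᵐ r, r ∈ Set.uIoc 0 t → deriv m r = W r * φ r * r := by
    have := (h.intervalIntegrable_density 0 t).ae_hasDerivAt_integral
    filter_upwards [this] with r hr hr'
    have h1 := (hr (Set.uIoc_subset_uIcc hr') 0 Set.left_mem_uIcc).deriv
    rwa [← funext h.flux] at h1
  have h1 := hmac.integral_mul_deriv_eq_deriv_mul hfac
  have h2 : ∫ r in (0 : ℝ)..t, deriv m r * f r = ∫ r in (0 : ℝ)..t, W r * φ r * r * f r :=
    intervalIntegral.integral_congr_ae (hd.mono fun r hr hr' => by rw [hr hr'])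
  rw [h2, h.flux_zero, zero_mul, sub_zero, funext fun r => (hf r).deriv] at h1
  rw [intervalIntegral.integral_add, h1, sub_add_cancel]
  · exact (hmc.mul hf').intervalIntegrable _ _
  · exact (h.intervalIntegrable_density 0 t).mul_continuousOn hfc.continuousOn

end IsScatteringSolution

/-! ### The energy identity and the lower bound on a ray -/

namespace IsScatteringSolution

variable {R₀ : ℝ} {W φ m : ℝ → ℝ}

lemma continuous_flux (h : IsScatteringSolution R₀ W φ m) : Continuous m := by
  rw [funext h.flux]
  exact intervalIntegral.continuous_primitive h.intervalIntegrable_density 0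

lemma div_mul_self (h : IsScatteringSolution R₀ W φ m) (r : ℝ) : m r / r * r = m r := by
  rcases eq_or_ne r 0 with rfl | hr
  · simp [h.flux_zero]
  · exact div_mul_cancel₀ _ hr

/-- The energy of the scattering solution in the disk of radius `t`. -/
lemma integral_energy (h : IsScatteringSolution R₀ W φ m) (t : ℝ) :
    ∫ r in (0 : ℝ)..t, ((m r / r) ^ 2 + W r * φ r ^ 2) * r = m t * φ t := by
  rw [← h.integral_flux_mul_deriv h.hasDerivAt h.continuous_deriv]
  refine intervalIntegral.integral_congr fun r _ => ?_
  have := h.div_mul_self r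
  linear_combination (m r / r) * this

lemma intervalIntegrable_energy (h : IsScatteringSolution R₀ W φ m) {f' g : ℝ → ℝ}
    (hf' : Continuous f') (hg : Continuous g) (a b : ℝ) :
    IntervalIntegrable (fun r => (f' r ^ 2 + W r * g r ^ 2) * r) volume a b := by
  have h1 : IntervalIntegrable (fun r => f' r ^ 2 * r) volume a b :=
    Continuous.intervalIntegrable (by fun_prop) _ _
  have h2 := h.intervalIntegrable_mul (f := fun r => g r ^ 2 * r) (by fun_prop) a b
  refine (h1.add h2).congr fun r _ => ?_
  ring

lemma intervalIntegrable_flux_mul (h : IsScatteringSolution R₀ W φ m) {f' g : ℝ → ℝ}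
    (hf' : Continuous f') (hg : Continuous g) (a b : ℝ) :
    IntervalIntegrable (fun r => m r * f' r + W r * φ r * r * g r) volume a b := by
  have h1 : IntervalIntegrable (fun r => m r * f' r) volume a b :=
    (h.continuous_flux.mul hf').intervalIntegrable _ _
  exact h1.add ((h.intervalIntegrable_density a b).mul_continuousOn hg.continuousOn)

/-- Expansion of the energy around a multiple of the scattering solution. -/
lemma integral_energy_sub (h : IsScatteringSolution R₀ W φ m) {f' g : ℝ → ℝ}
    (hf' : Continuous f') (hg : Continuous g) (c t : ℝ) :
    ∫ r in (0 : ℝ)..t, ((f' r - c * (m r / r)) ^ 2 + W r * (g r - c * φ r) ^ 2) * r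
      = (∫ r in (0 : ℝ)..t, (f' r ^ 2 + W r * g r ^ 2) * r)
        - 2 * c * (∫ r in (0 : ℝ)..t, m r * f' r + W r * φ r * r * g r) + c ^ 2 * (m t * φ t) := by
  rw [← h.integral_energy, ← intervalIntegral.integral_const_mul,
    ← intervalIntegral.integral_const_mul, ← intervalIntegral.integral_sub,
    ← intervalIntegral.integral_add]
  · refine intervalIntegral.integral_congr fun r _ => ?_
    linear_combination (-2 * c * f' r) * h.div_mul_self r
  · exact (h.intervalIntegrable_energy hf' hg _ _).sub
      ((h.intervalIntegrable_flux_mul hf' hg _ _).const_mul _)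
  · exact (h.intervalIntegrable_energy h.continuous_deriv h.continuous _ _).const_mul _
  · exact h.intervalIntegrable_energy hf' hg _ _
  · exact (h.intervalIntegrable_flux_mul hf' hg _ _).const_mul _

/-- Cauchy-Schwarz inequality for the energy of the scattering solution. -/
lemma sq_integral_le (h : IsScatteringSolution R₀ W φ m) {f' g : ℝ → ℝ}
    (hf' : Continuous f') (hg : Continuous g) {t : ℝ} (ht0 : 0 ≤ t) (ht : R₀ ≤ t) :
    (∫ r in (0 : ℝ)..t, m r * f' r + W r * φ r * r * g r) ^ 2
      ≤ φ t * ∫ r in (0 : ℝ)..t, (f' r ^ 2 + W r * g r ^ 2) * r := by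
  set A := ∫ r in (0 : ℝ)..t, m r * f' r + W r * φ r * r * g r
  have hpos := h.pos t
  -- The coefficient A / φ(t) minimizes the quadratic in c from `integral_energy_sub`. Its
  -- nonnegative minimum is the Cauchy-Schwarz inequality.
  have h0 : 0 ≤ ∫ r in (0 : ℝ)..t,
      ((f' r - A / φ t * (m r / r)) ^ 2 + W r * (g r - A / φ t * φ r) ^ 2) * r := by
    refine intervalIntegral.integral_nonneg ht0 fun r hr => ?_
    have := h.nonneg r
    have := hr.1
    positivity
  rw [h.integral_energy_sub hf' hg, h.flux_one t ht] at h0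
  have h1 : φ t * (-(2 * (A / φ t) * A) + (A / φ t) ^ 2 * (1 * φ t)) = - A ^ 2 := by
    field_simp
    ring
  nlinarith [mul_nonneg hpos.le h0]

/-- The lower bound on a ray. The functions `ξ` and `ψ` are the restrictions to the ray of the
function with cutoff and of the full function. -/
lemma exists_norm_sq_le (h : IsScatteringSolution R₀ W φ m) {t : ℝ} (ht0 : 0 ≤ t) (ht : R₀ ≤ t)
    {ξ ξ' ψ : ℝ → ℂ} (hξ : ∀ r, HasDerivAt ξ (ξ' r) r) (hξ' : Continuous ξ') (hψ : Continuous ψ)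
    {M : ℝ} (hM : ∀ r ∈ Set.Icc 0 t, ‖(ψ t - ξ t) - (ψ r - ξ r)‖ ≤ M) :
    ∃ z : ℂ, ‖z‖ ≤ M ∧
      ‖ψ t - z‖ ^ 2 ≤ φ t * ∫ r in (0 : ℝ)..t, (‖ξ' r‖ ^ 2 + W r * ‖ψ r‖ ^ 2) * r := by
  have hξc : Continuous ξ := continuous_iff_continuousAt.2 fun r => (hξ r).continuousAt
  set ρ : ℝ → ℝ := fun r => W r * φ r * r with hρ
  have hρi : IntervalIntegrable ρ volume 0 t := h.intervalIntegrable_density 0 t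
  have hρ1 : ∫ r in (0 : ℝ)..t, ρ r = 1 := by rw [← h.flux, h.flux_one t ht]
  have hDc : Continuous fun r => (ψ t - ξ t) - (ψ r - ξ r) := by fun_prop
  have hDi : IntervalIntegrable (fun r => ρ r • ((ψ t - ξ t) - (ψ r - ξ r))) volume 0 t :=
    hρi.smul_continuousOn hDc.continuousOn
  -- This z is what remains of the boundary term when ξ is replaced by ψ in the tested equation. As
  -- ρ has total mass 1, z is an average of increments of ψ - ξ, whence the bound by M.
  set z : ℂ := ∫ r in (0 : ℝ)..t, ρ r • ((ψ t - ξ t) - (ψ r - ξ r)) with hz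
  refine ⟨z, ?_, ?_⟩
  · calc ‖z‖ ≤ ∫ r in (0 : ℝ)..t, ρ r * M := by
          refine intervalIntegral.norm_integral_le_of_norm_le ht0
            (ae_of_all _ fun r hr => ?_) (hρi.mul_const M)
          rw [norm_smul, Real.norm_of_nonneg (h.density_nonneg r)]
          exact mul_le_mul_of_nonneg_left (hM r ⟨hr.1.le, hr.2⟩) (h.density_nonneg r)
      _ = M := by rw [intervalIntegral.integral_mul_const, hρ1, one_mul]
  -- A phase c of modulus 1 makes c(ψ(t) - z) real and nonnegative. The functional x ↦ Re(c x) does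
  -- not increase norms, so the real Cauchy-Schwarz inequality suffices.
  obtain ⟨c, hc, hcz⟩ := RCLike.exists_norm_eq_mul_self (ψ t - z)
  set l : ℂ →L[ℝ] ℝ := Complex.reCLM.comp (ContinuousLinearMap.mul ℝ ℂ c) with hl
  have hl' : ∀ x, |l x| ≤ ‖x‖ := fun x => by
    have := Complex.abs_re_le_norm (c * x)
    rwa [norm_mul, hc, one_mul] at this
  have hlz : l (ψ t - z) = ‖ψ t - z‖ := by
    change (c * (ψ t - z)).re = _
    rw [← hcz]
    exact Complex.ofReal_re _
  have hlξ : ∀ r, HasDerivAt (fun r => l (ξ r)) (l (ξ' r)) r := fun r =>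
    l.hasFDerivAt.comp_hasDerivAt r (hξ r)
  have hlξ'c : Continuous fun r => l (ξ' r) := l.continuous.comp hξ'
  have hlψc : Continuous fun r => l (ψ r) := l.continuous.comp hψ
  have hlξc : Continuous fun r => l (ξ r) := l.continuous.comp hξc
  have hA : ∫ r in (0 : ℝ)..t, m r * l (ξ' r) + W r * φ r * r * l (ψ r) = ‖ψ t - z‖ := by
    have h1 := h.integral_flux_mul_deriv hlξ hlξ'c (t := t)
    have h2 : l z = l (ψ t - ξ t) - ∫ r in (0 : ℝ)..t, ρ r * l (ψ r - ξ r) := by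
      rw [hz, ← l.intervalIntegral_comp_comm hDi]
      simp only [map_smul, map_sub l (ψ t - ξ t), smul_eq_mul, mul_sub]
      rw [intervalIntegral.integral_sub (hρi.mul_const _)
        (hρi.mul_continuousOn (by
          have : Continuous fun r => l (ψ r - ξ r) := by fun_prop
          exact this.continuousOn)),
        intervalIntegral.integral_mul_const, hρ1, one_mul]
    rw [h.flux_one t ht, one_mul] at h1
    have h3 : ∀ x y J : ℝ, x - (x - y - J) = y + J := fun x y J => by ring
    rw [← hlz, map_sub, h2, map_sub, h3, ← h1, ← intervalIntegral.integral_add]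
    · refine intervalIntegral.integral_congr fun r _ => ?_
      simp only [hρ, map_sub]
      ring
    · exact h.intervalIntegrable_flux_mul hlξ'c hlξc _ _
    · exact hρi.mul_continuousOn (by
        have : Continuous fun r => l (ψ r - ξ r) := by fun_prop
        exact this.continuousOn)
  rw [← hA]
  refine (h.sq_integral_le hlξ'c hlψc ht0 ht).trans ?_
  refine mul_le_mul_of_nonneg_left ?_ (h.pos t).le
  refine intervalIntegral.integral_mono_on ht0 (h.intervalIntegrable_energy hlξ'c hlψc _ _)
    (h.intervalIntegrable_energy hξ'.norm hψ.norm _ _) fun r hr => ?_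
  have h0 := h.nonneg r
  have h1 := sq_le_sq.2 ((hl' (ξ' r)).trans (le_abs_self _))
  have h2 := sq_le_sq.2 ((hl' (ψ r)).trans (le_abs_self _))
  have h3 := hr.1
  gcongr

/-- Since p² - q² = 2p(p - q) - (p - q)², one has p² ≤ q² + 2pM, and 2pM ≤ ε p² + M² / ε. No sign of
1 - ε is needed. -/
lemma one_sub_mul_sq_le {p q M ε : ℝ} (hp : 0 ≤ p) (hε : 0 < ε) (hpq : p - q ≤ M) :
    (1 - ε) * p ^ 2 ≤ q ^ 2 + 1 / ε * M ^ 2 := by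
  have h1 : p ^ 2 ≤ q ^ 2 + 2 * p * M := by nlinarith [sq_nonneg (p - q)]
  have h2 : 2 * p * M ≤ ε * p ^ 2 + 1 / ε * M ^ 2 := by
    have := sq_nonneg (ε * p - M)
    have h3 : ε * p ^ 2 + 1 / ε * M ^ 2 - 2 * p * M = (ε * p - M) ^ 2 / ε := by
      field_simp
      ring
    have : 0 ≤ (ε * p - M) ^ 2 / ε := by positivity
    linarith
  linarith

/-- The ray bound after z has been absorbed at the cost of ε, in the form that can be integrated
over rays in `[0, ∞]`. -/
lemma ofReal_mul_enorm_sq_le (h : IsScatteringSolution R₀ W φ m) {t : ℝ} (ht0 : 0 ≤ t)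
    (ht : R₀ ≤ t) {ξ ξ' ψ : ℝ → ℂ} (hξ : ∀ r, HasDerivAt ξ (ξ' r) r) (hξ' : Continuous ξ')
    (hψ : Continuous ψ) {M : ℝ} (hM : ∀ r ∈ Set.Icc 0 t, ‖(ψ t - ξ t) - (ψ r - ξ r)‖ ≤ M)
    {ε : ℝ} (hε : 0 < ε) :
    ENNReal.ofReal (1 - ε) * ‖ψ t‖ₑ ^ 2
      ≤ ENNReal.ofReal (φ t) * (∫⁻ r in Set.Ioc 0 t,
          (‖ξ' r‖ₑ ^ 2 + ENNReal.ofReal (W r) * ‖ψ r‖ₑ ^ 2) * ENNReal.ofReal r)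
        + ENNReal.ofReal (1 / ε) * ENNReal.ofReal (M ^ 2) := by
  obtain ⟨z, hz, hle⟩ := h.exists_norm_sq_le ht0 ht hξ hξ' hψ hM
  have hpq : ‖ψ t‖ - ‖ψ t - z‖ ≤ M := by
    have := norm_sub_norm_le (ψ t) (ψ t - z)
    rw [sub_sub_cancel] at this
    exact this.trans hz
  have h1 := (one_sub_mul_sq_le (norm_nonneg (ψ t)) hε hpq).trans (add_le_add_left hle _)
  have h2 : ∫⁻ r in Set.Ioc 0 t,
      (‖ξ' r‖ₑ ^ 2 + ENNReal.ofReal (W r) * ‖ψ r‖ₑ ^ 2) * ENNReal.ofReal r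
      = ENNReal.ofReal (∫ r in (0 : ℝ)..t, (‖ξ' r‖ ^ 2 + W r * ‖ψ r‖ ^ 2) * r) := by
    have hi := h.intervalIntegrable_energy hξ'.norm hψ.norm 0 t
    rw [intervalIntegral.integral_of_le ht0, ofReal_integral_eq_lintegral_ofReal
      ((intervalIntegrable_iff_integrableOn_Ioc_of_le ht0).1 hi)
      ((ae_restrict_iff' measurableSet_Ioc).2 (ae_of_all _ fun r hr => by
        have := h.nonneg r
        have := hr.1
        positivity))]
    refine setLIntegral_congr_fun measurableSet_Ioc fun r hr => ?_
    have := h.nonneg r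
    rw [ENNReal.ofReal_mul (by positivity), ENNReal.ofReal_add (by positivity) (by positivity),
      ENNReal.ofReal_mul this, ENNReal.ofReal_pow (norm_nonneg _), ENNReal.ofReal_pow (norm_nonneg _),
      ofReal_norm, ofReal_norm]
  have h3 : 0 ≤ ∫ r in (0 : ℝ)..t, (‖ξ' r‖ ^ 2 + W r * ‖ψ r‖ ^ 2) * r :=
    intervalIntegral.integral_nonneg ht0 fun r hr => by
      have := h.nonneg r
      have := hr.1
      positivity
  rw [h2, ← ofReal_norm, ← ENNReal.ofReal_pow (norm_nonneg _), ← ENNReal.ofReal_mul' (by positivity),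
    ← ENNReal.ofReal_mul (h.pos t).le, ← ENNReal.ofReal_mul (by positivity),
    ← ENNReal.ofReal_add (mul_nonneg (h.pos t).le h3) (by positivity)]
  exact ENNReal.ofReal_le_ofReal h1

end IsScatteringSolution

/-! ### Polar coordinates in the plane -/

/-- The unit vector with angle `θ`. -/
noncomputable def polarVec (θ : ℝ) : Plane := !₂[Real.cos θ, Real.sin θ]

lemma norm_polarVec (θ : ℝ) : ‖polarVec θ‖ = 1 := by
  simp [polarVec, EuclideanSpace.norm_eq]

lemma continuous_polarVec : Continuous polarVec := by
  unfold polarVec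
  fun_prop

lemma norm_smul_polarVec {r : ℝ} (hr : 0 ≤ r) (θ : ℝ) : ‖r • polarVec θ‖ = r := by
  rw [norm_smul, norm_polarVec, mul_one, Real.norm_of_nonneg hr]

/-- The radial integral stands inside, so that inequalities on single rays can be integrated over
the angle. -/
lemma lintegral_polar {F : Plane → ℝ≥0∞} (hF : Measurable F) :
    ∫⁻ x, F x = ∫⁻ θ in Set.Ioo (-Real.pi) Real.pi, ∫⁻ r in Set.Ioi (0 : ℝ),
      ENNReal.ofReal r * F (r • polarVec θ) := by
  have h1 : MeasurePreserving (fun p : ℝ × ℝ => (WithLp.toLp 2 ![p.1, p.2] : Plane)) :=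
    (PiLp.volume_preserving_toLp (Fin 2)).comp (volume_preserving_finTwoArrow ℝ).symm
  rw [← h1.lintegral_comp hF, ← lintegral_comp_polarCoord_symm]
  have hm : Measurable fun p : ℝ × ℝ => ENNReal.ofReal p.1 * F (p.1 • polarVec p.2) := by
    have : Continuous fun p : ℝ × ℝ => p.1 • polarVec p.2 :=
      continuous_fst.smul (continuous_polarVec.comp continuous_snd)
    exact (measurable_fst.ennreal_ofReal).mul (hF.comp this.measurable)
  rw [← setLIntegral_prod_symm (μ := volume) (ν := volume)
    (fun p : ℝ × ℝ => ENNReal.ofReal p.1 * F (p.1 • polarVec p.2)) hm.aemeasurable]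
  refine lintegral_congr fun p => ?_
  rw [smul_eq_mul]
  congr 2
  ext i
  fin_cases i <;> simp [polarVec, polarCoord]

/-! ### Periodic functions on the plane -/

/-- The lattice vector `L k`. -/
noncomputable abbrev latticeVec (L : ℝ) (k : Fin 2 → ℤ) : Plane :=
  L • (WithLp.toLp 2 (fun i => (k i : ℝ)) : Plane)

/-- The half-open square of side length `L` with lower left corner `b`. -/
def box (L : ℝ) (b : Plane) : Set Plane := {x | ∀ i, x i ∈ Set.Ioc (b i) (b i + L)}

/-- The projection of the plane to the unit torus after rescaling by `L`. -/
noncomputable def toUnitTorus (L : ℝ) (x : Plane) : UnitAddTorus (Fin 2) :=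
  fun i => ((x i / L : ℝ) : UnitAddCircle)

/-- The normalized Haar measure on the unit torus. -/
noncomputable abbrev torusHaar : Measure (UnitAddTorus (Fin 2)) :=
  Measure.pi fun _ => AddCircle.haarAddCircle

/-- A section of `toUnitTorus`. -/
noncomputable def ofUnitTorus (L : ℝ) (z : UnitAddTorus (Fin 2)) : Plane :=
  L • (WithLp.toLp 2 (fun i => (AddCircle.equivIoc (1 : ℝ) 0 (z i) : ℝ)) : Plane)

lemma measurableSet_box (L : ℝ) (b : Plane) : MeasurableSet (box L b) := by
  have : box L b = ⋂ i, (fun x : Plane => x i) ⁻¹' Set.Ioc (b i) (b i + L) := by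
    ext x; simp [box]
  rw [this]
  refine MeasurableSet.iInter fun i => ?_
  exact measurableSet_Ioc.preimage (by fun_prop)

lemma measurable_ofUnitTorus (L : ℝ) : Measurable (ofUnitTorus L) := by
  have h : Measurable fun z : UnitAddTorus (Fin 2) =>
      fun i => (AddCircle.equivIoc (1 : ℝ) 0 (z i) : ℝ) := by
    refine measurable_pi_lambda _ fun i => ?_
    exact measurable_subtype_coe.comp
      ((AddCircle.measurableEquivIoc (1 : ℝ) 0).measurable.comp (measurable_pi_apply i))
  exact ((PiLp.volume_preserving_toLp (Fin 2)).measurable.comp h).const_smul L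

lemma toUnitTorus_ofUnitTorus {L : ℝ} (hL : 0 < L) (z : UnitAddTorus (Fin 2)) :
    toUnitTorus L (ofUnitTorus L z) = z := by
  ext i
  simp only [toUnitTorus, ofUnitTorus, PiLp.smul_apply, smul_eq_mul]
  rw [mul_div_cancel_left₀ _ hL.ne']
  exact (AddCircle.equivIoc (1 : ℝ) 0).symm_apply_apply (z i)

lemma exists_ofUnitTorus_eq {L : ℝ} (hL : 0 < L) (x : Plane) :
    ∃ k, ofUnitTorus L (toUnitTorus L x) = x + latticeVec L k := by
  have h : ∀ i, ∃ k : ℤ, (AddCircle.equivIoc (1 : ℝ) 0 (toUnitTorus L x i) : ℝ) = x i / L + k := by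
    intro i
    have h1 : ((AddCircle.equivIoc (1 : ℝ) 0 (toUnitTorus L x i) : ℝ) : UnitAddCircle)
        = ((x i / L : ℝ) : UnitAddCircle) :=
      (AddCircle.equivIoc (1 : ℝ) 0).symm_apply_apply _
    rw [← sub_eq_zero, ← AddCircle.coe_sub, AddCircle.coe_eq_zero_iff] at h1
    obtain ⟨k, hk⟩ := h1
    refine ⟨k, ?_⟩
    rw [zsmul_eq_mul, mul_one] at hk
    linarith
  choose k hk using h
  refine ⟨k, ?_⟩
  ext i
  simp only [ofUnitTorus, PiLp.smul_apply, smul_eq_mul, hk, PiLp.add_apply]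
  field_simp

lemma lintegral_box {L : ℝ} (hL : 0 < L) (b : Plane) {f : UnitAddTorus (Fin 2) → ℝ≥0∞}
    (hf : Measurable f) :
    ∫⁻ x in box L b, f (toUnitTorus L x) = ENNReal.ofReal (L ^ 2) * ∫⁻ z, f z ∂torusHaar := by
  set S : Set (Fin 2 → ℝ) := {x | ∀ i, x i ∈ Set.Ioc (b i / L) (b i / L + 1)} with hS
  have hSm : MeasurableSet S := by
    have : S = ⋂ i, (fun x : Fin 2 → ℝ => x i) ⁻¹' Set.Ioc (b i / L) (b i / L + 1) := by
      ext x; simp [hS]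
    rw [this]
    exact MeasurableSet.iInter fun i => measurableSet_Ioc.preimage (measurable_pi_apply i)
  set g : Plane → ℝ≥0∞ := fun x => S.indicator (fun x => f fun i => x i) (x.ofLp) with hg
  have hgm : Measurable g := by
    refine Measurable.comp (g := S.indicator (fun x => f fun i => x i)) ?_
      (PiLp.volume_preserving_ofLp (Fin 2)).measurable
    refine Measurable.indicator ?_ hSm
    exact hf.comp (measurable_pi_lambda _ fun i => AddCircle.measurable_mk'.comp
      (measurable_pi_apply i))
  have h1 : ∫⁻ z, f z ∂torusHaar = ∫⁻ x, g x := by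
    rw [show ∫⁻ z, f z ∂torusHaar = ∫⁻ x in S, f (fun i => x i) from
      UnitAddTorus.lintegral_preimage f (fun i => b i / L)]
    rw [← lintegral_indicator hSm, ← (PiLp.volume_preserving_ofLp (Fin 2)).lintegral_comp]
    refine Measurable.indicator ?_ hSm
    exact hf.comp (measurable_pi_lambda _ fun i => AddCircle.measurable_mk'.comp
      (measurable_pi_apply i))
  have h2 : ∫⁻ x in box L b, f (toUnitTorus L x) = ∫⁻ x, g (L⁻¹ • x) := by
    rw [← lintegral_indicator (measurableSet_box L b)]
    refine lintegral_congr fun x => ?_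
    have hiff : x ∈ box L b ↔ (L⁻¹ • x).ofLp ∈ S := by
      refine forall_congr' fun i => ?_
      simp only [Set.mem_Ioc, PiLp.smul_apply, smul_eq_mul]
      rw [inv_mul_eq_div, div_lt_div_iff_of_pos_right hL, ← div_self hL.ne', ← add_div,
        div_le_div_iff_of_pos_right hL]
    by_cases hx : x ∈ box L b
    · rw [Set.indicator_of_mem hx, hg]
      dsimp only
      rw [Set.indicator_of_mem (hiff.1 hx)]
      congr 1
      ext i
      simp [toUnitTorus, div_eq_inv_mul]
    · rw [Set.indicator_of_notMem hx, hg]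
      dsimp only
      rw [Set.indicator_of_notMem (fun h => hx (hiff.2 h))]
  rw [h1, h2, ← lintegral_map hgm (measurable_const_smul L⁻¹),
    Measure.map_addHaar_smul _ (inv_ne_zero hL.ne'), lintegral_smul_measure, smul_eq_mul]
  congr 2
  simp [abs_of_pos hL]

/-- A function on the plane has the periods `L k`. -/
def IsPeriodic {α : Type*} (L : ℝ) (F : Plane → α) : Prop := ∀ x k, F (x + latticeVec L k) = F x

lemma IsPeriodic.ofUnitTorus_toUnitTorus {α : Type*} {L : ℝ} (hL : 0 < L) {F : Plane → α}
    (hF : IsPeriodic L F) (x : Plane) : F (ofUnitTorus L (toUnitTorus L x)) = F x := by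
  obtain ⟨k, hk⟩ := exists_ofUnitTorus_eq hL x
  rw [hk, hF]

/-- The right side does not contain b, so all translates of the fundamental square give the same
integral. This is the source of translation invariance on the torus and allows the square to be
centered at any of the points. -/
lemma IsPeriodic.lintegral_box {L : ℝ} (hL : 0 < L) {F : Plane → ℝ≥0∞} (hF : IsPeriodic L F)
    (hFm : Measurable F) (b : Plane) :
    ∫⁻ x in box L b, F x = ENNReal.ofReal (L ^ 2) * ∫⁻ z, F (ofUnitTorus L z) ∂torusHaar := by
  have := Dyson.lintegral_box hL b (hFm.comp (measurable_ofUnitTorus L))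
  simpa only [Function.comp_apply, hF.ofUnitTorus_toUnitTorus hL] using this

lemma torus_ae_eq_box (L : ℝ) : torus L =ᵐ[volume] box L 0 := by
  have h1 : (Set.univ.pi fun _ : Fin 2 => Set.Ioc (0 : ℝ) L) =ᵐ[volume]
      Set.univ.pi fun _ : Fin 2 => Set.Icc (0 : ℝ) L := Measure.pi_Ioc_ae_eq_pi_Icc
  have h2 := (PiLp.volume_preserving_ofLp (Fin 2)).quasiMeasurePreserving.preimage_ae_eq h1
  have h3 : WithLp.ofLp ⁻¹' (Set.univ.pi fun _ : Fin 2 => Set.Ioc (0 : ℝ) L) = box L 0 := by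
    ext x; simp [box]
  have h4 : WithLp.ofLp ⁻¹' (Set.univ.pi fun _ : Fin 2 => Set.Icc (0 : ℝ) L) = torus L := by
    ext x; simp only [Set.mem_preimage, Set.mem_univ_pi, torus, Set.mem_ofPred_eq]
  rw [h3, h4] at h2
  exact h2.symm

lemma restrict_torus (L : ℝ) : (volume.restrict (torus L) : Measure Plane)
    = volume.restrict (box L 0) :=
  Measure.restrict_congr_set (torus_ae_eq_box L)

lemma setLIntegral_torus {L : ℝ} (hL : 0 < L) {F : Plane → ℝ≥0∞} (hF : IsPeriodic L F)
    (hFm : Measurable F) (b : Plane) : ∫⁻ x in torus L, F x = ∫⁻ x in box L b, F x := by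
  rw [restrict_torus, hF.lintegral_box hL hFm, hF.lintegral_box hL hFm]

lemma IsPeriodic.const_add {α : Type*} {L : ℝ} {F : Plane → α} (hF : IsPeriodic L F) (y : Plane) :
    IsPeriodic L fun x => F (y + x) := fun x k => by
  change F (y + (x + latticeVec L k)) = F (y + x)
  rw [← add_assoc, hF]

lemma setLIntegral_torus_add {L : ℝ} (hL : 0 < L) {F : Plane → ℝ≥0∞} (hF : IsPeriodic L F)
    (hFm : Measurable F) (y : Plane) :
    ∫⁻ x in torus L, F (y + x) = ∫⁻ x in torus L, F x := by
  rw [setLIntegral_torus hL (hF.const_add y) (by fun_prop) 0, setLIntegral_torus hL hF hFm y,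
    ← lintegral_indicator (measurableSet_box _ _), ← lintegral_indicator (measurableSet_box _ _),
    ← lintegral_add_left_eq_self ((box L y).indicator F) y]
  refine lintegral_congr fun x => ?_
  have : x ∈ box L 0 ↔ y + x ∈ box L y := by
    refine forall_congr' fun i => ?_
    simp
  by_cases hx : x ∈ box L 0
  · rw [Set.indicator_of_mem hx, Set.indicator_of_mem (this.1 hx)]
  · rw [Set.indicator_of_notMem hx, Set.indicator_of_notMem fun h => hx (this.2 h)]

/-- The square of side length `L` centered at the origin. -/
noncomputable abbrev centeredBox (L : ℝ) : Set Plane := box L (WithLp.toLp 2 fun _ => -(L / 2))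

lemma setLIntegral_torus_centered {L : ℝ} (hL : 0 < L) {F : Plane → ℝ≥0∞} (hF : IsPeriodic L F)
    (hFm : Measurable F) (y : Plane) :
    ∫⁻ x in torus L, F x = ∫⁻ x in centeredBox L, F (y + x) := by
  rw [← setLIntegral_torus_add hL hF hFm y]
  exact setLIntegral_torus hL (hF.const_add y) (by fun_prop) _

/-! ### The torus distance -/

lemma torusDist_bddBelow (L : ℝ) (x y : Plane) :
    BddBelow (Set.range fun k : Fin 2 → ℤ => ‖x - y - latticeVec L k‖) :=
  ⟨0, by rintro _ ⟨k, rfl⟩; exact norm_nonneg _⟩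

lemma torusDist_le (L : ℝ) (x y : Plane) (k : Fin 2 → ℤ) :
    torusDist L x y ≤ ‖x - y - latticeVec L k‖ :=
  ciInf_le (torusDist_bddBelow L x y) k

lemma torusDist_le_norm (L : ℝ) (x y : Plane) : torusDist L x y ≤ ‖x - y‖ := by
  have := torusDist_le L x y 0
  rwa [show latticeVec L 0 = 0 by ext i; simp [latticeVec], sub_zero] at this

lemma torusDist_le_add (L : ℝ) (x x' y : Plane) :
    torusDist L x y ≤ torusDist L x' y + ‖x - x'‖ := by
  rw [← sub_le_iff_le_add]
  refine le_ciInf fun k => ?_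
  rw [sub_le_iff_le_add]
  refine (torusDist_le L x y k).trans ?_
  calc ‖x - y - latticeVec L k‖ = ‖(x' - y - latticeVec L k) + (x - x')‖ := by congr 1; abel
    _ ≤ _ := norm_add_le _ _

lemma continuous_torusDist (L : ℝ) (y : Plane) : Continuous fun x => torusDist L x y := by
  refine LipschitzWith.continuous (K := 1) (LipschitzWith.of_le_add_mul 1 fun x x' => ?_)
  rw [NNReal.coe_one, one_mul, dist_eq_norm]
  exact torusDist_le_add L x x' y

lemma isPeriodic_torusDist (L : ℝ) (y : Plane) : IsPeriodic L fun x => torusDist L x y := by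
  intro x k
  change ⨅ l : Fin 2 → ℤ, ‖x + latticeVec L k - y - latticeVec L l‖ =
    ⨅ l : Fin 2 → ℤ, ‖x - y - latticeVec L l‖
  rw [← (Equiv.addRight k).iInf_comp]
  refine iInf_congr fun l => ?_
  congr 1
  ext i
  simp
  ring

/-- Among the multiples of L, the nearest to a number in [-L/2, L/2] is 0. -/
lemma mul_self_le_sub_mul {L u : ℝ} (hL : 0 < L) (hu : |u| ≤ L / 2) (k : ℤ) :
    u ^ 2 ≤ (u - L * k) ^ 2 := by
  rcases eq_or_ne k 0 with rfl | hk
  · simp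
  · have h1 : (1 : ℝ) ≤ |(k : ℝ)| := by exact_mod_cast Int.one_le_abs hk
    rw [sq_le_sq]
    have h2 : |L * k| ≤ |u - L * k| + |u| := by
      have := abs_sub_abs_le_abs_sub (L * k) u
      rw [abs_sub_comm] at this
      linarith
    rw [abs_mul, abs_of_pos hL] at h2
    nlinarith

/-- The squared norm is minimized over the lattice separately in each coordinate, and in the
centered square every coordinate already has its smallest modulus. -/
lemma torusDist_add_self {L : ℝ} (hL : 0 < L) (y : Plane) {x : Plane}
    (hx : ∀ i, |x i| ≤ L / 2) : torusDist L (y + x) y = ‖x‖ := by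
  refine le_antisymm ?_ (le_ciInf fun k => ?_)
  · simpa using torusDist_le_norm L (y + x) y
  · rw [add_sub_cancel_left, EuclideanSpace.norm_eq, EuclideanSpace.norm_eq]
    refine Real.sqrt_le_sqrt (Finset.sum_le_sum fun i _ => ?_)
    simpa using mul_self_le_sub_mul hL (hx i) (k i)

lemma abs_apply_le_norm (x : Plane) (i : Fin 2) : |x i| ≤ ‖x‖ := PiLp.norm_apply_le x i

lemma mem_centeredBox_of_norm_lt {L : ℝ} {x : Plane} (hx : ‖x‖ < L / 2) : x ∈ centeredBox L := by
  intro i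
  have := abs_lt.1 ((abs_apply_le_norm x i).trans_lt hx)
  simp only [Set.mem_Ioc]
  constructor <;> linarith [this.1, this.2]

lemma abs_apply_le_of_mem_centeredBox {L : ℝ} {x : Plane} (hx : x ∈ centeredBox L) (i : Fin 2) :
    |x i| ≤ L / 2 := by
  have := hx i
  simp only [Set.mem_Ioc] at this
  rw [abs_le]
  constructor <;> linarith [this.1, this.2]

/-! ### The inequality in a star-shaped cell -/

/-- The part of the cell `C` within distance `R` of `y`, seen from `y`. -/
def cellPart (C : Set Plane) (y : Plane) (R : ℝ) : Set Plane := {x | y + x ∈ C ∧ ‖x‖ ≤ R}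

lemma measurableSet_cellPart {C : Set Plane} (hC : MeasurableSet C) (y : Plane) (R : ℝ) :
    MeasurableSet (cellPart C y R) :=
  (hC.preimage (measurable_const_add y)).inter (measurableSet_le measurable_norm measurable_const)

namespace IsScatteringSolution

variable {R₀ : ℝ} {W φ m : ℝ → ℝ}

/-- On a ray, the bound at radius t is multiplied by U(t) t and integrated over t. The energy up to
radius t is at most the energy on the whole ray, so the weight in front of it is ∫ U φ t dt ≤ 1. The
radial derivative is at most the full gradient, and integration over the angle finishes the
argument. -/
lemma lintegral_cellPart_le (h : IsScatteringSolution R₀ W φ m) {R : ℝ}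
    {ψ ξ : Plane → ℂ} (hψ : Continuous ψ) (hξ : ContDiff ℝ 1 ξ) (y : Plane)
    {C : Set Plane} (hC : MeasurableSet C)
    (hstar : ∀ x ∈ cellPart C y R, ∀ s ∈ Set.Ioc (0 : ℝ) 1, y + s • x ∈ C)
    {M : ℝ} (hM : ∀ x, ‖x‖ ≤ R → ‖(ψ (y + x) - ξ (y + x)) - (ψ y - ξ y)‖ ≤ M / 2)
    {U : ℝ → ℝ≥0∞} (hU : Measurable U) (hU_supp : ∀ t, t ∉ Set.Icc R₀ R → U t = 0)
    (hU_int : ∫⁻ t in Set.Ioi 0, U t * ENNReal.ofReal (φ t * t) ≤ 1) {ε : ℝ} (hε : 0 < ε) :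
    ENNReal.ofReal (1 - ε) * ∫⁻ x in cellPart C y R, U ‖x‖ * ‖ψ (y + x)‖ₑ ^ 2
      ≤ (∫⁻ x in cellPart C y R,
          (‖fderiv ℝ ξ (y + x)‖ₑ ^ 2 + ENNReal.ofReal (W ‖x‖) * ‖ψ (y + x)‖ₑ ^ 2))
        + ENNReal.ofReal (1 / ε) * (∫⁻ t in Set.Ioi 0, U t * ENNReal.ofReal t)
          * ENNReal.ofReal (2 * Real.pi * M ^ 2) := by
  have hWm := h.measurable
  have hA := measurableSet_cellPart hC y R
  set A := cellPart C y R with hAdef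
  have hdξ : Continuous (fderiv ℝ ξ) := hξ.continuous_fderiv one_ne_zero
  set E : Plane → ℝ≥0∞ := fun x =>
    ‖fderiv ℝ ξ (y + x)‖ₑ ^ 2 + ENNReal.ofReal (W ‖x‖) * ‖ψ (y + x)‖ₑ ^ 2 with hE
  set V : Plane → ℝ≥0∞ := fun x => U ‖x‖ * ‖ψ (y + x)‖ₑ ^ 2 with hV
  have hEm : Measurable E := by
    have h1 : Continuous fun x => fderiv ℝ ξ (y + x) := by fun_prop
    have h2 : Continuous fun x => ψ (y + x) := by fun_prop
    have h3 : Measurable fun x : Plane => ENNReal.ofReal (W ‖x‖) := by fun_prop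
    exact (h1.enorm.measurable.pow_const 2).add (h3.mul (h2.enorm.measurable.pow_const 2))
  have hVm : Measurable V := by
    have h2 : Continuous fun x => ψ (y + x) := by fun_prop
    have h3 : Measurable fun x : Plane => U ‖x‖ := by fun_prop
    exact h3.mul (h2.enorm.measurable.pow_const 2)
  set K := ENNReal.ofReal (1 / ε) * ENNReal.ofReal (M ^ 2) with hK
  set I := ∫⁻ t in Set.Ioi 0, U t * ENNReal.ofReal t with hI
  have hray : ∀ θ, ENNReal.ofReal (1 - ε) *
      (∫⁻ r in Set.Ioi (0 : ℝ), ENNReal.ofReal r * A.indicator V (r • polarVec θ))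
      ≤ (∫⁻ r in Set.Ioi (0 : ℝ), ENNReal.ofReal r * A.indicator E (r • polarVec θ)) + K * I := by
    intro θ
    set e := ∫⁻ r in Set.Ioi (0 : ℝ), ENNReal.ofReal r * A.indicator E (r • polarVec θ) with he
    have hpc : Continuous fun r : ℝ => y + r • polarVec θ := by fun_prop
    have hpd : ∀ r : ℝ, HasDerivAt (fun r : ℝ => y + r • polarVec θ) (polarVec θ) r := fun r => by
      simpa using ((hasDerivAt_id r).smul_const (polarVec θ)).const_add y
    have hpoint : ∀ t ∈ Set.Ioi (0 : ℝ),
        ENNReal.ofReal (1 - ε) * (ENNReal.ofReal t * A.indicator V (t • polarVec θ))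
        ≤ U t * ENNReal.ofReal (φ t * t) * e + K * (U t * ENNReal.ofReal t) := by
      intro t ht
      have ht0 : 0 < t := ht
      by_cases htA : t • polarVec θ ∈ A
      swap
      · rw [Set.indicator_of_notMem htA]; simp
      rw [Set.indicator_of_mem htA]
      simp only [hV]
      rw [norm_smul_polarVec ht0.le]
      by_cases htR : t ∈ Set.Icc R₀ R
      swap
      · rw [hU_supp t htR]; simp
      -- The cell part is star-shaped, so the ray segment behind a point of it stays inside and its
      -- energy is counted in e.
      have hsub : ∀ r ∈ Set.Ioc 0 t, r • polarVec θ ∈ A := by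
        intro r hr
        refine ⟨?_, ?_⟩
        · have := hstar _ htA (r / t) ⟨div_pos hr.1 ht0, (div_le_one ht0).2 hr.2⟩
          rwa [smul_smul, div_mul_cancel₀ _ ht0.ne'] at this
        · rw [norm_smul_polarVec hr.1.le]
          exact hr.2.trans htR.2
      have key := h.ofReal_mul_enorm_sq_le ht0.le htR.1
        (ξ := fun r => ξ (y + r • polarVec θ))
        (ξ' := fun r => fderiv ℝ ξ (y + r • polarVec θ) (polarVec θ))
        (ψ := fun r => ψ (y + r • polarVec θ))
        (fun r => ((hξ.differentiable one_ne_zero _).hasFDerivAt).comp_hasDerivAt r (hpd r))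
        ((hdξ.comp hpc).clm_apply continuous_const) (hψ.comp hpc) (M := M)
        (fun r hr => by
          have h1 := hM (t • polarVec θ) ((norm_smul_polarVec ht0.le θ).trans_le htR.2)
          have h2 := hM (r • polarVec θ)
            ((norm_smul_polarVec hr.1 θ).trans_le (hr.2.trans htR.2))
          -- Both points are compared with the center y, and the two bounds M / 2 add up to M.
          calc _ = ‖((ψ (y + t • polarVec θ) - ξ (y + t • polarVec θ)) - (ψ y - ξ y))
              - ((ψ (y + r • polarVec θ) - ξ (y + r • polarVec θ)) - (ψ y - ξ y))‖ := by
                congr 1; ring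
            _ ≤ _ := (norm_sub_le _ _).trans (by linarith)) hε
      have hle : (∫⁻ r in Set.Ioc 0 t,
          (‖fderiv ℝ ξ (y + r • polarVec θ) (polarVec θ)‖ₑ ^ 2
            + ENNReal.ofReal (W r) * ‖ψ (y + r • polarVec θ)‖ₑ ^ 2) * ENNReal.ofReal r) ≤ e := by
        rw [he]
        refine (setLIntegral_mono' measurableSet_Ioc fun r hr => ?_).trans
          (lintegral_mono_set Set.Ioc_subset_Ioi_self)
        rw [Set.indicator_of_mem (hsub r hr), mul_comm]
        simp only [hE]
        rw [norm_smul_polarVec hr.1.le]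
        gcongr
        have := (fderiv ℝ ξ (y + r • polarVec θ)).le_opENorm (polarVec θ)
        rwa [← ofReal_norm (polarVec θ), norm_polarVec, ENNReal.ofReal_one, mul_one] at this
      calc _ = (U t * ENNReal.ofReal t) *
            (ENNReal.ofReal (1 - ε) * ‖ψ (y + t • polarVec θ)‖ₑ ^ 2) := by ring
        _ ≤ (U t * ENNReal.ofReal t) * (ENNReal.ofReal (φ t) * e + K) := by
            gcongr
            exact key.trans (by gcongr)
        _ = _ := by
            rw [ENNReal.ofReal_mul (h.pos t).le]
            ring
    have hφm := h.continuous.measurable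
    rw [← lintegral_const_mul']
    swap
    · exact ENNReal.ofReal_ne_top
    refine (setLIntegral_mono' measurableSet_Ioi hpoint).trans ?_
    rw [lintegral_add_left (by fun_prop), lintegral_mul_const _ (by fun_prop),
      lintegral_const_mul _ (by fun_prop)]
    gcongr
    -- The only use of the normalization of U: the ray energy e enters with weight at most 1.
    exact mul_le_of_le_one_left zero_le hU_int
  have hpolar : ∀ {F : Plane → ℝ≥0∞}, Measurable F → ∫⁻ x in A, F x
      = ∫⁻ θ in Set.Ioo (-Real.pi) Real.pi, ∫⁻ r in Set.Ioi (0 : ℝ),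
        ENNReal.ofReal r * A.indicator F (r • polarVec θ) := fun hF => by
    rw [← lintegral_indicator hA, lintegral_polar (hF.indicator hA)]
  rw [hpolar hVm, hpolar hEm, ← lintegral_const_mul' _ _ ENNReal.ofReal_ne_top]
  refine (lintegral_mono hray).trans ?_
  rw [lintegral_add_right _ measurable_const, setLIntegral_const, Real.volume_Ioo]
  refine add_le_add le_rfl ?_
  -- The error is the same on every ray, and the angles have total length 2π.
  rw [hK, show Real.pi - -Real.pi = 2 * Real.pi by ring,
    ENNReal.ofReal_mul (p := 2 * Real.pi) (q := M ^ 2) (by positivity)]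
  exact le_of_eq (by ring)

end IsScatteringSolution

/-! ### Fourier series on the torus -/

/-- The plane wave `e^{ipx}` with momentum `p = (2π / L) k`. -/
noncomputable def wave (L : ℝ) (k : Fin 2 → ℤ) (x : Plane) : ℂ :=
  Complex.exp (Complex.I * ((inner ℝ (momentum L k) x : ℝ) : ℂ))

lemma planeWave_eq_conj (L : ℝ) (k : Fin 2 → ℤ) (x : Plane) :
    planeWave (momentum L k) x = (starRingEnd ℂ) (wave L k x) := by
  simp [planeWave, wave, ← Complex.exp_conj]

lemma norm_wave (L : ℝ) (k : Fin 2 → ℤ) (x : Plane) : ‖wave L k x‖ = 1 := by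
  rw [wave, mul_comm, Complex.norm_exp_ofReal_mul_I]

lemma norm_planeWave (p x : Plane) : ‖planeWave p x‖ = 1 := by
  have : planeWave p x = Complex.exp ((-(inner ℝ p x) : ℝ) * Complex.I) := by
    rw [planeWave]; congr 1; push_cast; ring
  rw [this, Complex.norm_exp_ofReal_mul_I]

lemma continuous_planeWave (p : Plane) : Continuous (planeWave p) := by
  unfold planeWave
  fun_prop

lemma continuous_wave (L : ℝ) (k : Fin 2 → ℤ) : Continuous (wave L k) := by
  unfold wave
  fun_prop

lemma mFourier_toUnitTorus (L : ℝ) (k : Fin 2 → ℤ) (x : Plane) :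
    UnitAddTorus.mFourier k (toUnitTorus L x) = wave L k x := by
  simp only [UnitAddTorus.mFourier, ContinuousMap.coe_mk, toUnitTorus, fourier_coe_apply, wave]
  rw [← Complex.exp_sum]
  congr 1
  simp only [Fin.sum_univ_two, momentum, PiLp.inner_apply, RCLike.inner_apply, conj_trivial]
  push_cast
  ring

lemma isPeriodic_wave {L : ℝ} (hL : 0 < L) (k : Fin 2 → ℤ) : IsPeriodic L (wave L k) := by
  intro x l
  rw [← mFourier_toUnitTorus, ← mFourier_toUnitTorus]
  congr 1
  ext i
  simp only [toUnitTorus, PiLp.add_apply, PiLp.smul_apply, smul_eq_mul, add_div,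
    mul_div_cancel_left₀ _ hL.ne', AddCircle.coe_add]
  rw [add_eq_left, AddCircle.coe_eq_zero_iff]
  exact ⟨l i, by simp⟩

lemma ofUnitTorus_toUnitTorus {L : ℝ} (hL : 0 < L) {x : Plane} (hx : x ∈ box L 0) :
    ofUnitTorus L (toUnitTorus L x) = x := by
  ext i
  have hi : x i / L ∈ Set.Ioc (0 : ℝ) (0 + 1) := by
    have := hx i
    simp only [PiLp.zero_apply, zero_add] at this
    exact ⟨div_pos this.1 hL, by rw [zero_add, div_le_one hL]; exact this.2⟩
  have : AddCircle.equivIoc (1 : ℝ) 0 (toUnitTorus L x i) = ⟨x i / L, hi⟩ := by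
    rw [← Equiv.eq_symm_apply]
    rfl
  simp only [ofUnitTorus, PiLp.smul_apply, smul_eq_mul, this]
  field_simp

/-- The bridge to Fourier theory on `UnitAddTorus`. The representative of z has coordinates in (0,
L], so a function given only on the fundamental square can be pulled back without periodic
extension. -/
lemma measurePreserving_ofUnitTorus {L : ℝ} (hL : 0 < L) :
    MeasurePreserving (ofUnitTorus L) (ENNReal.ofReal (L ^ 2) • torusHaar)
      (volume.restrict (torus L)) := by
  refine ⟨measurable_ofUnitTorus L, ?_⟩
  ext s hs
  rw [Measure.map_apply (measurable_ofUnitTorus L) hs, restrict_torus, ← lintegral_indicator_one hs,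
    ← lintegral_indicator_one (hs.preimage (measurable_ofUnitTorus L)), lintegral_smul_measure,
    smul_eq_mul, ← lintegral_box hL 0 (measurable_one.indicator
      (hs.preimage (measurable_ofUnitTorus L)))]
  refine setLIntegral_congr_fun (measurableSet_box L 0) fun x hx => ?_
  have := ofUnitTorus_toUnitTorus hL hx
  have h : toUnitTorus L x ∈ ofUnitTorus L ⁻¹' s ↔ x ∈ s := by rw [Set.mem_preimage, this]
  by_cases hxs : x ∈ s
  · rw [Set.indicator_of_mem hxs, Set.indicator_of_mem (h.2 hxs)]
    rfl
  · rw [Set.indicator_of_notMem hxs, Set.indicator_of_notMem (hxs ∘ h.1)]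

lemma setLIntegral_torus_eq {L : ℝ} (hL : 0 < L) {F : Plane → ℝ≥0∞}
    (hF : AEMeasurable F (volume.restrict (torus L))) :
    ∫⁻ x in torus L, F x = ENNReal.ofReal (L ^ 2) * ∫⁻ z, F (ofUnitTorus L z) ∂torusHaar := by
  have h := measurePreserving_ofUnitTorus hL
  rw [← h.map_eq, lintegral_map' (by rwa [h.map_eq]) h.measurable.aemeasurable,
    lintegral_smul_measure, smul_eq_mul]

lemma setIntegral_torus_eq {L : ℝ} (hL : 0 < L) {F : Plane → ℂ}
    (hF : AEStronglyMeasurable F (volume.restrict (torus L))) :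
    ∫ x in torus L, F x = (L ^ 2) • ∫ z, F (ofUnitTorus L z) ∂torusHaar := by
  have h := measurePreserving_ofUnitTorus hL
  rw [← h.map_eq, integral_map h.measurable.aemeasurable (by rwa [h.map_eq]),
    integral_smul_measure, ENNReal.toReal_ofReal (by positivity)]

lemma wave_ofUnitTorus {L : ℝ} (hL : 0 < L) (k : Fin 2 → ℤ) (z : UnitAddTorus (Fin 2)) :
    wave L k (ofUnitTorus L z) = UnitAddTorus.mFourier k z := by
  rw [← mFourier_toUnitTorus, toUnitTorus_ofUnitTorus hL]

/-- The Fourier modes as elements of `L²` of the unit torus. -/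
noncomputable abbrev modeLp (k : Fin 2 → ℤ) : Lp ℂ 2 torusHaar :=
  ContinuousMap.toLp (E := ℂ) 2 torusHaar ℂ (UnitAddTorus.mFourier k)

lemma orthonormal_modeLp : Orthonormal ℂ modeLp := UnitAddTorus.orthonormal_mFourier

lemma hasSum_modeLp (f : Lp ℂ 2 torusHaar) :
    HasSum (fun k => (∫ z, UnitAddTorus.mFourier (-k) z • f z ∂torusHaar) • modeLp k) f :=
  UnitAddTorus.hasSum_mFourier_series_L2 f

lemma coeFn_modeLp (k : Fin 2 → ℤ) : modeLp k =ᵐ[torusHaar] UnitAddTorus.mFourier k :=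
  UnitAddTorus.coeFn_mFourierLp 2 k

lemma coeFn_sum_modeLp (s : Finset (Fin 2 → ℤ)) (a : (Fin 2 → ℤ) → ℂ) :
    (∑ k ∈ s, a k • modeLp k : Lp ℂ 2 torusHaar) =ᵐ[torusHaar]
      fun z => ∑ k ∈ s, a k * UnitAddTorus.mFourier k z := by
  classical
  induction s using Finset.induction_on with
  | empty =>
    simp only [Finset.sum_empty]
    exact Lp.coeFn_zero ℂ 2 torusHaar
  | insert k s hk ih =>
    rw [Finset.sum_insert hk]
    filter_upwards [Lp.coeFn_add (a k • modeLp k) (∑ k ∈ s, a k • modeLp k),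
      Lp.coeFn_smul (a k) (modeLp k), coeFn_modeLp k, ih] with z h1 h2 h3 h4
    rw [h1, Pi.add_apply, h2, Pi.smul_apply, h3, h4, Finset.sum_insert hk, smul_eq_mul]

lemma eLpNorm_two_sq {α E : Type*} [MeasurableSpace α] [NormedAddCommGroup E] (μ : Measure α)
    (f : α → E) : eLpNorm f 2 μ ^ 2 = ∫⁻ x, ‖f x‖ₑ ^ 2 ∂μ := by
  have := eLpNorm_nnreal_pow_eq_lintegral (f := f) (μ := μ) (p := 2) two_ne_zero
  simpa using this

/-- Parseval's identity for finite sums, from the orthonormality of the modes on the unit torus. -/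
lemma setLIntegral_torus_sum_wave {L : ℝ} (hL : 0 < L) (s : Finset (Fin 2 → ℤ))
    (a : (Fin 2 → ℤ) → ℂ) :
    ∫⁻ x in torus L, ‖∑ k ∈ s, a k * wave L k x‖ₑ ^ 2
      = ENNReal.ofReal (L ^ 2) * ∑ k ∈ s, ‖a k‖ₑ ^ 2 := by
  have hc : Continuous fun x => ∑ k ∈ s, a k * wave L k x :=
    continuous_finsetSum _ fun k _ => continuous_const.mul (continuous_wave L k)
  rw [setLIntegral_torus_eq hL (hc.enorm.measurable.pow_const 2).aemeasurable]
  simp only [wave_ofUnitTorus hL]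
  congr 1
  rw [← eLpNorm_two_sq, ← eLpNorm_congr_ae (coeFn_sum_modeLp s a), ← Lp.enorm_def,
    ← ofReal_norm, ← ENNReal.ofReal_pow (norm_nonneg _)]
  have h1 : ‖∑ k ∈ s, a k • modeLp k‖ ^ 2 = ∑ k ∈ s, ‖a k‖ ^ 2 := by
    have := orthonormal_modeLp.inner_sum a a s
    rw [inner_self_eq_norm_sq_to_K] at this
    have h2 : ((‖∑ k ∈ s, a k • modeLp k‖ ^ 2 : ℝ) : ℂ) = ((∑ k ∈ s, ‖a k‖ ^ 2 : ℝ) : ℂ) := by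
      push_cast
      rw [← Complex.coe_algebraMap] at *
      refine this.trans (Finset.sum_congr rfl fun k _ => ?_)
      rw [Complex.conj_mul']
      rfl
    exact_mod_cast h2
  rw [h1, ENNReal.ofReal_sum_of_nonneg fun k _ => by positivity]
  simp only [ENNReal.ofReal_pow (norm_nonneg _), ofReal_norm]

/-- The Fourier coefficient of `ψ` at the momentum `(2π / L) k`. -/
noncomputable def fourierCoeffTorus (L : ℝ) (ψ : Plane → ℂ) (k : Fin 2 → ℤ) : ℂ :=
  (1 / L ^ 2 : ℝ) * ∫ x in torus L, ψ x * planeWave (momentum L k) x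

/-- Completeness of the Fourier modes in L² of the unit torus (`hasSum_modeLp`), carried over by
`ofUnitTorus`, which only multiplies squared norms by L². -/
lemma tendsto_partialSum {L : ℝ} (hL : 0 < L) {ψ : Plane → ℂ}
    (hψ : MemLp ψ 2 (volume.restrict (torus L))) :
    Filter.Tendsto (fun s : Finset (Fin 2 → ℤ) =>
      ∫⁻ x in torus L, ‖ψ x - ∑ k ∈ s, fourierCoeffTorus L ψ k * wave L k x‖ₑ ^ 2)
      Filter.atTop (nhds 0) := by
  have hmp := measurePreserving_ofUnitTorus hL
  have hLpos : (0 : ℝ) < L ^ 2 := by positivity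
  have hΨ : MemLp (ψ ∘ ofUnitTorus L) 2 torusHaar := by
    refine (hψ.comp_measurePreserving hmp).of_measure_le_smul
      (c := (ENNReal.ofReal (L ^ 2))⁻¹) (by simpa using hL.ne') ?_
    rw [smul_smul, ENNReal.inv_mul_cancel (by simpa using hL.ne') ENNReal.ofReal_ne_top, one_smul]
  set f : Lp ℂ 2 torusHaar := hΨ.toLp _ with hf
  have hfae : f =ᵐ[torusHaar] ψ ∘ ofUnitTorus L := hΨ.coeFn_toLp
  have hcoeff : ∀ k, ∫ z, UnitAddTorus.mFourier (-k) z • f z ∂torusHaar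
      = fourierCoeffTorus L ψ k := by
    intro k
    rw [fourierCoeffTorus, setIntegral_torus_eq hL (F := fun x => ψ x * planeWave (momentum L k) x)
      (hψ.1.mul (continuous_planeWave _).aestronglyMeasurable)]
    rw [Complex.real_smul, ← mul_assoc, ← Complex.ofReal_mul, one_div_mul_cancel hLpos.ne',
      Complex.ofReal_one, one_mul]
    refine integral_congr_ae ?_
    filter_upwards [hfae] with z hz
    rw [hz, planeWave_eq_conj, wave_ofUnitTorus hL, UnitAddTorus.mFourier_neg, smul_eq_mul,
      mul_comm]
    rfl
  have hsum := hasSum_modeLp f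
  simp only [hcoeff] at hsum
  have h1 := tendsto_iff_edist_tendsto_0.1 hsum
  have h2 : ∀ s : Finset (Fin 2 → ℤ),
      ∫⁻ x in torus L, ‖ψ x - ∑ k ∈ s, fourierCoeffTorus L ψ k * wave L k x‖ₑ ^ 2
      = ENNReal.ofReal (L ^ 2) * edist (∑ k ∈ s, fourierCoeffTorus L ψ k • modeLp k) f ^ 2 := by
    intro s
    have hc : Continuous fun x => ∑ k ∈ s, fourierCoeffTorus L ψ k * wave L k x :=
      continuous_finsetSum _ fun k _ => continuous_const.mul (continuous_wave L k)
    rw [setLIntegral_torus_eq hL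
      (F := fun x => ‖ψ x - ∑ k ∈ s, fourierCoeffTorus L ψ k * wave L k x‖ₑ ^ 2) ((hψ.1.sub hc.aestronglyMeasurable).enorm.pow_const 2),
      edist_comm, Lp.edist_def, eLpNorm_two_sq]
    congr 1
    refine lintegral_congr_ae ?_
    filter_upwards [hfae, coeFn_sum_modeLp s (fourierCoeffTorus L ψ)] with z hz hz'
    simp only [Pi.sub_apply, hz, hz', wave_ofUnitTorus hL, Function.comp_apply]
  simp only [h2]
  have h3 := ENNReal.Tendsto.const_mul (a := ENNReal.ofReal (L ^ 2))
    ((ENNReal.continuous_pow 2).tendsto 0 |>.comp h1) (Or.inr ENNReal.ofReal_ne_top)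
  simpa using h3

/-! ### The convolution kernel of the cutoff -/

/-- The partial sum of a Fourier series with coefficients `a`. -/
noncomputable def trigSum (L : ℝ) (s : Finset (Fin 2 → ℤ)) (a : (Fin 2 → ℤ) → ℂ) (x : Plane) : ℂ :=
  ∑ k ∈ s, a k * wave L k x

lemma continuous_trigSum (L : ℝ) (s : Finset (Fin 2 → ℤ)) (a : (Fin 2 → ℤ) → ℂ) :
    Continuous (trigSum L s a) :=
  continuous_finsetSum _ fun k _ => continuous_const.mul (continuous_wave L k)

lemma isPeriodic_trigSum {L : ℝ} (hL : 0 < L) (s : Finset (Fin 2 → ℤ)) (a : (Fin 2 → ℤ) → ℂ) :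
    IsPeriodic L (trigSum L s a) := fun x k => by
  simp only [trigSum, isPeriodic_wave hL _ x k]

lemma integral_conj_wave_mul_wave {L : ℝ} (hL : 0 < L) (j k : Fin 2 → ℤ) :
    ∫ z in torus L, (starRingEnd ℂ) (wave L j z) * wave L k z
      = if j = k then ((L ^ 2 : ℝ) : ℂ) else 0 := by
  have h1 := orthonormal_iff_ite.1 orthonormal_modeLp j k
  rw [ContinuousMap.inner_toLp] at h1
  have hc : Continuous fun z => (starRingEnd ℂ) (wave L j z) * wave L k z :=
    (Complex.continuous_conj.comp (continuous_wave L j)).mul (continuous_wave L k)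
  rw [setIntegral_torus_eq hL hc.aestronglyMeasurable]
  simp only [wave_ofUnitTorus hL]
  simp only [mul_comm] at h1 ⊢
  rw [h1, Complex.real_smul]
  split_ifs <;> simp

lemma momentum_neg (L : ℝ) (k : Fin 2 → ℤ) : momentum L (-k) = -momentum L k := by
  ext i
  simp [momentum]

lemma wave_neg_index (L : ℝ) (k : Fin 2 → ℤ) (x : Plane) :
    wave L (-k) x = (starRingEnd ℂ) (wave L k x) := by
  simp [wave, momentum_neg, ← Complex.exp_conj]

lemma wave_sub (L : ℝ) (k : Fin 2 → ℤ) (x z : Plane) :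
    wave L k (x - z) = wave L k x * (starRingEnd ℂ) (wave L k z) := by
  simp only [wave, ← Complex.exp_conj, ← Complex.exp_add, inner_sub_right]
  congr 1
  simp
  ring

lemma restrict_torus_finite (L : ℝ) : IsFiniteMeasure (volume.restrict (torus L) : Measure Plane) := by
  refine ⟨?_⟩
  rw [Measure.restrict_apply_univ]
  have : torus L ⊆ Metric.closedBall 0 (2 * |L|) := by
    intro x hx
    rw [mem_closedBall_zero_iff, EuclideanSpace.norm_eq, Fin.sum_univ_two]
    have h : ∀ i, ‖x i‖ ^ 2 ≤ |L| ^ 2 := fun i => by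
      rw [Real.norm_eq_abs, sq_abs, sq_abs]
      have := hx i
      nlinarith [this.1, this.2]
    refine Real.sqrt_le_iff.2 ⟨by positivity, ?_⟩
    nlinarith [h 0, h 1, sq_nonneg L]
  exact (measure_mono this).trans_lt measure_closedBall_lt_top

section Kernel

variable {L : ℝ} {χ : Plane → ℝ}

lemma norm_kernel_term (hχ : ∀ p, χ p ∈ Set.Icc 0 1) (k : Fin 2 → ℤ) {w : ℂ} (hw : ‖w‖ = 1) :
    ‖((1 - χ (momentum L k) : ℝ) : ℂ) * w‖ = 1 - χ (momentum L k) := by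
  rw [norm_mul, hw, mul_one, Complex.norm_real, Real.norm_of_nonneg]
  linarith [(hχ (momentum L k)).2]

/-- A radial χ is even, so the sign in the exponent is immaterial. -/
lemma kernelH_eq_wave (hχ_radial : ∀ p q, ‖p‖ = ‖q‖ → χ p = χ q) (x : Plane) :
    kernelH L χ x = ((2 * Real.pi / L ^ 2 : ℝ) : ℂ) *
      ∑' k : Fin 2 → ℤ, ((1 - χ (momentum L k) : ℝ) : ℂ) * wave L k x := by
  unfold kernelH
  congr 1
  rw [← (Equiv.neg (Fin 2 → ℤ)).tsum_eq]
  refine tsum_congr fun k => ?_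
  rw [Equiv.neg_apply, planeWave_eq_conj, wave_neg_index, Complex.conj_conj, momentum_neg,
    hχ_radial _ _ (norm_neg _)]

lemma continuous_kernelH (hχ : ∀ p, χ p ∈ Set.Icc 0 1)
    (hχ_sum : Summable fun k : Fin 2 → ℤ => 1 - χ (momentum L k)) : Continuous (kernelH L χ) := by
  refine continuous_const.mul (continuous_tsum
    (fun k => continuous_const.mul (continuous_planeWave _)) hχ_sum fun k x => ?_)
  rw [norm_kernel_term hχ k (norm_planeWave _ x)]

lemma norm_kernelH_le (hL : 0 < L) (hχ : ∀ p, χ p ∈ Set.Icc 0 1)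
    (hχ_sum : Summable fun k : Fin 2 → ℤ => 1 - χ (momentum L k)) (x : Plane) :
    ‖kernelH L χ x‖ ≤ 2 * Real.pi / L ^ 2 * ∑' k : Fin 2 → ℤ, (1 - χ (momentum L k)) := by
  rw [kernelH, norm_mul, Complex.norm_real, Real.norm_of_nonneg (by positivity)]
  refine mul_le_mul_of_nonneg_left ?_ (by positivity)
  exact tsum_of_norm_bounded hχ_sum.hasSum fun k =>
    (norm_kernel_term hχ k (norm_planeWave _ x)).le

lemma isPeriodic_kernelH (hL : 0 < L) : IsPeriodic L (kernelH L χ) := by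
  intro x k
  simp only [kernelH, planeWave_eq_conj, isPeriodic_wave hL _ x k]

lemma kernelH_neg (x : Plane) : kernelH L χ (-x) = (starRingEnd ℂ) (kernelH L χ x) := by
  rw [kernelH, kernelH, map_mul, Complex.conj_ofReal, Complex.conj_tsum]
  congr 1
  refine tsum_congr fun k => ?_
  rw [map_mul, Complex.conj_ofReal]
  congr 1
  simp [planeWave, ← Complex.exp_conj]

lemma oscF_le (hL : 0 < L) (hχ : ∀ p, χ p ∈ Set.Icc 0 1)
    (hχ_sum : Summable fun k : Fin 2 → ℤ => 1 - χ (momentum L k)) (R : ℝ) :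
    ∃ B : ℝ≥0, ∀ x, oscF L χ R x ≤ B := by
  set b := 2 * Real.pi / L ^ 2 * ∑' k : Fin 2 → ℤ, (1 - χ (momentum L k))
  refine ⟨Real.toNNReal (b + b), fun x => iSup₂_le fun y _ => ?_⟩
  rw [← ofReal_norm]
  exact ENNReal.ofReal_le_ofReal ((norm_sub_le _ _).trans
    (add_le_add (norm_kernelH_le hL hχ hχ_sum _) (norm_kernelH_le hL hχ hχ_sum _)))

/-- An uncountable supremum of continuous functions is still lower semicontinuous. -/
lemma measurable_oscF (hχ : ∀ p, χ p ∈ Set.Icc 0 1)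
    (hχ_sum : Summable fun k : Fin 2 → ℤ => 1 - χ (momentum L k)) (R : ℝ) :
    Measurable (oscF L χ R) := by
  have hc := continuous_kernelH hχ hχ_sum
  refine LowerSemicontinuous.measurable (lowerSemicontinuous_biSup fun y _ => ?_)
  exact Continuous.lowerSemicontinuous (by fun_prop)

lemma isPeriodic_oscF (hL : 0 < L) (R : ℝ) : IsPeriodic L (oscF L χ R) := by
  intro x k
  unfold oscF
  refine iSup_congr fun y => iSup_congr fun _ => ?_
  rw [add_sub_right_comm, isPeriodic_kernelH hL, isPeriodic_kernelH hL]

/-- As χ is real, h(-x) is the conjugate of h(x), and the disk of translations is symmetric. The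
symmetry is needed because the kernel appears as h(y - z), while the weight is evaluated at z - y.
-/
lemma oscF_neg (R : ℝ) (x : Plane) : oscF L χ R (-x) = oscF L χ R x := by
  have h : ∀ x, oscF L χ R (-x) ≤ oscF L χ R x := by
    intro x
    refine iSup₂_le fun y hy => ?_
    have hy' : -y ∈ Metric.closedBall (0 : Plane) R := by simpa using hy
    refine le_trans (le_of_eq ?_) (le_iSup₂ (f := fun y (_ : y ∈ Metric.closedBall (0 : Plane) R) =>
      ‖kernelH L χ (x - y) - kernelH L χ x‖ₑ) (-y) hy')
    rw [show -x - y = -(x - -y) by abel, kernelH_neg, kernelH_neg, ← map_sub, ← ofReal_norm,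
      Complex.norm_conj, ofReal_norm]
  exact le_antisymm (h x) (by simpa using h (-x))

/-- Summability of 1 - χ dominates the series and allows termwise integration. Orthogonality then
leaves only the term j = k. -/
lemma integral_kernelH_mul_wave (hL : 0 < L) (hχ : ∀ p, χ p ∈ Set.Icc 0 1)
    (hχ_radial : ∀ p q, ‖p‖ = ‖q‖ → χ p = χ q)
    (hχ_sum : Summable fun k : Fin 2 → ℤ => 1 - χ (momentum L k)) (k : Fin 2 → ℤ) (x : Plane) :
    ∫ z in torus L, kernelH L χ (x - z) * wave L k z
      = ((2 * Real.pi * (1 - χ (momentum L k)) : ℝ) : ℂ) * wave L k x := by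
  have := restrict_torus_finite L
  set F : (Fin 2 → ℤ) → Plane → ℂ := fun j z =>
    ((1 - χ (momentum L j) : ℝ) : ℂ) * wave L j (x - z) * wave L k z with hF
  have hFc : ∀ j, Continuous (F j) := fun j =>
    (continuous_const.mul ((continuous_wave L j).comp (continuous_const.sub continuous_id))).mul
      (continuous_wave L k)
  have hFn : ∀ j z, ‖F j z‖ = 1 - χ (momentum L j) := fun j z => by
    rw [hF]
    dsimp only
    rw [norm_mul, norm_kernel_term hχ j (norm_wave L j _), norm_wave, mul_one]
  have hFi : ∀ j, Integrable (F j) (volume.restrict (torus L)) := fun j =>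
    (integrable_const (1 - χ (momentum L j))).mono' (hFc j).aestronglyMeasurable
      (ae_of_all _ fun z => (hFn j z).le)
  have hsum : Summable fun j => ∫ z in torus L, ‖F j z‖ := by
    simp only [hFn, integral_const, smul_eq_mul]
    exact hχ_sum.mul_left _
  have h1 := hasSum_integral_of_summable_integral_norm hFi hsum
  have h2 : ∀ j, ∫ z in torus L, F j z
      = if j = k then ((1 - χ (momentum L k) : ℝ) : ℂ) * wave L k x * ((L ^ 2 : ℝ) : ℂ) else 0 := by
    intro j
    have : ∀ z, F j z = (((1 - χ (momentum L j) : ℝ) : ℂ) * wave L j x) *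
        ((starRingEnd ℂ) (wave L j z) * wave L k z) := fun z => by
      simp only [hF, wave_sub]; ring
    simp only [this]
    rw [integral_const_mul, integral_conj_wave_mul_wave hL]
    split_ifs with h
    · rw [h]
    · simp
  simp only [h2] at h1
  have h3 := h1.unique (hasSum_ite_eq k _)
  have h4 : ∀ z, kernelH L χ (x - z) * wave L k z
      = ((2 * Real.pi / L ^ 2 : ℝ) : ℂ) * ∑' j, F j z := fun z => by
    rw [kernelH_eq_wave hχ_radial, mul_assoc, ← tsum_mul_right]
  simp only [h4]
  rw [integral_const_mul, h3]
  have hL' : (L : ℂ) ≠ 0 := by exact_mod_cast hL.ne'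
  push_cast
  field_simp

/-- The effect of removing the cutoff is convolution with the kernel `h / 2π`. -/
lemma integral_kernelH_mul_trigSum (hL : 0 < L) (hχ : ∀ p, χ p ∈ Set.Icc 0 1)
    (hχ_radial : ∀ p q, ‖p‖ = ‖q‖ → χ p = χ q)
    (hχ_sum : Summable fun k : Fin 2 → ℤ => 1 - χ (momentum L k)) (s : Finset (Fin 2 → ℤ))
    (a : (Fin 2 → ℤ) → ℂ) (x : Plane) :
    ∫ z in torus L, kernelH L χ (x - z) * trigSum L s a z
      = ((2 * Real.pi : ℝ) : ℂ) *
        (trigSum L s a x - trigSum L s (fun k => χ (momentum L k) * a k) x) := by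
  have := restrict_torus_finite L
  have hc := continuous_kernelH hχ hχ_sum
  have hi : ∀ k, Integrable (fun z => kernelH L χ (x - z) * wave L k z)
      (volume.restrict (torus L)) := fun k => by
    refine (integrable_const (2 * Real.pi / L ^ 2 * ∑' k : Fin 2 → ℤ, (1 - χ (momentum L k)))).mono'
      ((hc.comp (continuous_const.sub continuous_id)).mul
        (continuous_wave L k)).aestronglyMeasurable (ae_of_all _ fun z => ?_)
    rw [norm_mul, norm_wave, mul_one]
    exact norm_kernelH_le hL hχ hχ_sum _
  simp only [trigSum, Finset.mul_sum, ← Finset.sum_sub_distrib, mul_left_comm _ (a _)]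
  rw [integral_finsetSum _ fun k _ => (hi k).const_mul _]
  refine Finset.sum_congr rfl fun k _ => ?_
  rw [integral_const_mul, integral_kernelH_mul_wave hL hχ hχ_radial hχ_sum]
  push_cast
  ring

/-- Cauchy-Schwarz for the measure with density f, applied to the functions 1 and g. -/
lemma lintegral_mul_sq_le {α : Type*} [MeasurableSpace α] (μ : Measure α) {f g : α → ℝ≥0∞}
    (hf : AEMeasurable f μ) (hg : AEMeasurable g μ) :
    (∫⁻ x, f x * g x ∂μ) ^ 2 ≤ (∫⁻ x, f x ∂μ) * ∫⁻ x, f x * g x ^ 2 ∂μ := by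
  have h := ENNReal.lintegral_mul_le_Lp_mul_Lq μ Real.HolderConjugate.two_two
    (f := fun x => f x ^ (1 / 2 : ℝ)) (g := fun x => f x ^ (1 / 2 : ℝ) * g x)
    (hf.pow_const _) ((hf.pow_const _).mul hg)
  have hhalf : ∀ u : ℝ≥0∞, u ^ (1 / 2 : ℝ) * u ^ (1 / 2 : ℝ) = u := fun u => by
    rw [← ENNReal.rpow_add_of_nonneg _ _ (by norm_num) (by norm_num)]
    norm_num
  have hsq : ∀ u : ℝ≥0∞, u ^ (2 : ℝ) = u * u := fun u => by
    rw [ENNReal.rpow_two, sq]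
  have h1 : ∀ x, (fun x => f x ^ (1 / 2 : ℝ)) x ^ (2 : ℝ) = f x := fun x => by
    rw [hsq, hhalf]
  have h2 : ∀ x, (fun x => f x ^ (1 / 2 : ℝ) * g x) x ^ (2 : ℝ) = f x * g x ^ 2 := fun x => by
    rw [hsq, mul_mul_mul_comm, hhalf, sq]
  have h3 : ∀ x, ((fun x => f x ^ (1 / 2 : ℝ)) * fun x => f x ^ (1 / 2 : ℝ) * g x) x = f x * g x :=
    fun x => by rw [Pi.mul_apply, ← mul_assoc, hhalf]
  simp only [h1, h2, h3] at h
  calc _ ≤ ((∫⁻ x, f x ∂μ) ^ (1 / 2 : ℝ) * (∫⁻ x, f x * g x ^ 2 ∂μ) ^ (1 / 2 : ℝ)) ^ 2 := by gcongr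
    _ = _ := by rw [sq, mul_mul_mul_comm, hhalf, hhalf]

/-- Since ψ - ξ is convolution with h / 2π, its increment from y to y + x is at most (1 / 2π) ∫
f_R(z - y) |ψ(z)| dz for |x| ≤ R. Weighted Cauchy-Schwarz with weight f_R splits the square of the
integral into ∫ f_R times ∫ f_R |ψ|², which is where both factors of w_R come from. -/
lemma exists_error_bound (hL : 0 < L) (hχ : ∀ p, χ p ∈ Set.Icc 0 1)
    (hχ_radial : ∀ p q, ‖p‖ = ‖q‖ → χ p = χ q)
    (hχ_sum : Summable fun k : Fin 2 → ℤ => 1 - χ (momentum L k)) (R : ℝ)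
    (s : Finset (Fin 2 → ℤ)) (a : (Fin 2 → ℤ) → ℂ) (y : Plane) :
    ∃ M : ℝ, (∀ x, ‖x‖ ≤ R →
        ‖(trigSum L s a (y + x) - trigSum L s (fun k => χ (momentum L k) * a k) (y + x))
          - (trigSum L s a y - trigSum L s (fun k => χ (momentum L k) * a k) y)‖ ≤ M / 2) ∧
      ENNReal.ofReal (2 * Real.pi * M ^ 2)
        ≤ ∫⁻ z in torus L, weightW L χ R (z - y) * ‖trigSum L s a z‖ₑ ^ 2 := by
  have := restrict_torus_finite L
  have hhc := continuous_kernelH hχ hχ_sum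
  have hψc := continuous_trigSum L s a
  have hom := measurable_oscF (L := L) hχ hχ_sum R
  have hop := isPeriodic_oscF (χ := χ) hL R
  obtain ⟨B, hB⟩ := oscF_le hL hχ hχ_sum R
  set ψ := trigSum L s a with hψ
  set ξ := trigSum L s (fun k => χ (momentum L k) * a k) with hξ
  have hψb : ∀ z, ‖ψ z‖ ≤ ∑ k ∈ s, ‖a k‖ := fun z => by
    rw [hψ, trigSum]
    refine (norm_sum_le _ _).trans (Finset.sum_le_sum fun k _ => ?_)
    rw [norm_mul, norm_wave, mul_one]
  set J := ∫⁻ z in torus L, oscF L χ R (z - y) * ‖ψ z‖ₑ with hJ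
  have hJtop : J ≠ ⊤ := by
    refine ne_top_of_le_ne_top (b := ∫⁻ z in torus L, B * ENNReal.ofReal (∑ k ∈ s, ‖a k‖)) ?_
      (lintegral_mono fun z => ?_)
    · rw [lintegral_const]
      exact ENNReal.mul_ne_top (ENNReal.mul_ne_top ENNReal.coe_ne_top ENNReal.ofReal_ne_top)
        (measure_ne_top _ _)
    · rw [← ofReal_norm]
      exact mul_le_mul' (hB _) (ENNReal.ofReal_le_ofReal (hψb z))
  have hint : ∀ x, Integrable (fun z => kernelH L χ (x - z) * ψ z) (volume.restrict (torus L)) := by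
    intro x
    refine (integrable_const ((2 * Real.pi / L ^ 2 * ∑' k : Fin 2 → ℤ, (1 - χ (momentum L k)))
      * ∑ k ∈ s, ‖a k‖)).mono'
      ((hhc.comp (continuous_const.sub continuous_id)).mul hψc).aestronglyMeasurable
        (ae_of_all _ fun z => ?_)
    rw [norm_mul]
    exact mul_le_mul (norm_kernelH_le hL hχ hχ_sum _) (hψb z) (norm_nonneg _)
      ((norm_nonneg _).trans (norm_kernelH_le hL hχ hχ_sum 0))
  -- M / 2 = J / 2π is the bound from the convolution. Then 2π M² = (2 / π) J², the constant in w_R.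
  refine ⟨1 / Real.pi * J.toReal, fun x hx => ?_, ?_⟩
  · have h1 := integral_kernelH_mul_trigSum hL hχ hχ_radial hχ_sum s a (y + x)
    have h2 := integral_kernelH_mul_trigSum hL hχ hχ_radial hχ_sum s a y
    rw [← hψ, ← hξ] at h1 h2
    have h3 : ‖((2 * Real.pi : ℝ) : ℂ) * ((ψ (y + x) - ξ (y + x)) - (ψ y - ξ y))‖ₑ ≤ J := by
      rw [mul_sub, ← h1, ← h2, ← integral_sub (hint _) (hint _)]
      refine (enorm_integral_le_lintegral_enorm _).trans (lintegral_mono fun z => ?_)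
      rw [← sub_mul, enorm_mul]
      gcongr
      rw [← oscF_neg, neg_sub]
      have hx' : -x ∈ Metric.closedBall (0 : Plane) R := by simpa using hx
      have := le_iSup₂ (f := fun w (_ : w ∈ Metric.closedBall (0 : Plane) R) =>
        ‖kernelH L χ (y - z - w) - kernelH L χ (y - z)‖ₑ) (-x) hx'
      rwa [show y - z - -x = y + x - z by abel] at this
    rw [← ofReal_norm, ENNReal.ofReal_le_iff_le_toReal hJtop, norm_mul, Complex.norm_real,
      Real.norm_of_nonneg (by positivity)] at h3
    have hpi := Real.pi_pos
    rw [div_mul_eq_mul_div, one_mul, div_div, le_div_iff₀ (by positivity)]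
    linarith
  · have hpi := Real.pi_pos
    have h1 : J ^ 2 ≤ (∫⁻ z in torus L, oscF L χ R z) *
        ∫⁻ z in torus L, oscF L χ R (z - y) * ‖ψ z‖ₑ ^ 2 := by
      refine (lintegral_mul_sq_le _ (f := fun z => oscF L χ R (z - y)) (g := fun z => ‖ψ z‖ₑ)
        (hom.comp (measurable_sub_const y)).aemeasurable hψc.enorm.measurable.aemeasurable).trans ?_
      refine le_of_eq ?_
      congr 1
      rw [← setLIntegral_torus_add hL hop hom (-y)]
      refine lintegral_congr fun z => ?_
      rw [neg_add_eq_sub]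
    calc ENNReal.ofReal (2 * Real.pi * (1 / Real.pi * J.toReal) ^ 2)
        = ENNReal.ofReal (2 / Real.pi) * J ^ 2 := by
          rw [show 2 * Real.pi * (1 / Real.pi * J.toReal) ^ 2 = 2 / Real.pi * J.toReal ^ 2 by
            field_simp, ENNReal.ofReal_mul (by positivity), ENNReal.ofReal_pow (by positivity),
            ENNReal.ofReal_toReal hJtop]
      _ ≤ ENNReal.ofReal (2 / Real.pi) * ((∫⁻ z in torus L, oscF L χ R z) *
          ∫⁻ z in torus L, oscF L χ R (z - y) * ‖ψ z‖ₑ ^ 2) := by gcongr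
      _ = _ := by
          rw [← mul_assoc, ← lintegral_const_mul]
          · refine lintegral_congr fun z => ?_
            rw [weightW]
            ring
          · exact (hom.comp (measurable_sub_const y)).mul (hψc.enorm.measurable.pow_const 2)

end Kernel

/-! ### Kinetic energy of trigonometric sums -/

/-- The operator norm is at most the Hilbert-Schmidt norm. The latter is the one that Parseval's
identity computes. -/
lemma enorm_clm_sq_le (A : Plane →L[ℝ] ℂ) :
    ‖A‖ₑ ^ 2 ≤ ∑ j, ‖A (EuclideanSpace.single j 1)‖ₑ ^ 2 := by
  have h : ‖A‖ ^ 2 ≤ ∑ j, ‖A (EuclideanSpace.single j 1)‖ ^ 2 := by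
    set S := ∑ j, ‖A (EuclideanSpace.single j 1)‖ ^ 2 with hS
    have hS0 : 0 ≤ S := Finset.sum_nonneg fun _ _ => by positivity
    have : ‖A‖ ≤ Real.sqrt S := by
      refine A.opNorm_le_bound (Real.sqrt_nonneg _) fun u => ?_
      have hu : u = ∑ j, u j • (EuclideanSpace.single j (1 : ℝ) : Plane) := by
        ext i
        fin_cases i <;> simp
      have h1 : ‖A u‖ ≤ ∑ j, ‖A (EuclideanSpace.single j 1)‖ * ‖u j‖ := by
        conv_lhs => rw [hu]
        rw [map_sum]
        refine (norm_sum_le _ _).trans (Finset.sum_le_sum fun j _ => ?_)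
        rw [map_smul, norm_smul, mul_comm]
      refine h1.trans ?_
      rw [EuclideanSpace.norm_eq]
      exact Real.sum_mul_le_sqrt_mul_sqrt _ _ _
    calc ‖A‖ ^ 2 ≤ Real.sqrt S ^ 2 := by gcongr
      _ = S := Real.sq_sqrt hS0
  have h2 := ENNReal.ofReal_le_ofReal h
  rw [ENNReal.ofReal_sum_of_nonneg fun _ _ => by positivity] at h2
  simpa only [ENNReal.ofReal_pow (norm_nonneg _), ofReal_norm] using h2

lemma hasFDerivAt_wave (L : ℝ) (k : Fin 2 → ℤ) (x : Plane) :
    HasFDerivAt (wave L k)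
      ((Complex.I * wave L k x) • Complex.ofRealCLM.comp (innerSL ℝ (momentum L k))) x := by
  have h1 : HasFDerivAt (fun x => Complex.I * ((inner ℝ (momentum L k) x : ℝ) : ℂ))
      (Complex.I • Complex.ofRealCLM.comp (innerSL ℝ (momentum L k))) x :=
    (Complex.ofRealCLM.comp (innerSL ℝ (momentum L k))).hasFDerivAt.const_mul Complex.I
  refine h1.cexp.congr_fderiv ?_
  ext v
  simp only [wave, smul_apply, smul_eq_mul]
  ring

lemma hasFDerivAt_trigSum (L : ℝ) (s : Finset (Fin 2 → ℤ)) (a : (Fin 2 → ℤ) → ℂ) (x : Plane) :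
    HasFDerivAt (trigSum L s a) (∑ k ∈ s, a k • ((Complex.I * wave L k x) •
      Complex.ofRealCLM.comp (innerSL ℝ (momentum L k)))) x :=
  HasFDerivAt.fun_sum fun k _ => (hasFDerivAt_wave L k x).const_mul (a k)

lemma fderiv_trigSum_single (L : ℝ) (s : Finset (Fin 2 → ℤ)) (a : (Fin 2 → ℤ) → ℂ) (x : Plane)
    (j : Fin 2) : fderiv ℝ (trigSum L s a) x (EuclideanSpace.single j 1)
      = trigSum L s (fun k => Complex.I * (momentum L k j : ℂ) * a k) x := by
  rw [(hasFDerivAt_trigSum L s a x).fderiv, sum_apply, trigSum]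
  refine Finset.sum_congr rfl fun k _ => ?_
  simp only [smul_apply, ContinuousLinearMap.comp_apply, innerSL_apply_apply,
    EuclideanSpace.inner_single_right, Complex.ofRealCLM_apply, smul_eq_mul, one_mul]
  simp
  ring

lemma contDiff_trigSum (L : ℝ) (s : Finset (Fin 2 → ℤ)) (a : (Fin 2 → ℤ) → ℂ) :
    ContDiff ℝ 1 (trigSum L s a) :=
  ContDiff.sum fun k _ => contDiff_const.mul (contDiff_const.mul
    (Complex.ofRealCLM.comp (innerSL ℝ (momentum L k))).contDiff).cexp

lemma isPeriodic_fderiv {L : ℝ} {f : Plane → ℂ} (hf : IsPeriodic L f) :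
    IsPeriodic L (fderiv ℝ f) := fun x k => by
  have : (fun x => f (x + latticeVec L k)) = f := funext fun x => hf x k
  rw [← fderiv_comp_add_right, this]

/-- Differentiation multiplies the coefficients by i p, so Parseval's identity turns the sum of
squared partial derivatives into the terms k ∈ s of the kinetic form. The remaining terms are
nonnegative. -/
lemma lintegral_fderiv_le_kineticForm {L : ℝ} (hL : 0 < L) {χ : Plane → ℝ}
    (ψ : Plane → ℂ) (s : Finset (Fin 2 → ℤ)) :
    ∫⁻ x in torus L, ‖fderiv ℝ (trigSum L s fun k => χ (momentum L k) * fourierCoeffTorus L ψ k) x‖ₑ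
      ^ 2 ≤ kineticForm L χ ψ := by
  set a : (Fin 2 → ℤ) → ℂ := fun k => χ (momentum L k) * fourierCoeffTorus L ψ k with ha
  have hm : ∀ j : Fin 2, Measurable fun x =>
      ‖fderiv ℝ (trigSum L s a) x (EuclideanSpace.single j 1)‖ₑ ^ 2 := fun j => by
    simp only [fderiv_trigSum_single]
    exact (continuous_trigSum _ _ _).enorm.measurable.pow_const 2
  calc _ ≤ ∫⁻ x in torus L, ∑ j, ‖fderiv ℝ (trigSum L s a) x (EuclideanSpace.single j 1)‖ₑ ^ 2 :=
        lintegral_mono fun x => enorm_clm_sq_le _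
    _ = ∑ j : Fin 2, ENNReal.ofReal (L ^ 2) *
          ∑ k ∈ s, ‖Complex.I * (momentum L k j : ℂ) * a k‖ₑ ^ 2 := by
        rw [lintegral_finsetSum _ fun j _ => hm j]
        refine Finset.sum_congr rfl fun j _ => ?_
        simp only [fderiv_trigSum_single, trigSum]
        exact setLIntegral_torus_sum_wave hL s _
    _ = ∑ k ∈ s, ENNReal.ofReal (1 / L ^ 2 * (‖momentum L k‖ ^ 2 * χ (momentum L k) ^ 2
      * ‖∫ x in torus L, ψ x * planeWave (momentum L k) x‖ ^ 2)) := by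
        simp only [Finset.mul_sum]
        rw [Finset.sum_comm]
        refine Finset.sum_congr rfl fun k _ => ?_
        have hterm : ∀ j : Fin 2, ENNReal.ofReal (L ^ 2) *
            ‖Complex.I * (momentum L k j : ℂ) * a k‖ₑ ^ 2
            = ENNReal.ofReal (L ^ 2 * ((momentum L k j) ^ 2 * ‖a k‖ ^ 2)) := fun j => by
          rw [← ofReal_norm, ← ENNReal.ofReal_pow (norm_nonneg _),
            ← ENNReal.ofReal_mul (by positivity), norm_mul, norm_mul, Complex.norm_I, one_mul,
            Complex.norm_real, mul_pow, Real.norm_eq_abs, sq_abs]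
        simp only [hterm]
        rw [← ENNReal.ofReal_sum_of_nonneg fun _ _ => by positivity, ← Finset.mul_sum,
          ← Finset.sum_mul]
        congr 1
        rw [← EuclideanSpace.real_norm_sq_eq, ha]
        simp only [fourierCoeffTorus, norm_mul, Complex.norm_real, Real.norm_eq_abs, mul_pow, sq_abs]
        field_simp
    _ ≤ _ := ENNReal.sum_le_tsum s

/-! ### Decomposition of the torus into nearest-neighbor cells -/

/-- The points whose nearest neighbor is `y i`; ties are decided in favor of the smallest index. -/
def cell (L : ℝ) {n : ℕ} (y : Fin n → Plane) (i : Fin n) : Set Plane :=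
  {x | ∀ j, torusDist L x (y i) ≤ torusDist L x (y j) ∧
    (j < i → torusDist L x (y i) < torusDist L x (y j))}

section Cell

variable {L : ℝ} {n : ℕ} {y : Fin n → Plane}

lemma measurableSet_cell (i : Fin n) : MeasurableSet (cell L y i) := by
  have hm := fun i => (continuous_torusDist L (y i)).measurable
  have : cell L y i = ⋂ j, ({x | torusDist L x (y i) ≤ torusDist L x (y j)} ∩
      {x | j < i → torusDist L x (y i) < torusDist L x (y j)}) := by
    ext x; simp [cell]
  rw [this]
  refine MeasurableSet.iInter fun j => (measurableSet_le (hm i) (hm j)).inter ?_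
  by_cases h : j < i
  · simpa [h] using measurableSet_lt (hm i) (hm j)
  · simp [h]

lemma mem_cell_add (i : Fin n) (x : Plane) (k : Fin 2 → ℤ) :
    x + latticeVec L k ∈ cell L y i ↔ x ∈ cell L y i := by
  refine forall_congr' fun j => ?_
  have h := fun i => isPeriodic_torusDist L (y i) x k
  dsimp only at h
  rw [h, h]

lemma cell_unique {i j : Fin n} {x : Plane} (hi : x ∈ cell L y i) (hj : x ∈ cell L y j) :
    i = j := by
  rcases lt_trichotomy i j with h | h | h
  · exact absurd ((hj i).2 h) (not_lt.2 (hi j).1)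
  · exact h
  · exact absurd ((hi j).2 h) (not_lt.2 (hj i).1)

lemma exists_mem_cell (i₀ : Fin n) (x : Plane) : ∃ i, x ∈ cell L y i := by
  classical
  obtain ⟨i₁, -, hi₁⟩ := Finset.exists_min_image Finset.univ (fun i => torusDist L x (y i))
    ⟨i₀, Finset.mem_univ _⟩
  have hne : (Finset.univ.filter fun i => torusDist L x (y i) = torusDist L x (y i₁)).Nonempty :=
    ⟨i₁, by simp⟩
  set i := Finset.min' _ hne with hi
  have hmem := Finset.min'_mem _ hne
  rw [← hi, Finset.mem_filter] at hmem
  refine ⟨i, fun j => ⟨hmem.2.trans_le (hi₁ j (Finset.mem_univ _)), fun hj => ?_⟩⟩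
  rw [hmem.2]
  refine lt_of_le_of_ne (hi₁ j (Finset.mem_univ _)) fun h => ?_
  have := Finset.min'_le (Finset.univ.filter fun i => torusDist L x (y i) = torusDist L x (y i₁)) j
    (by simpa using h.symm)
  exact absurd hj (not_lt.2 this)

lemma sum_indicator_cell (F : Fin n → Plane → ℝ≥0∞) {i : Fin n} {x : Plane}
    (hx : x ∈ cell L y i) : ∑ j, (cell L y j).indicator (F j) x = F i x := by
  rw [Finset.sum_eq_single i]
  · exact Set.indicator_of_mem hx _
  · intro j _ hj
    exact Set.indicator_of_notMem (fun h => hj (cell_unique h hx)) _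
  · simp

lemma torusDist_add_of_norm_le {R : ℝ} (hL : 0 < L) (hRL : R < L / 2) (y : Plane) {x : Plane}
    (hx : ‖x‖ ≤ R) : torusDist L (y + x) y = ‖x‖ :=
  torusDist_add_self hL y fun i => (abs_apply_le_norm x i).trans (hx.trans hRL.le)

/-- Moving from y i + x to y i + s x shortens the distance to y i by exactly (1 - s)|x|, because |x|
≤ R < L / 2. By the triangle inequality the distance to any other point shrinks by no more than
that. Both the weak and the strict inequalities of the cell survive. -/
lemma cell_star {R : ℝ} (hL : 0 < L) (hRL : R < L / 2) (i : Fin n) :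
    ∀ x ∈ cellPart (cell L y i) (y i) R, ∀ s ∈ Set.Ioc (0 : ℝ) 1, y i + s • x ∈ cell L y i := by
  rintro x ⟨hx, hxR⟩ s ⟨hs0, hs1⟩
  have hn : ‖s • x‖ = s * ‖x‖ := by rw [norm_smul, Real.norm_of_nonneg hs0.le]
  have h1 := torusDist_add_of_norm_le hL hRL (y i) hxR
  have h2 : torusDist L (y i + s • x) (y i) = s * ‖x‖ := by
    rw [torusDist_add_of_norm_le hL hRL (y i) (by rw [hn]; nlinarith [norm_nonneg x]), hn]
  have h3 : ∀ j, torusDist L (y i + x) (y j)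
      ≤ torusDist L (y i + s • x) (y j) + (1 - s) * ‖x‖ := fun j => by
    refine (torusDist_le_add L _ (y i + s • x) _).trans (le_of_eq ?_)
    rw [add_sub_add_left_eq_sub, show x - s • x = (1 - s) • x by rw [sub_smul, one_smul],
      norm_smul, Real.norm_of_nonneg (by linarith)]
  intro j
  rw [h2]
  refine ⟨?_, fun hj => ?_⟩
  · have := (hx j).1
    rw [h1] at this
    linarith [h3 j]
  · have := (hx j).2 hj
    rw [h1] at this
    linarith [h3 j]

lemma isPeriodic_indicator_cell (i : Fin n) {F : Plane → ℝ≥0∞} (hF : IsPeriodic L F) :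
    IsPeriodic L ((cell L y i).indicator F) := by
  intro x k
  by_cases hx : x ∈ cell L y i
  · rw [Set.indicator_of_mem hx, Set.indicator_of_mem ((mem_cell_add i x k).2 hx), hF]
  · rw [Set.indicator_of_notMem hx, Set.indicator_of_notMem fun h => hx ((mem_cell_add i x k).1 h)]

/-- Used for the energy, where the contribution of the cell beyond distance R is dropped. R < L / 2
keeps the disk inside the centered square, so nothing is counted twice. -/
lemma lintegral_cellPart_le_torus {R : ℝ} (hL : 0 < L) (hRL : R < L / 2) (i : Fin n)
    {F : Plane → ℝ≥0∞} (hF : IsPeriodic L F) (hFm : Measurable F) :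
    ∫⁻ x in cellPart (cell L y i) (y i) R, F (y i + x)
      ≤ ∫⁻ x in torus L, (cell L y i).indicator F x := by
  rw [setLIntegral_torus_centered hL (isPeriodic_indicator_cell i hF)
    (hFm.indicator (measurableSet_cell i)) (y i)]
  refine (setLIntegral_mono' (measurableSet_cellPart (measurableSet_cell i) _ _)
    fun x hx => ?_).trans (lintegral_mono_set fun x hx => ?_)
  · rw [Set.indicator_of_mem hx.1]
  · exact mem_centeredBox_of_norm_lt (hx.2.trans_lt hRL)

/-- Used for the soft potential. In the centered square the torus distance to the center is the
norm, so an integrand that vanishes beyond distance R lives on the cell part alone. -/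
lemma lintegral_torus_le_cellPart {R : ℝ} (hL : 0 < L) (i : Fin n) {F : Plane → ℝ≥0∞}
    (hF : IsPeriodic L F) (hFm : Measurable F)
    (hF0 : ∀ x, R < torusDist L x (y i) → F x = 0) :
    ∫⁻ x in torus L, (cell L y i).indicator F x
      ≤ ∫⁻ x in cellPart (cell L y i) (y i) R, F (y i + x) := by
  rw [setLIntegral_torus_centered hL (isPeriodic_indicator_cell i hF)
    (hFm.indicator (measurableSet_cell i)) (y i),
    ← lintegral_indicator (measurableSet_box _ _),
    ← lintegral_indicator (measurableSet_cellPart (measurableSet_cell i) _ _)]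
  refine lintegral_mono fun x => ?_
  by_cases hx : x ∈ centeredBox L
  swap
  · rw [Set.indicator_of_notMem hx]; exact zero_le
  rw [Set.indicator_of_mem hx]
  by_cases hc : y i + x ∈ cell L y i
  swap
  · rw [Set.indicator_of_notMem hc]; exact zero_le
  rw [Set.indicator_of_mem hc]
  by_cases hR : ‖x‖ ≤ R
  · rw [Set.indicator_of_mem (show x ∈ cellPart (cell L y i) (y i) R from ⟨hc, hR⟩)]
  · rw [hF0 _ (by
      rw [torusDist_add_self hL _ (abs_apply_le_of_mem_centeredBox hx)]
      exact not_le.1 hR)]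
    exact zero_le

end Cell

/-! ### The inequality for trigonometric sums -/

lemma measurable_weightW {L : ℝ} {χ : Plane → ℝ} (hχ : ∀ p, χ p ∈ Set.Icc 0 1)
    (hχ_sum : Summable fun k : Fin 2 → ℤ => 1 - χ (momentum L k)) (R : ℝ) :
    Measurable (weightW L χ R) :=
  ((measurable_oscF hχ hχ_sum R).const_mul _).mul_const _

/-- The Dyson inequality for a trigonometric sum and a bounded potential. -/
lemma IsScatteringSolution.trigSum_inequality {L R₀ R : ℝ} {W φ m : ℝ → ℝ}
    (h : IsScatteringSolution R₀ W φ m) (hR₀ : 0 < R₀) (hR₀R : R₀ < R) (hRL : R < L / 2)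
    {χ : Plane → ℝ} (hχ : ∀ p, χ p ∈ Set.Icc 0 1) (hχ_radial : ∀ p q, ‖p‖ = ‖q‖ → χ p = χ q)
    (hχ_sum : Summable fun k : Fin 2 → ℤ => 1 - χ (momentum L k))
    {U : ℝ → ℝ≥0∞} (hU : Measurable U) (hU_supp : ∀ t, t ∉ Set.Icc R₀ R → U t = 0)
    (hU_int : ∫⁻ t in Set.Ioi 0, U t * ENNReal.ofReal (φ t * t) ≤ 1)
    {n : ℕ} {y : Fin n → Plane} {NN : Plane → Fin n}
    (hNN : ∀ x i, torusDist L x (y (NN x)) ≤ torusDist L x (y i))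
    {ε : ℝ} (hε : 0 < ε) (ψ : Plane → ℂ) (s : Finset (Fin 2 → ℤ)) :
    ENNReal.ofReal (1 - ε) * potentialForm L (fun x => U (torusDist L x (y (NN x))))
        (trigSum L s (fourierCoeffTorus L ψ))
      ≤ kineticForm L χ ψ
        + potentialForm L (fun x => ∑ i, ENNReal.ofReal (W (torusDist L x (y i))))
          (trigSum L s (fourierCoeffTorus L ψ))
        + ENNReal.ofReal (1 / ε) * (∫⁻ t in Set.Ioi 0, U t * ENNReal.ofReal t)
          * potentialForm L (fun x => ∑ i, weightW L χ R (x - y i))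
            (trigSum L s (fourierCoeffTorus L ψ)) := by
  have hL : 0 < L := by linarith
  have hkin := lintegral_fderiv_le_kineticForm hL (χ := χ) ψ s
  set Ψ := trigSum L s (fourierCoeffTorus L ψ) with hΨ
  set ξ := trigSum L s fun k => χ (momentum L k) * fourierCoeffTorus L ψ k with hξ
  have hΨc : Continuous Ψ := continuous_trigSum _ _ _
  have hΨp : IsPeriodic L Ψ := isPeriodic_trigSum hL _ _
  have hΨm : Measurable fun x => ‖Ψ x‖ₑ ^ 2 := hΨc.enorm.measurable.pow_const 2
  have hξd : ContDiff ℝ 1 ξ := contDiff_trigSum _ _ _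
  have hξp : IsPeriodic L (fderiv ℝ ξ) := isPeriodic_fderiv (isPeriodic_trigSum hL _ _)
  have hξm : Measurable fun x => ‖fderiv ℝ ξ x‖ₑ ^ 2 :=
    (hξd.continuous_fderiv one_ne_zero).enorm.measurable.pow_const 2
  have hWm := h.measurable
  have hdm : ∀ i, Measurable fun x => torusDist L x (y i) := fun i =>
    (continuous_torusDist L (y i)).measurable
  choose M hM1 hM2 using fun i =>
    exists_error_bound hL hχ hχ_radial hχ_sum R s (fourierCoeffTorus L ψ) (y i)
  rw [← hΨ, ← hξ] at hM1
  simp only [← hΨ] at hM2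
  set I := ∫⁻ t in Set.Ioi 0, U t * ENNReal.ofReal t with hI
  set FU : Fin n → Plane → ℝ≥0∞ := fun i x => U (torusDist L x (y i)) * ‖Ψ x‖ₑ ^ 2 with hFU
  set FW : Fin n → Plane → ℝ≥0∞ := fun i x =>
    ENNReal.ofReal (W (torusDist L x (y i))) * ‖Ψ x‖ₑ ^ 2 with hFW
  set FE : Fin n → Plane → ℝ≥0∞ := fun i x => ‖fderiv ℝ ξ x‖ₑ ^ 2 + FW i x with hFE
  have hFUm : ∀ i, Measurable (FU i) := fun i => (hU.comp (hdm i)).mul hΨm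
  have hFWm : ∀ i, Measurable (FW i) := fun i => ((hWm.comp (hdm i)).ennreal_ofReal).mul hΨm
  have hFEm : ∀ i, Measurable (FE i) := fun i => hξm.add (hFWm i)
  have hper : ∀ i, IsPeriodic L fun x => torusDist L x (y i) := fun i => isPeriodic_torusDist L _
  have hFUp : ∀ i, IsPeriodic L (FU i) := fun i x k => by
    simp only [hFU, hΨp x k, show torusDist L (x + latticeVec L k) (y i) = torusDist L x (y i) from
      hper i x k]
  have hFEp : ∀ i, IsPeriodic L (FE i) := fun i x k => by
    simp only [hFE, hFW, hΨp x k, hξp x k,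
      show torusDist L (x + latticeVec L k) (y i) = torusDist L x (y i) from hper i x k]
  have hcellU : ∀ i, ENNReal.ofReal (1 - ε) * ∫⁻ x in torus L, (cell L y i).indicator (FU i) x
      ≤ (∫⁻ x in torus L, (cell L y i).indicator (FE i) x) + ENNReal.ofReal (1 / ε) * I *
        ∫⁻ z in torus L, weightW L χ R (z - y i) * ‖Ψ z‖ₑ ^ 2 := by
    intro i
    have h1 := lintegral_torus_le_cellPart (R := R) hL i (hFUp i) (hFUm i) fun x hx => by
      simp only [hFU]
      rw [hU_supp _ fun h => absurd h.2 (not_le.2 hx), zero_mul]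
    have h2 := lintegral_cellPart_le_torus (y := y) hL hRL i (hFEp i) (hFEm i)
    have h3 := h.lintegral_cellPart_le hΨc hξd (y i) (measurableSet_cell i) (cell_star hL hRL i)
      (hM1 i) hU hU_supp hU_int hε
    have hm := measurableSet_cellPart (measurableSet_cell (L := L) (y := y) i) (y i) R
    have h4 : ∫⁻ x in cellPart (cell L y i) (y i) R, FU i (y i + x)
        = ∫⁻ x in cellPart (cell L y i) (y i) R, U ‖x‖ * ‖Ψ (y i + x)‖ₑ ^ 2 :=
      setLIntegral_congr_fun hm fun x hx => by
        simp only [hFU, torusDist_add_of_norm_le hL hRL (y i) hx.2]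
    have h5 : ∫⁻ x in cellPart (cell L y i) (y i) R, FE i (y i + x)
        = ∫⁻ x in cellPart (cell L y i) (y i) R, (‖fderiv ℝ ξ (y i + x)‖ₑ ^ 2
          + ENNReal.ofReal (W ‖x‖) * ‖Ψ (y i + x)‖ₑ ^ 2) :=
      setLIntegral_congr_fun hm fun x hx => by
        simp only [hFE, hFW, torusDist_add_of_norm_le hL hRL (y i) hx.2]
    rw [← h4, ← h5] at h3
    refine (mul_le_mul_right h1 _).trans (h3.trans ?_)
    gcongr
    exact hM2 i
  have hsumU : potentialForm L (fun x => U (torusDist L x (y (NN x)))) Ψ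
      = ∑ i, ∫⁻ x in torus L, (cell L y i).indicator (FU i) x := by
    rw [← lintegral_finsetSum _ fun i _ => (hFUm i).indicator (measurableSet_cell i), potentialForm]
    refine lintegral_congr fun x => ?_
    obtain ⟨i, hi⟩ := exists_mem_cell (L := L) (y := y) (NN x) x
    -- The cell index and the given nearest neighbor may differ at ties, but the two distances
    -- agree, and only the distance enters.
    rw [sum_indicator_cell FU hi, le_antisymm (hNN x i) (hi (NN x)).1]
  have hsumE : ∑ i, ∫⁻ x in torus L, (cell L y i).indicator (FE i) x
      ≤ kineticForm L χ ψ
        + potentialForm L (fun x => ∑ i, ENNReal.ofReal (W (torusDist L x (y i)))) Ψ := by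
    refine le_trans ?_ (add_le_add_left hkin _)
    rw [← lintegral_finsetSum _ fun i _ => (hFEm i).indicator (measurableSet_cell i), potentialForm,
      ← lintegral_add_left hξm]
    refine lintegral_mono fun x => ?_
    by_cases hx : ∃ i, x ∈ cell L y i
    · obtain ⟨i, hi⟩ := hx
      rw [sum_indicator_cell FE hi]
      simp only [hFE, hFW, Finset.sum_mul]
      gcongr
      -- In the cell of y i only the interaction with y i was used. The others are nonnegative.
      exact Finset.single_le_sum (f := fun i => ENNReal.ofReal (W (torusDist L x (y i))) * ‖Ψ x‖ₑ ^ 2)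
        (fun _ _ => zero_le) (Finset.mem_univ i)
    · exact absurd (exists_mem_cell (NN x) x) hx
  have hsumw : potentialForm L (fun x => ∑ i, weightW L χ R (x - y i)) Ψ
      = ∑ i, ∫⁻ z in torus L, weightW L χ R (z - y i) * ‖Ψ z‖ₑ ^ 2 := by
    rw [← lintegral_finsetSum, potentialForm]
    · simp only [Finset.sum_mul]
    · intro i _
      exact ((measurable_weightW hχ hχ_sum R).comp (measurable_sub_const (y i))).mul hΨm
  rw [hsumU, hsumw, Finset.mul_sum, Finset.mul_sum]
  refine (Finset.sum_le_sum fun i _ => hcellU i).trans ?_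
  rw [Finset.sum_add_distrib]
  gcongr

/-! ### Continuity of the potential energy -/

/-- The form is the squared L² norm for the measure V dx, which is at most B times Lebesgue measure.
Convergence in L² of the torus is then convergence for V dx, and the norm is continuous. -/
lemma tendsto_potentialForm {L : ℝ} {V : Plane → ℝ≥0∞} (hV : Measurable V) {B : ℝ≥0∞}
    (hB : B ≠ ⊤) (hVB : ∀ x, V x ≤ B) {ι : Type*} {l : Filter ι} {f : ι → Plane → ℂ} {ψ : Plane → ℂ}
    (hf : ∀ i, Continuous (f i)) (hψ : MemLp ψ 2 (volume.restrict (torus L)))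
    (hlim : Filter.Tendsto (fun i => ∫⁻ x in torus L, ‖ψ x - f i x‖ₑ ^ 2) l (nhds 0)) :
    Filter.Tendsto (fun i => potentialForm L V (f i)) l (nhds (potentialForm L V ψ)) := by
  set μ : Measure Plane := (volume.restrict (torus L)).withDensity V with hμ
  have hμle : μ ≤ B • volume.restrict (torus L) := by
    rw [hμ, ← withDensity_const]
    exact withDensity_mono (ae_of_all _ hVB)
  have hpot : ∀ g : Plane → ℂ, AEStronglyMeasurable g (volume.restrict (torus L)) →
      potentialForm L V g = eLpNorm g 2 μ ^ 2 := fun g hg => by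
    rw [eLpNorm_two_sq, hμ, lintegral_withDensity_eq_lintegral_mul₀ hV.aemeasurable
      (hg.enorm.pow_const 2)]
    rfl
  have hψμ : AEStronglyMeasurable ψ μ := hψ.1.mono_ac (withDensity_absolutelyContinuous _ _)
  have hψfin : eLpNorm ψ 2 μ ≠ ⊤ :=
    (hψ.of_measure_le_smul hB hμle).2.ne
  have hdiff : Filter.Tendsto (fun i => eLpNorm (ψ - f i) 2 μ) l (nhds 0) := by
    have h1 : Filter.Tendsto (fun i => eLpNorm (ψ - f i) 2 μ ^ 2) l (nhds 0) := by
      have h2 : Filter.Tendsto (fun i => B * ∫⁻ x in torus L, ‖ψ x - f i x‖ₑ ^ 2) l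
          (nhds 0) := by
        simpa using ENNReal.Tendsto.const_mul hlim (Or.inr hB)
      refine tendsto_of_tendsto_of_tendsto_of_le_of_le tendsto_const_nhds h2
        (fun _ => zero_le) fun i => ?_
      dsimp only
      rw [eLpNorm_two_sq, ← smul_eq_mul, ← lintegral_smul_measure]
      exact lintegral_mono' hμle le_rfl
    have h3 := (ENNReal.continuous_rpow_const (y := (1 / 2 : ℝ))).tendsto 0 |>.comp h1
    have h4 : (fun x : ℝ≥0∞ => x ^ (1 / 2 : ℝ)) ∘ (fun i => eLpNorm (ψ - f i) 2 μ ^ 2)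
        = fun i => eLpNorm (ψ - f i) 2 μ := by
      ext i
      rw [Function.comp_apply, ← ENNReal.rpow_natCast, ← ENNReal.rpow_mul]
      norm_num
    rw [h4, ENNReal.zero_rpow_of_pos (by norm_num)] at h3
    exact h3
  have hnorm : Filter.Tendsto (fun i => eLpNorm (f i) 2 μ) l (nhds (eLpNorm ψ 2 μ)) := by
    have hfμ : ∀ i, AEStronglyMeasurable (f i) μ := fun i => (hf i).aestronglyMeasurable
    have hlow : Filter.Tendsto (fun i => eLpNorm ψ 2 μ - eLpNorm (ψ - f i) 2 μ) l
        (nhds (eLpNorm ψ 2 μ)) := by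
      simpa using ENNReal.Tendsto.sub tendsto_const_nhds hdiff (Or.inl hψfin)
    have hup : Filter.Tendsto (fun i => eLpNorm ψ 2 μ + eLpNorm (ψ - f i) 2 μ) l
        (nhds (eLpNorm ψ 2 μ)) := by
      simpa using tendsto_const_nhds.add hdiff
    refine tendsto_of_tendsto_of_tendsto_of_le_of_le hlow hup (fun i => ?_) fun i => ?_
    · rw [tsub_le_iff_right]
      have := eLpNorm_add_le (hfμ i) (hψμ.sub (hfμ i)) (p := 2) (by norm_num)
      rwa [add_sub_cancel] at this
    · have := eLpNorm_sub_le hψμ (hψμ.sub (hfμ i)) (p := 2) (by norm_num)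
      rwa [sub_sub_cancel] at this
  have h5 := (ENNReal.continuous_pow 2).tendsto _ |>.comp hnorm
  rw [hpot ψ hψ.1]
  exact h5.congr fun i => (hpot _ (hf i).aestronglyMeasurable).symm

/-- The choice of a nearest neighbor need not be measurable, but the distance to it is a minimum of
1-Lipschitz functions. -/
lemma continuous_torusDist_nearest {L : ℝ} {n : ℕ} {y : Fin n → Plane} {NN : Plane → Fin n}
    (hNN : ∀ x i, torusDist L x (y (NN x)) ≤ torusDist L x (y i)) :
    Continuous fun x => torusDist L x (y (NN x)) := by
  refine LipschitzWith.continuous (K := 1) (LipschitzWith.of_le_add_mul 1 fun x x' => ?_)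
  rw [NNReal.coe_one, one_mul, dist_eq_norm]
  exact (hNN x (NN x')).trans (torusDist_le_add L x x' _)

lemma exists_weightW_le {L : ℝ} (hL : 0 < L) {χ : Plane → ℝ} (hχ : ∀ p, χ p ∈ Set.Icc 0 1)
    (hχ_sum : Summable fun k : Fin 2 → ℤ => 1 - χ (momentum L k)) (R : ℝ) :
    ∃ B : ℝ≥0∞, B ≠ ⊤ ∧ ∀ x, weightW L χ R x ≤ B := by
  have := restrict_torus_finite L
  obtain ⟨B, hB⟩ := oscF_le hL hχ hχ_sum R
  refine ⟨ENNReal.ofReal (2 / Real.pi) * B * ∫⁻ _ in torus L, B, ?_, fun x => ?_⟩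
  · rw [lintegral_const]
    exact ENNReal.mul_ne_top (ENNReal.mul_ne_top ENNReal.ofReal_ne_top ENNReal.coe_ne_top)
      (ENNReal.mul_ne_top ENNReal.coe_ne_top (measure_ne_top _ _))
  · unfold weightW
    gcongr
    · exact hB x
    · exact hB _

/-- The Dyson inequality for a bounded potential and a bounded soft potential. -/
lemma IsScatteringSolution.bounded_inequality {L R₀ R : ℝ} {W φ m : ℝ → ℝ}
    (h : IsScatteringSolution R₀ W φ m) (hR₀ : 0 < R₀) (hR₀R : R₀ < R) (hRL : R < L / 2)
    {χ : Plane → ℝ} (hχ : ∀ p, χ p ∈ Set.Icc 0 1) (hχ_radial : ∀ p q, ‖p‖ = ‖q‖ → χ p = χ q)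
    (hχ_sum : Summable fun k : Fin 2 → ℤ => 1 - χ (momentum L k))
    {U : ℝ → ℝ≥0∞} (hU : Measurable U) (hU_supp : ∀ t, t ∉ Set.Icc R₀ R → U t = 0)
    (hU_int : ∫⁻ t in Set.Ioi 0, U t * ENNReal.ofReal (φ t * t) ≤ 1)
    {B : ℝ≥0∞} (hB : B ≠ ⊤) (hUB : ∀ t, U t ≤ B)
    (hI : ∫⁻ t in Set.Ioi 0, U t * ENNReal.ofReal t ≠ ⊤)
    {n : ℕ} {y : Fin n → Plane} {NN : Plane → Fin n}
    (hNN : ∀ x i, torusDist L x (y (NN x)) ≤ torusDist L x (y i))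
    {ε : ℝ} (hε : 0 < ε) {ψ : Plane → ℂ} (hψ : MemLp ψ 2 (volume.restrict (torus L))) :
    ENNReal.ofReal (1 - ε) * potentialForm L (fun x => U (torusDist L x (y (NN x)))) ψ
      ≤ kineticForm L χ ψ
        + potentialForm L (fun x => ∑ i, ENNReal.ofReal (W (torusDist L x (y i)))) ψ
        + ENNReal.ofReal (1 / ε) * (∫⁻ t in Set.Ioi 0, U t * ENNReal.ofReal t)
          * potentialForm L (fun x => ∑ i, weightW L χ R (x - y i)) ψ := by
  have hL : 0 < L := by linarith
  have hlim := tendsto_partialSum hL hψ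
  have hc : ∀ s, Continuous (trigSum L s (fourierCoeffTorus L ψ)) := fun s =>
    continuous_trigSum L s _
  have hdm : ∀ i, Measurable fun x => torusDist L x (y i) := fun i =>
    (continuous_torusDist L (y i)).measurable
  have hWm := h.measurable
  obtain ⟨C, hC⟩ := h.bounded
  obtain ⟨D, hD, hwD⟩ := exists_weightW_le hL hχ hχ_sum R
  have h1 := tendsto_potentialForm (hU.comp (continuous_torusDist_nearest hNN).measurable) hB
    (fun x => hUB _) hc hψ hlim
  have h2 := tendsto_potentialForm (V := fun x => ∑ i, ENNReal.ofReal (W (torusDist L x (y i))))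
    (Finset.measurable_sum _ fun i _ => (hWm.comp (hdm i)).ennreal_ofReal)
    (B := ∑ _ : Fin n, ENNReal.ofReal C) (by simp [ENNReal.mul_eq_top])
    (fun x => Finset.sum_le_sum fun i _ => ENNReal.ofReal_le_ofReal (hC _)) hc hψ hlim
  have h3 := tendsto_potentialForm (V := fun x => ∑ i, weightW L χ R (x - y i))
    (Finset.measurable_sum _ fun i _ =>
      (measurable_weightW hχ hχ_sum R).comp (measurable_sub_const (y i)))
    (B := ∑ _ : Fin n, D) (by simp [ENNReal.mul_eq_top, hD])
    (fun x => Finset.sum_le_sum fun i _ => hwD _) hc hψ hlim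
  refine le_of_tendsto_of_tendsto'
    (ENNReal.Tendsto.const_mul h1 (Or.inr ENNReal.ofReal_ne_top))
    ((tendsto_const_nhds.add h2).add (ENNReal.Tendsto.const_mul h3
      (Or.inr (ENNReal.mul_ne_top ENNReal.ofReal_ne_top hI)))) fun s => ?_
  exact h.trigSum_inequality hR₀ hR₀R hRL hχ hχ_radial hχ_sum hU hU_supp hU_int hNN hε ψ s

/-! ### Removal of the boundedness assumptions -/

lemma potentialForm_mono {L : ℝ} {V V' : Plane → ℝ≥0∞} (h : ∀ x, V x ≤ V' x) (ψ : Plane → ℂ) :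
    potentialForm L V ψ ≤ potentialForm L V' ψ :=
  lintegral_mono fun x => mul_le_mul_left (h x) _

lemma potentialForm_const_mul {L : ℝ} {c : ℝ≥0∞} (hc : c ≠ ⊤) (V : Plane → ℝ≥0∞) (ψ : Plane → ℂ) :
    potentialForm L (fun x => c * V x) ψ = c * potentialForm L V ψ := by
  simp only [potentialForm, mul_assoc]
  rw [lintegral_const_mul' _ _ hc]

/-- The Dyson inequality, provided that `v` can be approximated from below by bounded potentials
with almost the same scattering length. -/
theorem dyson_of_approx {L R₀ R : ℝ} (hR₀ : 0 < R₀) (hR₀R : R₀ < R) (hRL : R < L / 2)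
    {v : ℝ → ℝ≥0∞} {a : ℝ} (ha0 : 0 < a) (ha : a ≤ R₀)
    (happrox : ∀ δ > 0, ∃ W φ m, IsScatteringSolution R₀ W φ m ∧
      (∀ r, ENNReal.ofReal (W r) ≤ v r / 2) ∧ ∀ t, R₀ ≤ t → φ t ≤ Real.log (t / a) + δ)
    {χ : Plane → ℝ} (hχ : ∀ p, χ p ∈ Set.Icc 0 1) (hχ_radial : ∀ p q, ‖p‖ = ‖q‖ → χ p = χ q)
    (hχ_sum : Summable fun k : Fin 2 → ℤ => 1 - χ (momentum L k))
    {U : ℝ → ℝ≥0} (hU : Measurable U) (hU_supp : ∀ t, t ∉ Set.Icc R₀ R → U t = 0)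
    (hU_int : ∫⁻ t in Set.Icc R₀ R, (U t : ℝ≥0∞) * ENNReal.ofReal (Real.log (t / a) * t) ≤ 1)
    {n : ℕ} {y : Fin n → Plane} {NN : Plane → Fin n}
    (hNN : ∀ x i, torusDist L x (y (NN x)) ≤ torusDist L x (y i))
    {ε : ℝ} (hε : 0 < ε) {ψ : Plane → ℂ} (hψ : MemLp ψ 2 (volume.restrict (torus L))) :
    ENNReal.ofReal (1 - ε)
        * potentialForm L (fun x => (U (torusDist L x (y (NN x))) : ℝ≥0∞)) ψ
      ≤ kineticForm L χ ψ + potentialForm L (fun x => 1 / 2 * ∑ i, v (torusDist L x (y i))) ψ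
        + ENNReal.ofReal (1 / ε) * (∫⁻ t in Set.Ioi 0, (U t : ℝ≥0∞) * ENNReal.ofReal t)
            * potentialForm L (fun x => ∑ i, weightW L χ R (x - y i)) ψ := by
  set rhs := kineticForm L χ ψ
    + potentialForm L (fun x => 1 / 2 * ∑ i, v (torusDist L x (y i))) ψ
    + ENNReal.ofReal (1 / ε) * (∫⁻ t in Set.Ioi 0, (U t : ℝ≥0∞) * ENNReal.ofReal t)
      * potentialForm L (fun x => ∑ i, weightW L χ R (x - y i)) ψ with hrhs
  have hdn : Measurable fun x => torusDist L x (y (NN x)) :=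
    (continuous_torusDist_nearest hNN).measurable
  -- Truncation makes U bounded and ∫ T t dt finite, as the continuity argument in
  -- `bounded_inequality` requires. The second integral also fixes how small δ has to be.
  set T : ℕ → ℝ → ℝ≥0∞ := fun k t => min (U t : ℝ≥0∞) k with hT
  have hTm : ∀ k, Measurable (T k) := fun k => hU.coe_nnreal_ennreal.min measurable_const
  have hTU : ∀ k t, T k t ≤ U t := fun k t => min_le_left _ _
  have hT_supp : ∀ k t, t ∉ Set.Icc R₀ R → T k t = 0 := fun k t ht => by
    simp [hT, hU_supp t ht]
  have hsupp : ∀ {F : ℝ → ℝ≥0∞}, (∀ t, t ∉ Set.Icc R₀ R → F t = 0) →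
      ∫⁻ t in Set.Ioi 0, F t = ∫⁻ t in Set.Icc R₀ R, F t := fun hF => by
    rw [← lintegral_indicator measurableSet_Ioi, ← lintegral_indicator measurableSet_Icc]
    refine lintegral_congr fun t => ?_
    by_cases ht : t ∈ Set.Icc R₀ R
    · rw [Set.indicator_of_mem ht, Set.indicator_of_mem (Set.mem_Ioi.2 (hR₀.trans_le ht.1))]
    · rw [Set.indicator_of_notMem ht]
      by_cases ht' : t ∈ Set.Ioi (0 : ℝ)
      · rw [Set.indicator_of_mem ht', hF t ht]
      · rw [Set.indicator_of_notMem ht']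
  have hTI : ∀ k, ∫⁻ t in Set.Ioi 0, T k t * ENNReal.ofReal t ≠ ⊤ := fun k => by
    rw [hsupp fun t ht => by rw [hT_supp k t ht, zero_mul]]
    refine ne_top_of_le_ne_top (b := ∫⁻ t in Set.Icc R₀ R, (k : ℝ≥0∞) * ENNReal.ofReal R) ?_
      (setLIntegral_mono' measurableSet_Icc fun t ht => ?_)
    · rw [setLIntegral_const, Real.volume_Icc]
      exact ENNReal.mul_ne_top (ENNReal.mul_ne_top (by simp) ENNReal.ofReal_ne_top)
        ENNReal.ofReal_ne_top
    · exact mul_le_mul' (min_le_right _ _) (ENNReal.ofReal_le_ofReal ht.2)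
  have hscaled : ∀ k, ∀ c ∈ Set.Ioo (0 : ℝ) 1, ENNReal.ofReal c * (ENNReal.ofReal (1 - ε)
      * potentialForm L (fun x => T k (torusDist L x (y (NN x)))) ψ) ≤ rhs := by
    intro k c hc
    set I := ∫⁻ t in Set.Ioi 0, T k t * ENNReal.ofReal t with hI
    -- Replacing log(t / a) by log(t / a) + δ raises the normalization integral from 1 to at most 1
    -- + δ I. This δ gives c(1 + δ I) ≤ 1, so c T is admissible. The summand 1 in the denominator
    -- covers I = 0.
    set δ := (1 / c - 1) / (I.toReal + 1) with hδ
    have hc1 : 0 < 1 / c - 1 := by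
      have := (one_lt_div hc.1).2 hc.2
      linarith
    have hI0 : 0 ≤ I.toReal := ENNReal.toReal_nonneg
    have hδ0 : 0 < δ := by positivity
    have hδI : c * (1 + δ * I.toReal) ≤ 1 := by
      have h1 : δ * I.toReal ≤ 1 / c - 1 := by
        rw [hδ, div_mul_eq_mul_div, div_le_iff₀ (by positivity)]
        nlinarith
      calc c * (1 + δ * I.toReal) ≤ c * (1 + (1 / c - 1)) := by
            have := hc.1
            gcongr
        _ = 1 := by
            have := hc.1.ne'
            field_simp
            ring
    obtain ⟨W, φ, m, hsol, hWv, hφ⟩ := happrox δ hδ0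
    have hint : ∫⁻ t in Set.Ioi 0, (ENNReal.ofReal c * T k t) * ENNReal.ofReal (φ t * t) ≤ 1 := by
      rw [hsupp fun t ht => by rw [hT_supp k t ht, mul_zero, zero_mul]]
      calc _ ≤ ∫⁻ t in Set.Icc R₀ R, ENNReal.ofReal c *
            ((U t : ℝ≥0∞) * ENNReal.ofReal (Real.log (t / a) * t)
              + ENNReal.ofReal δ * (T k t * ENNReal.ofReal t)) := by
            refine setLIntegral_mono' measurableSet_Icc fun t ht => ?_
            have ht0 : 0 < t := hR₀.trans_le ht.1
            -- Since a ≤ R₀, no negative part of the logarithm is cut off by `ENNReal.ofReal`.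
            have hlog : 0 ≤ Real.log (t / a) :=
              Real.log_nonneg ((one_le_div ha0).2 (ha.trans ht.1))
            have h1 : ENNReal.ofReal (φ t * t) ≤ ENNReal.ofReal (Real.log (t / a) * t)
                + ENNReal.ofReal δ * ENNReal.ofReal t := by
              rw [← ENNReal.ofReal_mul hδ0.le, ← ENNReal.ofReal_add (by positivity) (by positivity)]
              refine ENNReal.ofReal_le_ofReal ?_
              rw [← add_mul]
              exact mul_le_mul_of_nonneg_right (hφ t ht.1) ht0.le
            rw [mul_assoc]
            refine mul_le_mul_right ?_ _
            calc _ ≤ T k t * (ENNReal.ofReal (Real.log (t / a) * t)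
                  + ENNReal.ofReal δ * ENNReal.ofReal t) := by gcongr
              _ = T k t * ENNReal.ofReal (Real.log (t / a) * t)
                  + ENNReal.ofReal δ * (T k t * ENNReal.ofReal t) := by ring
              _ ≤ _ := by
                  gcongr
                  exact hTU k t
        _ = ENNReal.ofReal c * ((∫⁻ t in Set.Icc R₀ R,
              (U t : ℝ≥0∞) * ENNReal.ofReal (Real.log (t / a) * t)) + ENNReal.ofReal δ * I) := by
            have := hTm k
            rw [lintegral_const_mul' _ _ ENNReal.ofReal_ne_top, lintegral_add_right _ (by fun_prop),
              lintegral_const_mul' _ _ ENNReal.ofReal_ne_top, hI,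
              hsupp fun t ht => by rw [hT_supp k t ht, zero_mul]]
        _ ≤ ENNReal.ofReal c * (1 + ENNReal.ofReal δ * I) := by gcongr
        _ = ENNReal.ofReal (c * (1 + δ * I.toReal)) := by
            rw [ENNReal.ofReal_mul hc.1.le, ENNReal.ofReal_add zero_le_one (by positivity),
              ENNReal.ofReal_one, ENNReal.ofReal_mul hδ0.le, ENNReal.ofReal_toReal (hTI k)]
        _ ≤ 1 := by
            rw [← ENNReal.ofReal_one]
            exact ENNReal.ofReal_le_ofReal hδI
    have hIc : ∫⁻ t in Set.Ioi 0, (ENNReal.ofReal c * T k t) * ENNReal.ofReal t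
        = ENNReal.ofReal c * I := by
      simp only [mul_assoc]
      rw [lintegral_const_mul' _ _ ENNReal.ofReal_ne_top]
    have hmain := hsol.bounded_inequality hR₀ hR₀R hRL hχ hχ_radial hχ_sum
      (U := fun t => ENNReal.ofReal c * T k t) ((hTm k).const_mul _)
      (fun t ht => by rw [hT_supp k t ht, mul_zero]) hint
      (B := ENNReal.ofReal c * k) (ENNReal.mul_ne_top ENNReal.ofReal_ne_top (by simp))
      (fun t => mul_le_mul_right (min_le_right _ _) _)
      (by rw [hIc]; exact ENNReal.mul_ne_top ENNReal.ofReal_ne_top (hTI k)) hNN hε hψ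
    rw [potentialForm_const_mul ENNReal.ofReal_ne_top, hIc, mul_left_comm] at hmain
    refine hmain.trans ?_
    rw [hrhs]
    gcongr
    · refine potentialForm_mono (fun x => ?_) ψ
      rw [Finset.mul_sum]
      refine Finset.sum_le_sum fun i _ => (hWv _).trans (le_of_eq ?_)
      rw [ENNReal.div_eq_inv_mul, one_div]
    · calc ENNReal.ofReal c * I ≤ 1 * I := by
            gcongr
            rw [← ENNReal.ofReal_one]
            exact ENNReal.ofReal_le_ofReal hc.2.le
        _ ≤ _ := by
            rw [one_mul]
            exact lintegral_mono fun t => mul_le_mul_left (hTU k t) _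
  have htrunc : ∀ k, ENNReal.ofReal (1 - ε)
      * potentialForm L (fun x => T k (torusDist L x (y (NN x)))) ψ ≤ rhs := by
    intro k
    set X := ENNReal.ofReal (1 - ε)
      * potentialForm L (fun x => T k (torusDist L x (y (NN x)))) ψ
    have h1 : Filter.Tendsto (fun c : ℝ => ENNReal.ofReal c * X) (nhdsWithin 1 (Set.Iio 1))
        (nhds (ENNReal.ofReal 1 * X)) :=
      ENNReal.Tendsto.mul_const ((ENNReal.continuous_ofReal.tendsto 1).mono_left
        nhdsWithin_le_nhds) (Or.inl (by simp))
    rw [ENNReal.ofReal_one, one_mul] at h1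
    refine le_of_tendsto h1 ?_
    filter_upwards [Ioo_mem_nhdsLT (zero_lt_one' ℝ)] with c hc
    exact hscaled k c hc
  have hsup : potentialForm L (fun x => (U (torusDist L x (y (NN x))) : ℝ≥0∞)) ψ
      = ⨆ k, potentialForm L (fun x => T k (torusDist L x (y (NN x)))) ψ := by
    unfold potentialForm
    rw [← lintegral_iSup']
    · refine lintegral_congr fun x => ?_
      rw [← ENNReal.iSup_mul]
      congr 1
      refine le_antisymm ?_ (iSup_le fun k => hTU k _)
      obtain ⟨k, hk⟩ := ENNReal.exists_nat_gt (ENNReal.coe_ne_top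
        (r := U (torusDist L x (y (NN x)))))
      exact le_iSup_of_le k (le_min le_rfl hk.le)
    · exact fun k => ((hTm k).comp hdn).aemeasurable.mul (hψ.1.enorm.pow_const 2)
    · refine ae_of_all _ fun x i j hij => ?_
      exact mul_le_mul_left (min_le_min le_rfl (by exact_mod_cast hij)) _
  rw [hsup, ENNReal.mul_iSup]
  exact iSup_le htrunc

/-! ### Radial functions on the disk -/

lemma lintegral_ball_radial {f : ℝ → ℝ≥0∞} (hf : Measurable f) (R : ℝ) :
    ∫⁻ x in Metric.ball (0 : Plane) R, f ‖x‖
      = ENNReal.ofReal (2 * Real.pi) * ∫⁻ r in Set.Ioo 0 R, f r * ENNReal.ofReal r := by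
  have hm : Measurable fun x : Plane => f ‖x‖ := hf.comp measurable_norm
  rw [← lintegral_indicator Metric.isOpen_ball.measurableSet,
    lintegral_polar (hm.indicator Metric.isOpen_ball.measurableSet)]
  have h : ∀ θ, ∫⁻ r in Set.Ioi (0 : ℝ), ENNReal.ofReal r *
      (Metric.ball (0 : Plane) R).indicator (fun x => f ‖x‖) (r • polarVec θ)
      = ∫⁻ r in Set.Ioo 0 R, f r * ENNReal.ofReal r := by
    intro θ
    rw [← lintegral_indicator measurableSet_Ioi, ← lintegral_indicator measurableSet_Ioo]
    refine lintegral_congr fun r => ?_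
    by_cases hr : r ∈ Set.Ioi (0 : ℝ)
    swap
    · rw [Set.indicator_of_notMem hr, Set.indicator_of_notMem fun h => hr h.1]
    have hn := norm_smul_polarVec (le_of_lt hr) θ
    rw [Set.indicator_of_mem hr]
    by_cases hrR : r < R
    · rw [Set.indicator_of_mem (show r • polarVec θ ∈ Metric.ball (0 : Plane) R by
        rwa [mem_ball_zero_iff, hn]), Set.indicator_of_mem (show r ∈ Set.Ioo 0 R from ⟨hr, hrR⟩), hn,
        mul_comm]
    · rw [Set.indicator_of_notMem (fun h => hrR (by rwa [mem_ball_zero_iff, hn] at h)),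
        Set.indicator_of_notMem (fun h => hrR h.2), mul_zero]
  simp only [h]
  rw [setLIntegral_const, Real.volume_Ioo, mul_comm]
  congr 2
  ring

lemma lintegral_ball_radial_eq_ofReal {f : ℝ → ℝ} (hf : Measurable f) (hf0 : ∀ r, 0 ≤ f r) {R : ℝ}
    (hR : 0 ≤ R) (hfi : IntervalIntegrable (fun r => f r * r) volume 0 R) :
    ∫⁻ x in Metric.ball (0 : Plane) R, ENNReal.ofReal (f ‖x‖)
      = ENNReal.ofReal (2 * Real.pi * ∫ r in (0 : ℝ)..R, f r * r) := by
  rw [lintegral_ball_radial hf.ennreal_ofReal, ENNReal.ofReal_mul (p := 2 * Real.pi) (by positivity),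
    intervalIntegral.integral_of_le hR, integral_Ioc_eq_integral_Ioo,
    ofReal_integral_eq_lintegral_ofReal]
  · congr 1
    refine setLIntegral_congr_fun measurableSet_Ioo fun r _ => ?_
    rw [ENNReal.ofReal_mul (hf0 r)]
  · exact ((intervalIntegrable_iff_integrableOn_Ioc_of_le hR).1 hfi).mono_set
      Set.Ioo_subset_Ioc_self
  · exact (ae_restrict_iff' measurableSet_Ioo).2 (ae_of_all _ fun r hr =>
      mul_nonneg (hf0 r) hr.1.le)

lemma hasFDerivAt_norm_plane {x : Plane} (hx : x ≠ 0) :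
    HasFDerivAt (fun x : Plane => ‖x‖) (innerSL ℝ (‖x‖⁻¹ • x)) x := by
  have h1 := (hasStrictFDerivAt_norm_sq x).hasFDerivAt.sqrt
    (pow_ne_zero 2 (norm_ne_zero_iff.2 hx))
  have h2 : (fun y : Plane => √(‖y‖ ^ 2)) = fun y => ‖y‖ :=
    funext fun y => Real.sqrt_sq (norm_nonneg y)
  rw [h2, Real.sqrt_sq (norm_nonneg x)] at h1
  refine h1.congr_fderiv ?_
  ext v
  have := norm_ne_zero_iff.2 hx
  simp only [smul_apply, innerSL_apply_apply, smul_eq_mul, nsmul_eq_mul, inner_smul_left,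
    conj_trivial]
  field_simp
  norm_num

/-- The gradient of the radial function `φ(|x|)`. -/
noncomputable def radialGrad (m : ℝ → ℝ) (x : Plane) : Plane :=
  (m ‖x‖ / ‖x‖) • (‖x‖⁻¹ • x)

lemma norm_radialGrad (m : ℝ → ℝ) (x : Plane) :
    ‖radialGrad m x‖ = |m ‖x‖ / ‖x‖| := by
  rw [radialGrad, norm_smul, Real.norm_eq_abs]
  rcases eq_or_ne x 0 with rfl | hx
  · simp
  · rw [norm_smul, norm_inv, norm_norm, inv_mul_cancel₀ (norm_ne_zero_iff.2 hx), mul_one]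

namespace IsScatteringSolution

variable {R₀ : ℝ} {W φ m : ℝ → ℝ}

lemma norm_radialGrad_sub (h : IsScatteringSolution R₀ W φ m) {W' φ' m' : ℝ → ℝ}
    (h' : IsScatteringSolution R₀ W' φ' m') (x : Plane) :
    ‖radialGrad m x - radialGrad m' x‖ = |m ‖x‖ / ‖x‖ - m' ‖x‖ / ‖x‖| := by
  rw [radialGrad, radialGrad, ← sub_smul, norm_smul, Real.norm_eq_abs]
  rcases eq_or_ne x 0 with rfl | hx
  · simp [h.flux_zero, h'.flux_zero]
  · rw [norm_smul, norm_inv, norm_norm, inv_mul_cancel₀ (norm_ne_zero_iff.2 hx), mul_one]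

lemma measurable_radialGrad (h : IsScatteringSolution R₀ W φ m) : Measurable (radialGrad m) :=
  (h.continuous_deriv.measurable.comp measurable_norm).smul
    (measurable_norm.inv.smul measurable_id)

lemma exists_deriv_bound (h : IsScatteringSolution R₀ W φ m) (R : ℝ) :
    ∃ C, 0 ≤ C ∧ ∀ r ∈ Set.Icc 0 R, ‖m r / r‖ ≤ C := by
  obtain ⟨C, hC⟩ := isCompact_Icc.exists_bound_of_continuousOn (s := Set.Icc 0 R)
    h.continuous_deriv.continuousOn
  exact ⟨max C 0, le_max_right _ _, fun r hr => (hC r hr).trans (le_max_left _ _)⟩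

/-- The scattering solution minus its boundary value, extended by zero, has a weak gradient. -/
lemma weak_grad (h : IsScatteringSolution R₀ W φ m) {R : ℝ} (hR : 0 < R) {η : Plane → ℝ}
    (hη : ContDiff ℝ ∞ η) (hηc : HasCompactSupport η) (i : Fin 2) :
    ∫ x in Metric.ball (0 : Plane) R, (φ ‖x‖ - φ R) * fderiv ℝ η x (EuclideanSpace.single i 1)
      = -∫ x in Metric.ball (0 : Plane) R, radialGrad m x i * η x := by
  obtain ⟨C, hC0, hC⟩ := h.exists_deriv_bound R
  set e : Plane := EuclideanSpace.single i 1 with he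
  -- This extension by zero is Lipschitz on the plane. Integration by parts over the whole plane
  -- against a compactly supported η leaves no boundary term, even if η does not vanish on the
  -- circle of radius R. That is how the boundary condition in `IsTrialFunction` is obtained.
  set f : Plane → ℝ := fun x => φ (min ‖x‖ R) - φ R with hf
  have hmem : ∀ x : Plane, min ‖x‖ R ∈ Set.Icc 0 R := fun x =>
    ⟨le_min (norm_nonneg x) hR.le, min_le_right _ _⟩
  have hfLip : LipschitzWith C.toNNReal f := by
    refine LipschitzWith.of_dist_le_mul fun x x' => ?_
    have h1 := (convex_Icc (0 : ℝ) R).norm_image_sub_le_of_norm_hasDerivWithin_le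
      (fun r _ => (h.hasDerivAt r).hasDerivWithinAt) hC (hmem x') (hmem x)
    have h2 : |min ‖x‖ R - min ‖x'‖ R| ≤ ‖x - x'‖ := by
      refine (abs_min_sub_min_le_max _ _ _ _).trans ?_
      simpa using abs_norm_sub_norm_le x x'
    rw [Real.dist_eq, dist_eq_norm, Real.coe_toNNReal C hC0]
    have h3 : f x - f x' = φ (min ‖x‖ R) - φ (min ‖x'‖ R) := by simp only [hf]; ring
    rw [h3]
    exact h1.trans (mul_le_mul_of_nonneg_left h2 hC0)
  obtain ⟨D, hηLip⟩ := ContDiff.lipschitzWith_of_hasCompactSupport hηc hη (by simp)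
  have key := hfLip.integral_lineDeriv_mul_eq (μ := volume) hηLip hηc e
  have hball : MeasurableSet (Metric.ball (0 : Plane) R) := Metric.isOpen_ball.measurableSet
  have hleft : ∫ x, lineDeriv ℝ f x e * η x
      = ∫ x in Metric.ball (0 : Plane) R, radialGrad m x i * η x := by
    rw [← integral_indicator hball]
    refine integral_congr_ae ?_
    have hsphere : ∀ᵐ x : Plane, x ∉ Metric.sphere (0 : Plane) R :=
      measure_eq_zero_iff_ae_notMem.1 (Measure.addHaar_sphere_of_ne_zero volume 0 hR.ne')
    have hzero : ∀ᵐ x : Plane, x ≠ 0 := by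
      simpa using measure_eq_zero_iff_ae_notMem.1 (measure_singleton (0 : Plane))
    filter_upwards [hsphere, hzero] with x hx hx0
    rw [mem_sphere_zero_iff_norm] at hx
    rcases lt_or_gt_of_ne hx with hlt | hgt
    · rw [Set.indicator_of_mem (by simpa using hlt)]
      have h1 : HasFDerivAt (fun x : Plane => φ ‖x‖ - φ R)
          ((m ‖x‖ / ‖x‖) • innerSL ℝ (‖x‖⁻¹ • x)) x :=
        ((h.hasDerivAt ‖x‖).comp_hasFDerivAt x (hasFDerivAt_norm_plane hx0)).sub_const _
      have h2 : HasFDerivAt f ((m ‖x‖ / ‖x‖) • innerSL ℝ (‖x‖⁻¹ • x)) x := by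
        refine h1.congr_of_eventuallyEq ?_
        filter_upwards [continuous_norm.continuousAt.eventually_lt continuousAt_const hlt] with z hz
        simp only [hf, min_eq_left (le_of_lt hz)]
      rw [(h2.hasLineDerivAt e).lineDeriv]
      congr 1
      simp [radialGrad, he, EuclideanSpace.inner_single_right]
    · rw [Set.indicator_of_notMem (by simpa using hgt.le)]
      have h2 : HasFDerivAt f (0 : Plane →L[ℝ] ℝ) x := by
        refine (hasFDerivAt_const (0 : ℝ) x).congr_of_eventuallyEq ?_
        filter_upwards [continuousAt_const.eventually_lt continuous_norm.continuousAt hgt] with z hz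
        simp only [hf, min_eq_right (le_of_lt hz), sub_self]
      rw [(h2.hasLineDerivAt e).lineDeriv]
      simp
  have hright : ∫ x, lineDeriv ℝ η x (-e) * f x
      = -∫ x in Metric.ball (0 : Plane) R, (φ ‖x‖ - φ R) * fderiv ℝ η x e := by
    rw [← integral_neg, ← integral_indicator hball]
    refine integral_congr_ae (ae_of_all _ fun x => ?_)
    dsimp only
    rw [((hη.differentiable (by simp)) x).lineDeriv_eq_fderiv, map_neg]
    by_cases hx : ‖x‖ < R
    · rw [Set.indicator_of_mem (by simpa using hx)]
      simp only [hf, min_eq_left hx.le]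
      ring
    · rw [Set.indicator_of_notMem (by simpa using hx)]
      simp only [hf, min_eq_right (not_lt.1 hx), sub_self, mul_zero]
  rw [hleft, hright] at key
  linarith

end IsScatteringSolution

/-! ### Comparison of scattering solutions -/

namespace IsScatteringSolution

variable {R₀ : ℝ} {W φ m W' φ' m' : ℝ → ℝ}

/-- The W-energy of φ' - φ expands to that of φ', minus 2φ'(t), plus φ(t), because testing the
equation of φ against φ' yields φ'(t). The W-energy of φ' is at most its W'-energy, which is φ'(t).
Here φ' is the second solution, not a derivative. -/
lemma integral_sq_sub_le (h : IsScatteringSolution R₀ W φ m)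
    (h' : IsScatteringSolution R₀ W' φ' m') (hW : ∀ r, W r ≤ W' r) {t : ℝ} (ht0 : 0 ≤ t)
    (ht : R₀ ≤ t) :
    ∫ r in (0 : ℝ)..t, (m r / r - m' r / r) ^ 2 * r ≤ φ t - φ' t := by
  have h1 := h.integral_energy_sub h'.continuous_deriv h'.continuous 1 t
  have h2 := h.integral_flux_mul_deriv (t := t) h'.hasDerivAt h'.continuous_deriv
  have h3 := h'.integral_energy t
  rw [h.flux_one t ht] at h1 h2
  rw [h'.flux_one t ht] at h3
  have h4 : ∫ r in (0 : ℝ)..t, ((m' r / r) ^ 2 + W r * φ' r ^ 2) * r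
      ≤ ∫ r in (0 : ℝ)..t, ((m' r / r) ^ 2 + W' r * φ' r ^ 2) * r := by
    refine intervalIntegral.integral_mono_on ht0
      (h.intervalIntegrable_energy h'.continuous_deriv h'.continuous 0 t)
      (h'.intervalIntegrable_energy h'.continuous_deriv h'.continuous 0 t) fun r hr => ?_
    have := mul_le_mul_of_nonneg_right (hW r) (sq_nonneg (φ' r))
    exact mul_le_mul_of_nonneg_right (by linarith) hr.1
  have h5 : ∫ r in (0 : ℝ)..t, (m r / r - m' r / r) ^ 2 * r
      ≤ ∫ r in (0 : ℝ)..t,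
        ((m' r / r - 1 * (m r / r)) ^ 2 + W r * (φ' r - 1 * φ r) ^ 2) * r := by
    refine intervalIntegral.integral_mono_on ht0 ?_
      (h.intervalIntegrable_energy (f' := fun r => m' r / r - 1 * (m r / r))
        (g := fun r => φ' r - 1 * φ r)
        (h'.continuous_deriv.sub (continuous_const.mul h.continuous_deriv))
        (h'.continuous.sub (continuous_const.mul h.continuous)) 0 t) fun r hr => ?_
    · exact (((h.continuous_deriv.sub h'.continuous_deriv).pow 2).mul
        continuous_id).intervalIntegrable _ _
    · have h6 : 0 ≤ W r * (φ' r - 1 * φ r) ^ 2 := mul_nonneg (h.nonneg r) (sq_nonneg _)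
      refine mul_le_mul_of_nonneg_right ?_ hr.1
      linarith [h6, show (m r / r - m' r / r) ^ 2 = (m' r / r - 1 * (m r / r)) ^ 2 by ring]
  linarith

lemma le_of_potential_le (h : IsScatteringSolution R₀ W φ m)
    (h' : IsScatteringSolution R₀ W' φ' m') (hW : ∀ r, W r ≤ W' r) {t : ℝ} (ht0 : 0 ≤ t)
    (ht : R₀ ≤ t) : φ' t ≤ φ t := by
  have h1 := h.integral_sq_sub_le h' hW ht0 ht
  have h2 : 0 ≤ ∫ r in (0 : ℝ)..t, (m r / r - m' r / r) ^ 2 * r :=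
    intervalIntegral.integral_nonneg ht0 fun r hr => mul_nonneg (sq_nonneg _) hr.1
  linarith

/-- The difference at r equals the difference at t minus the integral of the difference x of the
derivatives over [r, t]. Under the integral, |x| ≤ (κ / 2) x² r + 1 / (2κr), and the square is
controlled by `integral_sq_sub_le`. The parameter κ is left free to make the last term small. -/
lemma abs_sub_le (h : IsScatteringSolution R₀ W φ m)
    (h' : IsScatteringSolution R₀ W' φ' m') (hW : ∀ r, W r ≤ W' r) {t : ℝ}
    (ht : R₀ ≤ t) {r : ℝ} (hr0 : 0 < r) (hrt : r ≤ t) {κ : ℝ} (hκ : 0 < κ) :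
    |φ r - φ' r| ≤ (1 + κ / 2) * (φ t - φ' t) + t / (2 * κ * r) := by
  have ht0 : 0 ≤ t := hr0.le.trans hrt
  have hc : Continuous fun s => m s / s - m' s / s := h.continuous_deriv.sub h'.continuous_deriv
  have h1 := h.integral_sq_sub_le h' hW ht0 ht
  have h0 := h.le_of_potential_le h' hW ht0 ht
  have hcs : Continuous fun s => (m s / s - m' s / s) ^ 2 * s := (hc.pow 2).mul continuous_id
  have h2 : ∫ s in r..t, (m s / s - m' s / s) = (φ t - φ' t) - (φ r - φ' r) :=
    intervalIntegral.integral_eq_sub_of_hasDerivAt (f := fun s => φ s - φ' s)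
      (fun s _ => (h.hasDerivAt s).sub (h'.hasDerivAt s)) (hc.intervalIntegrable _ _)
  have h3 : |∫ s in r..t, (m s / s - m' s / s)|
      ≤ ∫ s in r..t, (κ / 2 * ((m s / s - m' s / s) ^ 2 * s) + 1 / (2 * κ * r)) := by
    refine (intervalIntegral.abs_integral_le_integral_abs hrt).trans
      (intervalIntegral.integral_mono_on hrt (hc.abs.intervalIntegrable _ _)
        (((continuous_const.mul hcs).add continuous_const).intervalIntegrable _ _) fun s hs => ?_)
    set x := m s / s - m' s / s
    have h4 : κ / 2 * (x ^ 2 * r) + 1 / (2 * κ * r) - |x| = (κ * r * |x| - 1) ^ 2 / (2 * κ * r) := by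
      rw [← sq_abs x]
      field_simp
      ring
    have h5 : 0 ≤ (κ * r * |x| - 1) ^ 2 / (2 * κ * r) := by positivity
    have h6 : κ / 2 * (x ^ 2 * r) ≤ κ / 2 * (x ^ 2 * s) := by
      have := hs.1
      gcongr
    linarith
  have h4 : ∫ s in r..t, (κ / 2 * ((m s / s - m' s / s) ^ 2 * s) + 1 / (2 * κ * r))
      = κ / 2 * (∫ s in r..t, (m s / s - m' s / s) ^ 2 * s) + (t - r) * (1 / (2 * κ * r)) := by
    rw [intervalIntegral.integral_add ((hcs.const_mul _).intervalIntegrable _ _)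
      (continuous_const.intervalIntegrable _ _), intervalIntegral.integral_const_mul,
      intervalIntegral.integral_const, smul_eq_mul]
  have h5 : ∫ s in r..t, (m s / s - m' s / s) ^ 2 * s
      ≤ ∫ s in (0 : ℝ)..t, (m s / s - m' s / s) ^ 2 * s := by
    rw [← intervalIntegral.integral_add_adjacent_intervals (hcs.intervalIntegrable 0 r)
      (hcs.intervalIntegrable r t)]
    have : 0 ≤ ∫ s in (0 : ℝ)..r, (m s / s - m' s / s) ^ 2 * s :=
      intervalIntegral.integral_nonneg hr0.le fun s hs => mul_nonneg (sq_nonneg _) hs.1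
    linarith
  have h6 : (t - r) * (1 / (2 * κ * r)) ≤ t / (2 * κ * r) := by
    rw [mul_one_div]
    gcongr
    linarith
  have h7 : κ / 2 * (∫ s in r..t, (m s / s - m' s / s) ^ 2 * s) ≤ κ / 2 * (φ t - φ' t) :=
    mul_le_mul_of_nonneg_left (h5.trans h1) (by positivity)
  rw [h2, h4] at h3
  rw [abs_le] at h3 ⊢
  constructor <;> linarith [h3.1, h3.2]

/-- Pointwise bound up to the boundary of the disk. -/
lemma le_boundary (h : IsScatteringSolution R₀ W φ m) {r t : ℝ} (hr : 0 ≤ r) (hrt : r ≤ t) :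
    φ r ≤ φ t := h.monotoneOn hr (hr.trans hrt) hrt

/-- Makes the gradients a Cauchy sequence in L² as soon as the boundary values converge. -/
lemma eLpNorm_radialGrad_sub_sq_le (h : IsScatteringSolution R₀ W φ m)
    (h' : IsScatteringSolution R₀ W' φ' m') (hW : ∀ r, W r ≤ W' r) {t : ℝ} (ht0 : 0 ≤ t)
    (ht : R₀ ≤ t) :
    eLpNorm (fun x => radialGrad m x - radialGrad m' x) 2 (volume.restrict (Metric.ball 0 t)) ^ 2
      ≤ ENNReal.ofReal (2 * Real.pi * (φ t - φ' t)) := by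
  have hc : Continuous fun s => m s / s - m' s / s := h.continuous_deriv.sub h'.continuous_deriv
  have h1 : ∀ x : Plane, ‖radialGrad m x - radialGrad m' x‖ₑ ^ 2
      = ENNReal.ofReal ((m ‖x‖ / ‖x‖ - m' ‖x‖ / ‖x‖) ^ 2) := fun x => by
    rw [← ofReal_norm, ← ENNReal.ofReal_pow (norm_nonneg _), h.norm_radialGrad_sub h', sq_abs]
  rw [eLpNorm_two_sq]
  simp only [h1]
  rw [lintegral_ball_radial_eq_ofReal (f := fun r => (m r / r - m' r / r) ^ 2)
    (hc.pow 2).measurable (fun r => sq_nonneg _) ht0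
    (((hc.pow 2).mul continuous_id).intervalIntegrable _ _)]
  exact ENNReal.ofReal_le_ofReal (mul_le_mul_of_nonneg_left (h.integral_sq_sub_le h' hW ht0 ht)
    (by positivity))

lemma memLp_radialGrad (h : IsScatteringSolution R₀ W φ m) (t : ℝ) :
    MemLp (radialGrad m) 2 (volume.restrict (Metric.ball 0 t)) := by
  obtain ⟨C, -, hC⟩ := h.exists_deriv_bound t
  have : IsFiniteMeasure (volume.restrict (Metric.ball (0 : Plane) t)) :=
    isFiniteMeasure_restrict.2 measure_ball_lt_top.ne
  refine MemLp.of_bound h.measurable_radialGrad.aestronglyMeasurable C ?_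
  refine (ae_restrict_iff' Metric.isOpen_ball.measurableSet).2 (ae_of_all _ fun x hx => ?_)
  rw [norm_radialGrad]
  exact hC _ ⟨norm_nonneg x, (mem_ball_zero_iff.1 hx).le⟩

/-- The planar form of `integral_energy`, with the flux equal to 1 at t. Gradient and potential
parts are kept apart because they pass to the limit by different arguments. -/
lemma energy_eq (h : IsScatteringSolution R₀ W φ m) {t : ℝ} (ht0 : 0 ≤ t) (ht : R₀ ≤ t) :
    eLpNorm (radialGrad m) 2 (volume.restrict (Metric.ball 0 t)) ^ 2
      + ∫⁻ x in Metric.ball (0 : Plane) t, ENNReal.ofReal (W ‖x‖) * ENNReal.ofReal (φ ‖x‖) ^ 2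
      = ENNReal.ofReal (2 * Real.pi * φ t) := by
  have h1 : ∀ x : Plane, ‖radialGrad m x‖ₑ ^ 2
      + ENNReal.ofReal (W ‖x‖) * ENNReal.ofReal (φ ‖x‖) ^ 2
      = ENNReal.ofReal ((m ‖x‖ / ‖x‖) ^ 2 + W ‖x‖ * φ ‖x‖ ^ 2) := fun x => by
    rw [← ofReal_norm, ← ENNReal.ofReal_pow (norm_nonneg _), norm_radialGrad, sq_abs,
      ← ENNReal.ofReal_pow (h.pos _).le, ← ENNReal.ofReal_mul (h.nonneg _),
      ← ENNReal.ofReal_add (sq_nonneg _) (mul_nonneg (h.nonneg _) (sq_nonneg _))]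
  rw [eLpNorm_two_sq, ← lintegral_add_left (h.measurable_radialGrad.enorm.pow_const 2)]
  simp only [h1]
  have := h.integral_energy t
  rw [lintegral_ball_radial_eq_ofReal (f := fun r => (m r / r) ^ 2 + W r * φ r ^ 2)
    ((h.continuous_deriv.measurable.pow_const 2).add
      (h.measurable.mul (h.continuous.measurable.pow_const 2)))
    (fun r => add_nonneg (sq_nonneg _) (mul_nonneg (h.nonneg _) (sq_nonneg _))) ht0
    (h.intervalIntegrable_energy h.continuous_deriv h.continuous 0 t), this, h.flux_one t ht,
    one_mul]

end IsScatteringSolution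

/-! ### Limits of weak gradients -/

/-- Weak differentiability passes to limits: pointwise bounded limits of the functions and `L²`
limits of the gradients. -/
lemma exists_weak_grad_limit {R : ℝ} {g : ℕ → Plane → ℝ} {G : ℕ → Plane → Plane} {c : ℕ → ℝ}
    {g' : Plane → ℝ} {c' B : ℝ} (hgm : ∀ N, Measurable (g N))
    (hgB : ∀ N, ∀ x ∈ Metric.ball (0 : Plane) R, |g N x| ≤ B)
    (hg : ∀ x ∈ Metric.ball (0 : Plane) R, x ≠ 0 →
      Filter.Tendsto (fun N => g N x) Filter.atTop (nhds (g' x)))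
    (hc : Filter.Tendsto c Filter.atTop (nhds c'))
    (hGm : ∀ N, MemLp (G N) 2 (volume.restrict (Metric.ball 0 R)))
    (hG : ∀ δ : ℝ≥0∞, 0 < δ → ∃ N₀, ∀ N ≥ N₀, ∀ M ≥ N,
      eLpNorm (fun x => G N x - G M x) 2 (volume.restrict (Metric.ball 0 R)) < δ)
    (hweak : ∀ N, ∀ η : Plane → ℝ, ContDiff ℝ ∞ η → HasCompactSupport η → ∀ i : Fin 2,
      ∫ x in Metric.ball (0 : Plane) R, (g N x - c N) * fderiv ℝ η x (EuclideanSpace.single i 1)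
        = -∫ x in Metric.ball (0 : Plane) R, G N x i * η x) :
    ∃ G' : Plane → Plane, MemLp G' 2 (volume.restrict (Metric.ball 0 R)) ∧
      Filter.Tendsto (fun N => eLpNorm (G N) 2 (volume.restrict (Metric.ball 0 R))) Filter.atTop
        (nhds (eLpNorm G' 2 (volume.restrict (Metric.ball 0 R)))) ∧
      ∀ η : Plane → ℝ, ContDiff ℝ ∞ η → HasCompactSupport η → ∀ i : Fin 2,
      ∫ x in Metric.ball (0 : Plane) R, (g' x - c') * fderiv ℝ η x (EuclideanSpace.single i 1)
        = -∫ x in Metric.ball (0 : Plane) R, G' x i * η x := by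
  set μ : Measure Plane := volume.restrict (Metric.ball (0 : Plane) R) with hμ
  have : IsFiniteMeasure μ := isFiniteMeasure_restrict.2 measure_ball_lt_top.ne
  have hball : MeasurableSet (Metric.ball (0 : Plane) R) := Metric.isOpen_ball.measurableSet
  have hcauchy : CauchySeq fun N => (hGm N).toLp (G N) := by
    refine EMetric.cauchySeq_iff'.2 fun δ hδ => ?_
    obtain ⟨N₀, hN₀⟩ := hG δ hδ
    refine ⟨N₀, fun N hN => ?_⟩
    rw [edist_comm, Lp.edist_toLp_toLp]
    exact hN₀ N₀ le_rfl N hN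
  obtain ⟨Γ, hΓ⟩ := cauchySeq_tendsto_of_complete hcauchy
  have hsub : Filter.Tendsto (fun N => eLpNorm (fun x => G N x - Γ x) 2 μ) Filter.atTop
      (nhds 0) := by
    have h1 := (tendsto_iff_edist_tendsto_0).1 hΓ
    refine h1.congr fun N => ?_
    rw [Lp.edist_def]
    refine eLpNorm_congr_ae ?_
    filter_upwards [(hGm N).coeFn_toLp] with x hx
    simp [hx]
  refine ⟨Γ, Lp.memLp Γ, ?_, fun η hη hηc i => ?_⟩
  · have h1 : Filter.Tendsto (fun N => ‖(hGm N).toLp (G N)‖ₑ) Filter.atTop (nhds ‖Γ‖ₑ) :=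
      (continuous_enorm.tendsto Γ).comp hΓ
    simp only [Lp.enorm_toLp] at h1
    rwa [Lp.enorm_def] at h1
  · have hηcont : Continuous η := hη.continuous
    obtain ⟨D, hD⟩ := hηc.exists_bound_of_continuous hηcont
    have hd : Continuous fun x => fderiv ℝ η x (EuclideanSpace.single i 1) :=
      (hη.continuous_fderiv (by simp)).clm_apply continuous_const
    have hdc : HasCompactSupport fun x => fderiv ℝ η x (EuclideanSpace.single i 1) :=
      hηc.fderiv_apply ℝ _
    obtain ⟨D', hD'⟩ := hdc.exists_bound_of_continuous hd
    obtain ⟨K, hK⟩ : ∃ K, ∀ N, |c N| ≤ K := by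
      obtain ⟨K, hK⟩ := hc.abs.bddAbove_range
      exact ⟨K, fun N => hK ⟨N, rfl⟩⟩
    have hleft : Filter.Tendsto (fun N => ∫ x in Metric.ball (0 : Plane) R,
        (g N x - c N) * fderiv ℝ η x (EuclideanSpace.single i 1)) Filter.atTop
        (nhds (∫ x in Metric.ball (0 : Plane) R,
          (g' x - c') * fderiv ℝ η x (EuclideanSpace.single i 1))) := by
      refine tendsto_integral_of_dominated_convergence (fun _ => (B + K) * D')
        (fun N => (((hgm N).sub_const _).mul hd.measurable).aestronglyMeasurable)
        (integrable_const _) (fun N => ?_) ?_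
      · refine (ae_restrict_iff' hball).2 (ae_of_all _ fun x hx => ?_)
        rw [norm_mul]
        have h1 : ‖g N x - c N‖ ≤ B + K := by
          rw [Real.norm_eq_abs]
          exact (abs_sub _ _).trans (add_le_add (hgB N x hx) (hK N))
        exact mul_le_mul h1 (hD' x) (norm_nonneg _) ((norm_nonneg _).trans h1)
      · have hzero : ∀ᵐ x : Plane, x ≠ 0 := by
          simpa using measure_eq_zero_iff_ae_notMem.1 (measure_singleton (0 : Plane))
        filter_upwards [ae_restrict_of_ae hzero, ae_restrict_mem hball] with x hx hxb
        exact ((hg x hxb hx).sub hc).mul_const _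
    have hint : ∀ {F : Plane → Plane}, MemLp F 2 μ → Integrable (fun x => F x i * η x) μ := by
      intro F hF
      have h1 : Integrable (fun x => F x i) μ :=
        (hF.integrable (by norm_num)).mono
          ((EuclideanSpace.proj (𝕜 := ℝ) i).continuous.comp_aestronglyMeasurable hF.1)
          (ae_of_all _ fun x => PiLp.norm_apply_le _ i)
      exact h1.mul_bdd hηcont.aestronglyMeasurable (ae_of_all _ hD)
    -- On a disk L² convergence implies L¹ convergence, and η is bounded.
    have hright : Filter.Tendsto (fun N => ∫ x in Metric.ball (0 : Plane) R, G N x i * η x)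
        Filter.atTop (nhds (∫ x in Metric.ball (0 : Plane) R, Γ x i * η x)) := by
      refine tendsto_integral_of_L1' _ (hint (Lp.memLp Γ)).1 (Filter.Eventually.of_forall
        fun N => hint (hGm N)) ?_
      have hbound : ∀ N, eLpNorm ((fun x => G N x i * η x) - fun x => Γ x i * η x) 1 μ
          ≤ ENNReal.ofReal D * (eLpNorm (fun x => G N x - Γ x) 2 μ
            * μ Set.univ ^ (1 / (1 : ℝ≥0∞).toReal - 1 / (2 : ℝ≥0∞).toReal)) := fun N => by
        refine (eLpNorm_le_mul_eLpNorm_of_ae_le_mul (c := D) (g := fun x => G N x - Γ x)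
          (ae_of_all _ fun x => ?_) 1).trans ?_
        · rw [Pi.sub_apply, ← sub_mul, norm_mul, mul_comm]
          exact mul_le_mul (hD x) (PiLp.norm_apply_le (G N x - Γ x) i) (norm_nonneg _)
            ((norm_nonneg _).trans (hD x))
        · gcongr
          exact eLpNorm_le_eLpNorm_mul_rpow_measure_univ (by norm_num)
            ((hGm N).1.sub (Lp.aestronglyMeasurable Γ))
      have hfin : μ Set.univ ^ (1 / (1 : ℝ≥0∞).toReal - 1 / (2 : ℝ≥0∞).toReal) ≠ ⊤ :=
        ENNReal.rpow_ne_top_of_nonneg (by norm_num) (measure_ne_top _ _)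
      have := ENNReal.Tendsto.const_mul (a := ENNReal.ofReal D)
        (ENNReal.Tendsto.mul_const hsub (Or.inr hfin)) (Or.inr ENNReal.ofReal_ne_top)
      rw [zero_mul, mul_zero] at this
      exact tendsto_of_tendsto_of_tendsto_of_le_of_le tendsto_const_nhds this (fun _ => zero_le)
        hbound
    refine tendsto_nhds_unique hleft ?_
    exact hright.neg.congr fun N => (hweak N η hη hηc i).symm

/-! ### The scattering length as a limit over bounded potentials -/

lemma IsTrialFunction.scatteringEnergy_le {R : ℝ} {g : Plane → ℝ} {G : Plane → Plane}
    (h : IsTrialFunction R g G) {v : ℝ → ℝ≥0∞} : scatteringEnergy v R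
      ≤ ∫⁻ x in Metric.ball (0 : Plane) R, (‖G x‖ₑ ^ 2 + v ‖x‖ / 2 * ‖g x‖ₑ ^ 2) := by
  unfold scatteringEnergy
  exact iInf_le_of_le g (iInf_le_of_le G (iInf_le _ h))

section Limit

variable {R₀ R : ℝ} {W φ m : ℕ → ℝ → ℝ}

/-- A larger potential gives a smaller boundary value, so the sequence decreases. It stays above
log(R / R₀) because φ(R₀) > 0, which keeps the limit positive. -/
lemma exists_boundary_limit (hs : ∀ N, IsScatteringSolution R₀ (W N) (φ N) (m N))
    (hmono : ∀ N M, N ≤ M → ∀ r, W N r ≤ W M r) (hR₀ : 0 < R₀) (hR : R₀ < R) :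
    ∃ l, 0 < l ∧ (∀ N, l ≤ φ N R) ∧
      Filter.Tendsto (fun N => φ N R) Filter.atTop (nhds l) := by
  have hanti : Antitone fun N => φ N R := fun N M h =>
    (hs N).le_of_potential_le (hs M) (hmono N M h) (hR₀.trans hR).le hR.le
  have hlow : ∀ N, Real.log (R / R₀) ≤ φ N R := fun N => by
    rw [(hs N).eq_add_log hR₀ le_rfl hR.le]
    linarith [(hs N).pos R₀]
  have hbdd : BddBelow (Set.range fun N => φ N R) :=
    ⟨_, Set.forall_mem_range.2 hlow⟩
  refine ⟨⨅ N, φ N R, (Real.log_pos ((one_lt_div hR₀).2 hR)).trans_le (le_ciInf hlow),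
    fun N => ciInf_le hbdd N, tendsto_atTop_ciInf hanti hbdd⟩

/-- Convergence at R forces a Cauchy sequence at every fixed r > 0 by `abs_sub_le`. That bound
degenerates as r tends to 0, and the origin is a null set in the plane. -/
lemma exists_pointwise_limit (hs : ∀ N, IsScatteringSolution R₀ (W N) (φ N) (m N))
    (hmono : ∀ N M, N ≤ M → ∀ r, W N r ≤ W M r) (hR : R₀ < R) {l : ℝ} (hl : ∀ N, l ≤ φ N R)
    (hlim : Filter.Tendsto (fun N => φ N R) Filter.atTop (nhds l)) {r : ℝ} (hr0 : 0 < r)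
    (hrR : r ≤ R) : ∃ y, Filter.Tendsto (fun N => φ N r) Filter.atTop (nhds y) := by
  refine cauchySeq_tendsto_of_complete (Metric.cauchySeq_iff'.2 fun δ hδ => ?_)
  have hRpos : 0 < R := hr0.trans_le hrR
  -- Chosen so that the term R / (2κr) is δ / 2. With κ fixed, N₀ makes the other term smaller than
  -- δ / 2.
  set κ : ℝ := R / (r * δ) with hκ
  have hκ0 : 0 < κ := by positivity
  have hκ1 : R / (2 * κ * r) = δ / 2 := by
    rw [hκ]
    field_simp
  have hev : ∀ᶠ N in Filter.atTop, φ N R < l + δ / (2 * (1 + κ / 2)) :=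
    hlim.eventually (gt_mem_nhds (by linarith [show 0 < δ / (2 * (1 + κ / 2)) by positivity]))
  obtain ⟨N₀, hN₀⟩ := hev.exists
  refine ⟨N₀, fun N hN => ?_⟩
  rw [dist_comm, Real.dist_eq]
  refine ((hs N₀).abs_sub_le (hs N) (hmono N₀ N hN) hR.le hr0 hrR hκ0).trans_lt ?_
  rw [hκ1]
  have h1 : (1 + κ / 2) * (φ N₀ R - φ N R) < (1 + κ / 2) * (δ / (2 * (1 + κ / 2))) := by
    have := hl N
    exact mul_lt_mul_of_pos_left (by linarith) (by positivity)
  have h2 : (1 + κ / 2) * (δ / (2 * (1 + κ / 2))) = δ / 2 := by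
    field_simp
  linarith

/-- The solutions, divided by l, converge to a function with boundary value 1. The energies 2π
φ_N(R) tend to 2π l. In the limit the gradient parts converge and Fatou's lemma bounds the potential
part, so the limit has energy at most 2π l / l² = 2π / l. -/
lemma scatteringEnergy_le (hs : ∀ N, IsScatteringSolution R₀ (W N) (φ N) (m N))
    (hmono : ∀ N M, N ≤ M → ∀ r, W N r ≤ W M r) (hR₀ : 0 < R₀) (hR : R₀ < R)
    {v : ℝ → ℝ≥0∞}
    (hv : ∀ r, 0 < r → Filter.Tendsto (fun N => ENNReal.ofReal (W N r)) Filter.atTop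
      (nhds (v r / 2))) {l : ℝ} (hl0 : 0 < l) (hl : ∀ N, l ≤ φ N R)
    (hlim : Filter.Tendsto (fun N => φ N R) Filter.atTop (nhds l)) :
    scatteringEnergy v R ≤ ENNReal.ofReal (2 * Real.pi / l) := by
  have hRpos : 0 < R := hR₀.trans hR
  set μ : Measure Plane := volume.restrict (Metric.ball (0 : Plane) R) with hμ
  have : IsFiniteMeasure μ := isFiniteMeasure_restrict.2 measure_ball_lt_top.ne
  have hball : MeasurableSet (Metric.ball (0 : Plane) R) := Metric.isOpen_ball.measurableSet
  have hex : ∀ r, ∃ y, 0 < r → r ≤ R →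
      Filter.Tendsto (fun N => φ N r) Filter.atTop (nhds y) := fun r => by
    by_cases h : 0 < r ∧ r ≤ R
    · obtain ⟨y, hy⟩ := exists_pointwise_limit hs hmono hR hl hlim h.1 h.2
      exact ⟨y, fun _ _ => hy⟩
    · exact ⟨0, fun h1 h2 => absurd ⟨h1, h2⟩ h⟩
  choose Φ hΦ using hex
  have hae : ∀ᵐ x ∂μ, x ∈ Metric.ball (0 : Plane) R ∧ x ≠ 0 := by
    have hzero : ∀ᵐ x : Plane, x ≠ 0 := by
      simpa using measure_eq_zero_iff_ae_notMem.1 (measure_singleton (0 : Plane))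
    filter_upwards [ae_restrict_of_ae hzero, ae_restrict_mem hball] with x hx hxb
    exact ⟨hxb, hx⟩
  have hΦx : ∀ x ∈ Metric.ball (0 : Plane) R, x ≠ 0 →
      Filter.Tendsto (fun N => φ N ‖x‖) Filter.atTop (nhds (Φ ‖x‖)) := fun x hx hx0 =>
    hΦ _ (norm_pos_iff.2 hx0) (mem_ball_zero_iff.1 hx).le
  have hbound : ∀ N, ∀ x ∈ Metric.ball (0 : Plane) R, |φ N ‖x‖| ≤ φ 0 R := fun N x hx => by
    rw [abs_of_pos ((hs N).pos _)]
    exact ((hs N).le_boundary (norm_nonneg x) (mem_ball_zero_iff.1 hx).le).trans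
      ((hs 0).le_of_potential_le (hs N) (hmono 0 N (Nat.zero_le N)) hRpos.le hR.le)
  have hmeas : ∀ N, Measurable fun x : Plane => φ N ‖x‖ := fun N =>
    ((hs N).continuous.comp continuous_norm).measurable
  have hΦm : AEStronglyMeasurable (fun x : Plane => Φ ‖x‖) μ :=
    aestronglyMeasurable_of_tendsto_ae Filter.atTop (fun N => (hmeas N).aestronglyMeasurable)
      (hae.mono fun x hx => hΦx x hx.1 hx.2)
  have hΦL : MemLp (fun x : Plane => Φ ‖x‖) 2 μ :=
    MemLp.of_bound hΦm (φ 0 R) (hae.mono fun x hx =>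
      le_of_tendsto' (hΦx x hx.1 hx.2).abs fun N => hbound N x hx.1)
  obtain ⟨G, hGL, hGlim, hGweak⟩ := exists_weak_grad_limit (R := R) (g := fun N x => φ N ‖x‖)
    (G := fun N => radialGrad (m N)) (c := fun N => φ N R) (g' := fun x => Φ ‖x‖) hmeas hbound
    hΦx hlim (fun N => (hs N).memLp_radialGrad R) (fun δ hδ => by
      have h1 : Filter.Tendsto (fun N => ENNReal.ofReal (2 * Real.pi * (φ N R - l)))
          Filter.atTop (nhds 0) := by
        have := ENNReal.tendsto_ofReal ((hlim.sub_const l).const_mul (2 * Real.pi))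
        simpa using this
      have hδ2 : 0 < δ ^ 2 := pos_iff_ne_zero.2 (pow_ne_zero 2 hδ.ne')
      obtain ⟨N₀, hN₀⟩ := Filter.eventually_atTop.1 (h1.eventually (gt_mem_nhds hδ2))
      refine ⟨N₀, fun N hN M hM => ?_⟩
      refine lt_of_pow_lt_pow_left' 2 (lt_of_le_of_lt ?_ (hN₀ N hN))
      refine ((hs N).eLpNorm_radialGrad_sub_sq_le (hs M) (hmono N M hM) hRpos.le hR.le).trans
        (ENNReal.ofReal_le_ofReal ?_)
      have := hl M
      gcongr) (fun N η hη hηc i => (hs N).weak_grad hRpos hη hηc i)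
  set A : ℕ → ℝ≥0∞ := fun N => eLpNorm (radialGrad (m N)) 2 μ ^ 2 with hA
  set P : ℕ → ℝ≥0∞ := fun N => ∫⁻ x in Metric.ball (0 : Plane) R,
    ENNReal.ofReal (W N ‖x‖) * ENNReal.ofReal (φ N ‖x‖) ^ 2 with hP
  have hAP : ∀ N, A N + P N = ENNReal.ofReal (2 * Real.pi * φ N R) := fun N =>
    (hs N).energy_eq hRpos.le hR.le
  have hAlim : Filter.Tendsto A Filter.atTop (nhds (eLpNorm G 2 μ ^ 2)) :=
    ((ENNReal.continuous_pow 2).tendsto _).comp hGlim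
  have hElim : Filter.Tendsto (fun N => ENNReal.ofReal (2 * Real.pi * φ N R)) Filter.atTop
      (nhds (ENNReal.ofReal (2 * Real.pi * l))) :=
    ENNReal.tendsto_ofReal (hlim.const_mul _)
  have hPlim : Filter.Tendsto P Filter.atTop
      (nhds (ENNReal.ofReal (2 * Real.pi * l) - eLpNorm G 2 μ ^ 2)) := by
    refine (ENNReal.Tendsto.sub hElim hAlim (Or.inl ENNReal.ofReal_ne_top)).congr fun N => ?_
    rw [← hAP N]
    exact ENNReal.add_sub_cancel_left (ENNReal.pow_ne_top ((hs N).memLp_radialGrad R).eLpNorm_ne_top)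
  have hAle : eLpNorm G 2 μ ^ 2 ≤ ENNReal.ofReal (2 * Real.pi * l) :=
    le_of_tendsto_of_tendsto' hAlim hElim fun N => by
      rw [← hAP N]
      exact le_self_add
  have hfatou : ∫⁻ x in Metric.ball (0 : Plane) R, v ‖x‖ / 2 * ‖Φ ‖x‖‖ₑ ^ 2
      ≤ ENNReal.ofReal (2 * Real.pi * l) - eLpNorm G 2 μ ^ 2 := by
    rw [← hPlim.liminf_eq]
    refine le_trans (lintegral_mono_ae ?_) (lintegral_liminf_le fun N =>
      ((hs N).measurable.ennreal_ofReal.comp measurable_norm).mul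
        ((hmeas N).ennreal_ofReal.pow_const 2))
    filter_upwards [hae] with x hx
    -- Where v is infinite the limit of the products could fail to be the product of limits, but if
    -- Φ = 0 the left side is ∞ · 0 = 0. If Φ > 0 the product converges even when v = ∞.
    by_cases h0 : Φ ‖x‖ = 0
    · simp [h0]
    have hpos : 0 < Φ ‖x‖ := lt_of_le_of_ne
      (ge_of_tendsto' (hΦx x hx.1 hx.2) fun N => ((hs N).pos _).le) (Ne.symm h0)
    rw [Real.enorm_of_nonneg hpos.le]
    refine (Filter.Tendsto.liminf_eq (ENNReal.Tendsto.mul (hv _ (norm_pos_iff.2 hx.2))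
      (Or.inr (ENNReal.pow_ne_top ENNReal.ofReal_ne_top))
      (((ENNReal.continuous_pow 2).tendsto _).comp
        (ENNReal.tendsto_ofReal (hΦx x hx.1 hx.2)))
      (Or.inl (pow_ne_zero 2 (ENNReal.ofReal_pos.2 hpos).ne')))).ge
  have htrial : IsTrialFunction R (fun x => l⁻¹ * Φ ‖x‖) (fun x => l⁻¹ • G x) := by
    refine ⟨hΦL.const_mul _, hGL.const_smul l⁻¹, fun η hη hηc i => ?_⟩
    have h1 : ∀ x : Plane, (l⁻¹ * Φ ‖x‖ - 1) * fderiv ℝ η x (EuclideanSpace.single i 1)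
        = l⁻¹ * ((Φ ‖x‖ - l) * fderiv ℝ η x (EuclideanSpace.single i 1)) := fun x => by
      field_simp
    have h2 : ∀ x : Plane, (l⁻¹ • G x) i * η x = l⁻¹ * (G x i * η x) := fun x => by
      rw [PiLp.smul_apply, smul_eq_mul, mul_assoc]
    simp only [h1, h2]
    rw [integral_const_mul, integral_const_mul, hGweak η hη hηc i, mul_neg]
  refine htrial.scatteringEnergy_le.trans ?_
  have h1 : ∀ x : Plane, ‖l⁻¹ • G x‖ₑ ^ 2 + v ‖x‖ / 2 * ‖l⁻¹ * Φ ‖x‖‖ₑ ^ 2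
      = ENNReal.ofReal (l⁻¹ ^ 2) * (‖G x‖ₑ ^ 2 + v ‖x‖ / 2 * ‖Φ ‖x‖‖ₑ ^ 2) := fun x => by
    rw [enorm_smul, enorm_mul, Real.enorm_of_nonneg (inv_pos.2 hl0).le,
      ENNReal.ofReal_pow (inv_pos.2 hl0).le]
    ring
  simp only [h1]
  rw [lintegral_const_mul' _ _ ENNReal.ofReal_ne_top,
    lintegral_add_left' (hGL.1.enorm.pow_const 2), ← eLpNorm_two_sq]
  calc _ ≤ ENNReal.ofReal (l⁻¹ ^ 2) * ENNReal.ofReal (2 * Real.pi * l) := by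
        gcongr
        exact (add_le_add_right hfatou _).trans (add_tsub_cancel_of_le hAle).le
    _ = ENNReal.ofReal (2 * Real.pi / l) := by
        rw [← ENNReal.ofReal_mul (by positivity)]
        congr 1
        field_simp

end Limit

/-! ### Truncated potentials and the logarithmic bound -/

/-- The potential `v / 2` cut off at height `N + 1`. -/
noncomputable def truncatedPotential (R₀ : ℝ) (v : ℝ → ℝ≥0∞) (N : ℕ) : ℝ → ℝ :=
  (Set.Ioc 0 R₀).indicator fun r => (min (v r / 2) (N + 1)).toReal

section Truncation

variable {R₀ : ℝ} {v : ℝ → ℝ≥0∞}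

lemma min_natCast_add_one_ne_top (N : ℕ) (r : ℝ) : min (v r / 2) ((N : ℝ≥0∞) + 1) ≠ ⊤ :=
  ne_top_of_le_ne_top (by simp) (min_le_right _ _)

lemma measurable_truncatedPotential (hv : Measurable v) (N : ℕ) :
    Measurable (truncatedPotential R₀ v N) :=
  (((hv.div_const 2).min measurable_const).ennreal_toReal).indicator measurableSet_Ioc

lemma truncatedPotential_nonneg (N : ℕ) (r : ℝ) : 0 ≤ truncatedPotential R₀ v N r :=
  Set.indicator_nonneg (fun _ _ => ENNReal.toReal_nonneg) r

lemma truncatedPotential_le (N : ℕ) (r : ℝ) : truncatedPotential R₀ v N r ≤ N + 1 := by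
  refine Set.indicator_le' (g := fun _ => (N : ℝ) + 1) (fun r _ => ?_) (fun _ _ => by positivity) r
  refine ENNReal.toReal_le_of_le_ofReal (by positivity) ((min_le_right _ _).trans (le_of_eq ?_))
  rw [ENNReal.ofReal_add (by positivity) zero_le_one]
  simp

lemma truncatedPotential_mono {N M : ℕ} (h : N ≤ M) (r : ℝ) :
    truncatedPotential R₀ v N r ≤ truncatedPotential R₀ v M r := by
  refine Set.indicator_le_indicator (ENNReal.toReal_mono (min_natCast_add_one_ne_top M r)
    (min_le_min_left _ ?_))
  gcongr

lemma ofReal_truncatedPotential {r : ℝ} (hr : r ∈ Set.Ioc 0 R₀) (N : ℕ) :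
    ENNReal.ofReal (truncatedPotential R₀ v N r) = min (v r / 2) (N + 1) := by
  rw [truncatedPotential, Set.indicator_of_mem hr, ENNReal.ofReal_toReal (min_natCast_add_one_ne_top N r)]

lemma ofReal_truncatedPotential_le (N : ℕ) (r : ℝ) :
    ENNReal.ofReal (truncatedPotential R₀ v N r) ≤ v r / 2 := by
  by_cases hr : r ∈ Set.Ioc 0 R₀
  · rw [ofReal_truncatedPotential hr]
    exact min_le_left _ _
  · simp [truncatedPotential, Set.indicator_of_notMem hr]

lemma tendsto_truncatedPotential (hv_range : ∀ r, R₀ < r → v r = 0) {r : ℝ} (hr : 0 < r) :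
    Filter.Tendsto (fun N => ENNReal.ofReal (truncatedPotential R₀ v N r)) Filter.atTop
      (nhds (v r / 2)) := by
  rcases le_or_gt r R₀ with h | h
  · simp only [ofReal_truncatedPotential (show r ∈ Set.Ioc 0 R₀ from ⟨hr, h⟩)]
    have h1 : Filter.Tendsto (fun N : ℕ => (N : ℝ≥0∞) + 1) Filter.atTop (nhds ⊤) := by
      refine tendsto_of_tendsto_of_tendsto_of_le_of_le ENNReal.tendsto_nat_nhds_top
        tendsto_const_nhds (fun N => le_self_add) (fun N => le_top)
    simpa using tendsto_const_nhds.min h1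
  · have : ∀ N, truncatedPotential R₀ v N r = 0 := fun N =>
      Set.indicator_of_notMem (fun hh => absurd hh.2 (not_le.2 h)) _
    simp [this, hv_range r h]

/-- A potential with a positive scattering length does not vanish. -/
lemma truncatedPotential_ne_zero (hv : Measurable v) (hv_range : ∀ r, R₀ < r → v r = 0)
    {R a : ℝ} (ha : IsScatteringLength v R a) (N : ℕ) :
    ¬ truncatedPotential R₀ v N =ᵐ[volume.restrict (Set.Ioc 0 R₀)] 0 := by
  intro h0
  obtain ⟨ha0, haR, hE⟩ := ha
  have hpos : 0 < scatteringEnergy v R := by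
    rw [hE, ENNReal.ofReal_pos]
    have := Real.log_pos ((one_lt_div ha0).2 haR)
    positivity
  refine hpos.ne' (le_antisymm ?_ zero_le)
  have : IsFiniteMeasure (volume.restrict (Metric.ball (0 : Plane) R)) :=
    isFiniteMeasure_restrict.2 measure_ball_lt_top.ne
  -- If a truncation vanished almost everywhere, so would v on (0, R), and the constant 1 would have
  -- energy 0. The scattering energy 2π / log(R / a) is positive.
  have htrial : IsTrialFunction R (fun _ => 1) (fun _ => 0) :=
    ⟨memLp_const 1, MemLp.zero', fun η _ _ i => by simp⟩
  refine htrial.scatteringEnergy_le.trans ?_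
  simp only [enorm_zero, enorm_one, one_pow, mul_one, ne_eq, OfNat.ofNat_ne_zero,
    not_false_eq_true, zero_pow, zero_add]
  rw [lintegral_ball_radial (f := fun r => v r / 2) (hv.div_const 2)]
  have hae : ∀ᵐ r ∂volume.restrict (Set.Ioo 0 R), v r / 2 * ENNReal.ofReal r = 0 := by
    rw [Filter.EventuallyEq, ae_restrict_iff' measurableSet_Ioc] at h0
    rw [ae_restrict_iff' measurableSet_Ioo]
    filter_upwards [h0] with r hr hrR
    rcases le_or_gt r R₀ with h | h
    · have hm : r ∈ Set.Ioc 0 R₀ := ⟨hrR.1, h⟩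
      have h1 := ofReal_truncatedPotential (v := v) hm N
      -- The cutoff height N + 1 is nonzero also for N = 0, so a vanishing minimum means v(r) = 0.
      rw [hr hm, Pi.zero_apply, ENNReal.ofReal_zero, eq_comm, min_eq_iff] at h1
      rcases h1 with h1 | h1
      · rw [h1.1, zero_mul]
      · simp at h1
    · simp [hv_range r h]
  rw [lintegral_congr_ae hae, lintegral_zero, mul_zero]

end Truncation

/-- A scattering length is at most the range of the potential, and bounded potentials below `v`
have scattering solutions close to `log (t / a)` outside the range. -/
theorem IsScatteringLength.exists_solution {R₀ : ℝ} {v : ℝ → ℝ≥0∞} (hR₀ : 0 < R₀)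
    (hv : Measurable v) (hv_range : ∀ r, R₀ < r → v r = 0) {R a : ℝ} (hR : R₀ < R)
    (ha : IsScatteringLength v R a) {δ : ℝ} (hδ : 0 < δ) :
    ∃ W φ m, IsScatteringSolution R₀ W φ m ∧ (∀ r, ENNReal.ofReal (W r) ≤ v r / 2) ∧
      ∀ t, R₀ ≤ t → φ t ≤ Real.log (t / a) + δ := by
  have hex : ∀ N, ∃ φ m, IsScatteringSolution R₀ (truncatedPotential R₀ v N) φ m := fun N =>
    exists_isScatteringSolution hR₀ (measurable_truncatedPotential hv N)
      (truncatedPotential_nonneg N) (truncatedPotential_le N)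
      (fun r hr => Set.indicator_of_notMem hr _)
      (truncatedPotential_ne_zero hv hv_range ha N)
  choose φ m hs using hex
  have hmono : ∀ N M, N ≤ M → ∀ r, truncatedPotential R₀ v N r ≤ truncatedPotential R₀ v M r :=
    fun N M h => truncatedPotential_mono h
  obtain ⟨l, hl0, hl, hlim⟩ := exists_boundary_limit hs hmono hR₀ hR
  have hE := scatteringEnergy_le hs hmono hR₀ hR
    (fun r hr => tendsto_truncatedPotential hv_range hr) hl0 hl hlim
  obtain ⟨ha0, haR, hEa⟩ := ha
  have hlog := Real.log_pos ((one_lt_div ha0).2 haR)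
  rw [hEa, ENNReal.ofReal_le_ofReal_iff (by positivity),
    div_le_div_iff_of_pos_left (by positivity) hlog hl0] at hE
  -- The comparison of energies gives l ≤ log(R / a), so φ_N(R) < log(R / a) + δ for some N. Beyond
  -- R₀ both φ_N and log(t / a) grow like log t, so the bound at R carries over to every t ≥ R₀.
  obtain ⟨N, hN⟩ := (hlim.eventually (gt_mem_nhds (lt_add_of_pos_right l hδ))).exists
  refine ⟨_, φ N, m N, hs N, ofReal_truncatedPotential_le N, fun t ht => ?_⟩
  have h1 := (hs N).eq_add_log hR₀ le_rfl hR.le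
  rw [(hs N).eq_add_log hR₀ le_rfl ht, Real.log_div (hR₀.trans_le ht).ne' hR₀.ne',
    Real.log_div (hR₀.trans_le ht).ne' ha0.ne']
  rw [Real.log_div (hR₀.trans hR).ne' hR₀.ne'] at h1
  rw [Real.log_div (hR₀.trans hR).ne' ha0.ne'] at hE
  linarith

/-- At t = R₀ the approximating solutions are positive and at most log(R₀ / a) + δ, for every δ > 0.
-/
theorem IsScatteringLength.le_range {R₀ : ℝ} {v : ℝ → ℝ≥0∞} (hR₀ : 0 < R₀)
    (hv : Measurable v) (hv_range : ∀ r, R₀ < r → v r = 0) {R a : ℝ} (hR : R₀ < R)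
    (ha : IsScatteringLength v R a) : a ≤ R₀ := by
  have h1 : 0 ≤ Real.log (R₀ / a) := le_of_forall_pos_le_add fun δ hδ => by
    obtain ⟨W, φ, m, hs, -, hφ⟩ := ha.exists_solution hR₀ hv hv_range hR hδ
    exact (hs.pos R₀).le.trans (hφ R₀ le_rfl)
  by_contra! h
  exact absurd h1 (not_le.2 (Real.log_neg (div_pos hR₀ ha.1) ((div_lt_one ha.1).2 h)))

end Dyson

/-- Two-dimensional Dyson lemma. The operator inequality is an inequality between quadratic forms
with values in `[0, ∞]`, for all `ψ ∈ L²`, with the negative term moved to the left side of `≥`.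
For `ε ≥ 1` the factor `ENNReal.ofReal (1 - ε)` is `0`: a right side without positive part. -/
theorem lemma3
    -- side length of the torus, range of the interaction, range of the soft potential
    (L R₀ R : ℝ) (hR₀ : 0 < R₀) (hR₀R : R₀ < R) (hRL : R < L / 2)
    -- interaction potential of range `R₀`, and its scattering length
    (v : ℝ → ℝ≥0∞) (hv : Measurable v) (hv_range : ∀ r, R₀ < r → v r = 0)
    (a R₁ : ℝ) (hR₁ : R₀ < R₁) (ha : IsScatteringLength v R₁ a)
    -- radial momentum cutoff with values in `[0, 1]`, tending to `1` fast enough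
    (χ : Plane → ℝ) (hχ : ∀ p, χ p ∈ Set.Icc 0 1) (hχ_radial : ∀ p q, ‖p‖ = ‖q‖ → χ p = χ q)
    (hχ_sum : Summable fun k : Fin 2 → ℤ => 1 - χ (momentum L k))
    -- soft potential
    (U : ℝ → ℝ≥0) (hU : Measurable U) (hU_supp : ∀ t, t ∉ Set.Icc R₀ R → U t = 0)
    (hU_int : ∫⁻ t in Set.Icc R₀ R, (U t : ℝ≥0∞) * ENNReal.ofReal (Real.log (t / a) * t) ≤ 1)
    -- the points, and the index of a nearest point to `x`
    (n : ℕ) (y : Fin n → Plane) (NN : Plane → Fin n)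
    (hNN : ∀ x i, torusDist L x (y (NN x)) ≤ torusDist L x (y i))
    (ε : ℝ) (hε : 0 < ε)
    (ψ : Plane → ℂ) (hψ : MemLp ψ 2 (volume.restrict (torus L))) :
    kineticForm L χ ψ
        + potentialForm L (fun x => 1 / 2 * ∑ i, v (torusDist L x (y i))) ψ
        + ENNReal.ofReal (1 / ε) * (∫⁻ t in Set.Ioi 0, (U t : ℝ≥0∞) * ENNReal.ofReal t)
            * potentialForm L (fun x => ∑ i, weightW L χ R (x - y i)) ψ
      ≥ ENNReal.ofReal (1 - ε)
          * potentialForm L (fun x => (U (torusDist L x (y (NN x))) : ℝ≥0∞)) ψ := by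
  exact dyson_of_approx hR₀ hR₀R hRL ha.1 (ha.le_range hR₀ hv hv_range hR₁)
    (fun _ hδ => ha.exists_solution hR₀ hv hv_range hR₁ hδ) hχ hχ_radial hχ_sum hU hU_supp hU_int
    hNN hε hψ
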